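/- A \emph{partial field} is a set $P$ with distinguished elements $0,1$, a multiplication, and a partially defined addition, such that: $P\setminus\{0\}$ is an abelian group under multiplication with identity $1$ (and $0\cdot p=0$); $p+0=p$; every $p$ has a unique $-p$ with $p+(-p)=0$; if $p+q$ is defined, then $q+p$ is defined and equal to it; for $p\neq 0$, $p(q+r)$ is defined if and only if $pq+pr$ is defined, and then they are equal; and addition is associative in the following sense: whenever a finite multiset $S$ can be summed along some binary tree (all intermediate sums being defined) with result $r$, and $u$, $w$ are results of summing the two parts of a partition of $S$ into two non-empty multisets along binary trees, then $u+w$ is defined and equal to $r$. Every field is a partial field. For a commutative ring $R\ne 0$ and a set $S$ of units of $R$, $\mathbb{P}(R,S)$ denotes the partial field with underlying set $\langle S\cup\{-1\}\rangle\cup\{0\}$ (where $\langle\cdot\rangle$ is the generated multiplicative group), with the operations of $R$, where $p+q$ is defined if and only if the sum in $R$ lies in this set. For partial fields $\mathbb{P}_1,\mathbb{P}_2$, the partial field $\mathbb{P}_1\otimes\mathbb{P}_2$ has underlying set $\{(p_1,p_2)\in \mathbb{P}_1\times \mathbb{P}_2 : p_1\ne 0 \Leftrightarrow p_2\neq 0\}$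 and componentwise operations, where $(p_1,p_2)+(q_1,q_2)$ is defined if and only if $p_1+q_1$ and $p_2+q_2$ are both defined and they are either both zero or both nonzero. A sum $p_1+\cdots+p_n$ in a partial field $\mathbb{P}$ is \emph{defined}, with value $r$, if for some finite multiset $Z=\{z_1,-z_1,\ldots,z_k,-z_k\}$ the multiset $\{p_1,\ldots,p_n\}\cup Z$ can be summed along some binary tree with result $r$; the determinant of a square matrix $A$ over $\mathbb{P}$ is defined if the sum $\sum_\sigma \operatorname{sgn}(\sigma)\prod_i a_{i\sigma(i)}$ is. A \emph{$\mathbb{P}$-matrix} is a matrix over $\mathbb{P}$ all of whose square submatrices have a defined determinant; its rank is the largest size of a square submatrix with nonzero determinant. A matroid $M$ (on a finite ground set $E$) is \emph{representable over $\mathbb{P}$} if, for some $r$, there is an $r\times E$ $\mathbb{P}$-matrix $A$ of rank $r$ such that the bases of $M$ are precisely the sets $B\subseteq E$ with $|B|=r$ for which the $r\times r$ submatrix of $A$ with columns $B$ has nonzero determinant. Let $\mathbb{H}_2:=\mathbb{P}(\mathbb{C},\{i,1-i\})$ with $i^2=-1$, and let $\mathbb{K}_2:=\mathbb{P}(\mathbb{Q}(\alpha),\{\alpha,\alpha-1,\alpha+1\})$,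 where $\alpha$ is an indeterminate. \textbf{Theorem.} Let $M$ be a matroid. The following are equivalent: (i) $M$ is representable over $\mathrm{GF}(4)\otimes\mathbb{H}_2$; (ii) $M$ is representable over $\mathbb{K}_2$. -/

import Mathlib

/-- An association of a finite multiset `S` with root label `r`, for a partial binary operation
`padd` on `P`: there is a binary tree whose leaves are labelled by the elements of `S`, in which
each inner node is labelled by the (defined) sum of the labels of its two children, and whose root
is labelled `r`. -/
inductive Association {P : Type*} (padd : P → P → Part P) : Multiset P → P → Prop
  | leaf (p : P) : Association padd {p} p
  | node {S T : Multiset P} {u w r : P} :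
      Association padd S u → Association padd T w → r ∈ padd u w → Association padd (S + T) r

/-- A partial field: `P \ {0}` is an abelian group under multiplication (and `0 * p = 0`), and
addition is a partial binary operation `padd`. The statement `r ∈ padd p q` reads
"`p + q` is defined and equal to `r`". -/
class PartialField (P : Type*) extends CommGroupWithZero P, Neg P where
  /-- The partial addition. -/
  padd : P → P → Part P
  padd_zero : ∀ p : P, padd p 0 = Part.some p
  zero_mem_padd_neg : ∀ p : P, 0 ∈ padd p (-p)
  eq_neg_of_zero_mem_padd : ∀ p q : P, 0 ∈ padd p q → q = -p
  padd_comm : ∀ p q : P, padd p q = padd q p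
  mul_padd : ∀ p q r : P, p ≠ 0 → padd (p * q) (p * r) = (padd q r).map (fun s => p * s)
  /-- The associative law: if `S` has an association with root `r`, and a pre-association of `S`
  has labels `u` and `w` at the two children of its root, then `u + w` is defined and equals `r`. -/
  associative_law : ∀ (S T : Multiset P) (r u w : P), Association padd (S + T) r →
    Association padd S u → Association padd T w → r ∈ padd u w

namespace PartialField

/-! ### Sums, determinants, matrices -/

/-- The sum of the elements of the multiset `S` is defined, with value `r`: there is a finite
multiset `{z₁, -z₁, …, zₖ, -zₖ}` whose union with `S` has an association with root `r`. -/
def SumIs {P : Type*} [PartialField P] (S : Multiset P) (r : P) : Prop :=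
  ∃ Z : Multiset P, Association padd (S + (Z + Z.map (fun z => -z))) r

/-- The determinant of the square matrix `A` is defined, with value `d`. -/
def DetIs {P : Type*} [PartialField P] {k : ℕ} (A : Matrix (Fin k) (Fin k) P) (d : P) : Prop :=
  SumIs ((Finset.univ : Finset (Equiv.Perm (Fin k))).val.map (fun σ =>
    if Equiv.Perm.sign σ = 1 then ∏ i, A i (σ i) else -∏ i, A i (σ i))) d

/-- The determinant of `A` is defined and nonzero. -/
def DetNeZero {P : Type*} [PartialField P] {k : ℕ} (A : Matrix (Fin k) (Fin k) P) : Prop :=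
  ∃ d : P, d ≠ 0 ∧ DetIs A d

/-- `A` is a matrix over the partial field `P` in the strong sense ("`P`-matrix"): the determinant
of every square submatrix is defined. -/
def IsPMatrix {P : Type*} [PartialField P] {X Y : Type*} (A : Matrix X Y P) : Prop :=
  ∀ (k : ℕ) (f : Fin k → X) (g : Fin k → Y), Function.Injective f → Function.Injective g →
    ∃ d : P, DetIs (A.submatrix f g) d

/-- The rank of a matrix with finitely many rows: the largest `k` such that there is a `k × k`
submatrix with nonzero determinant. -/
noncomputable def rank {P : Type*} [PartialField P] {r : ℕ} {Y : Type*}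
    (A : Matrix (Fin r) Y P) : ℕ :=
  sSup {k : ℕ | ∃ (f : Fin k → Fin r) (g : Fin k → Y), Function.Injective f ∧
    Function.Injective g ∧ DetNeZero (A.submatrix f g)}

/-- For an `r × E` matrix `A`, the family of those `B ⊆ E` with `|B| = r` for which the
determinant of the submatrix with columns `B` is nonzero. -/
def basesOf {P : Type*} [PartialField P] {α : Type*} {E : Set α} {r : ℕ}
    (A : Matrix (Fin r) E P) : Set (Set α) :=
  {B : Set α | ∃ g : Fin r → E, Function.Injective g ∧ Set.range (fun i => (g i : α)) = B ∧
    DetNeZero (A.submatrix id g)}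

/-- `M` is representable over the partial field `P`: there is an `r × E(M)` `P`-matrix `A` of
rank `r` such that `M = M[A]`. -/
def IsRepresentable (P : Type*) [PartialField P] {α : Type*} (M : Matroid α) : Prop :=
  ∃ (r : ℕ) (A : Matrix (Fin r) M.E P), IsPMatrix A ∧ rank A = r ∧
    ∀ B : Set α, M.IsBase B ↔ B ∈ basesOf A

/-! ### Fields -/

/-- If the partial addition is the restriction of an addition along `f`, the root of an
association is the sum of its leaves. -/
theorem map_association {P M : Type*} [AddCommMonoid M] {padd : P → P → Part P} (f : P → M)
    (hf : ∀ p q r : P, r ∈ padd p q → f r = f p + f q) {S : Multiset P} {r : P}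
    (h : Association padd S r) : f r = (S.map f).sum := by
  induction h with
  | leaf p => simp
  | node _ _ h ih₁ ih₂ => rw [hf _ _ _ h, ih₁, ih₂, Multiset.map_add, Multiset.sum_add]

/-- Every field is a partial field, with addition defined everywhere. -/
instance ofField (F : Type*) [Field F] : PartialField F where
  padd p q := Part.some (p + q)
  padd_zero p := by simp
  zero_mem_padd_neg p := by simp
  eq_neg_of_zero_mem_padd p q h := by
    rw [Part.mem_some_iff] at h
    exact eq_neg_of_add_eq_zero_right h.symm
  padd_comm p q := by rw [add_comm]
  mul_padd p q r _ := by simp [mul_add]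
  associative_law S T r u w h hS hT := by
    have key : ∀ p q r : F, r ∈ Part.some (p + q) → id r = id p + id q := by
      intro p q r h
      simpa using h
    have h₁ := map_association id key h
    have h₂ := map_association id key hS
    have h₃ := map_association id key hT
    simp only [id_eq, Multiset.map_id', Multiset.sum_add] at h₁ h₂ h₃
    rw [Part.mem_some_iff, h₁, h₂, h₃]

end PartialField

/-! ### Partial fields from rings -/

/-- The underlying set `⟨S ∪ {-1}⟩ ∪ {0}` of the partial field `ℙ(R, S)`, where `S` is a set of
units of the commutative ring `R`. -/
@[ext]
structure RingPartialField (R : Type*) [CommRing R] (S : Set Rˣ) where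
  /-- The element as an element of `R`. -/
  val : R
  property : val = 0 ∨ ∃ u ∈ Subgroup.closure (S ∪ {-1}), (u : R) = val

namespace RingPartialField

variable {R : Type*} [CommRing R] {S : Set Rˣ}

theorem closed_mul {x y : R} (hx : x = 0 ∨ ∃ u ∈ Subgroup.closure (S ∪ {-1}), (u : R) = x)
    (hy : y = 0 ∨ ∃ u ∈ Subgroup.closure (S ∪ {-1}), (u : R) = y) :
    x * y = 0 ∨ ∃ u ∈ Subgroup.closure (S ∪ {-1}), (u : R) = x * y := by
  rcases hx with rfl | ⟨u, hu, rfl⟩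
  · simp
  rcases hy with rfl | ⟨v, hv, rfl⟩
  · simp
  exact Or.inr ⟨u * v, Subgroup.mul_mem _ hu hv, by simp⟩

theorem closed_neg {x : R} (hx : x = 0 ∨ ∃ u ∈ Subgroup.closure (S ∪ {-1}), (u : R) = x) :
    -x = 0 ∨ ∃ u ∈ Subgroup.closure (S ∪ {-1}), (u : R) = -x := by
  rcases hx with rfl | ⟨u, hu, rfl⟩
  · simp
  refine Or.inr ⟨-1 * u, Subgroup.mul_mem _ (Subgroup.subset_closure (by simp)) hu, by simp⟩

theorem closed_inv {x : R} (hx : x = 0 ∨ ∃ u ∈ Subgroup.closure (S ∪ {-1}), (u : R) = x) :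
    Ring.inverse x = 0 ∨ ∃ u ∈ Subgroup.closure (S ∪ {-1}), (u : R) = Ring.inverse x := by
  rcases hx with rfl | ⟨u, hu, rfl⟩
  · simp
  exact Or.inr ⟨u⁻¹, Subgroup.inv_mem _ hu, by simp⟩

/-- The partial addition of `ℙ(R, S)`: `x + y` is defined if and only if the sum in `R` lies in
`⟨S ∪ {-1}⟩ ∪ {0}`. -/
def add (x y : RingPartialField R S) : Part (RingPartialField R S) :=
  ⟨x.val + y.val = 0 ∨ ∃ u ∈ Subgroup.closure (S ∪ {-1}), (u : R) = x.val + y.val,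
    fun h => ⟨x.val + y.val, h⟩⟩

theorem mem_add {x y z : RingPartialField R S} : z ∈ add x y ↔ z.val = x.val + y.val :=
  by
  constructor
  · rintro ⟨_, rfl⟩
    rfl
  · intro h
    have hz := z.property
    rw [h] at hz
    exact ⟨hz, RingPartialField.ext h.symm⟩

/-- The partial field `ℙ(R, S)`: multiplication and addition are the restrictions of those
of `R`. -/
noncomputable instance [Nontrivial R] : PartialField (RingPartialField R S) where
  zero := ⟨0, Or.inl rfl⟩
  one := ⟨1, Or.inr ⟨1, one_mem _, by simp⟩⟩
  mul x y := ⟨x.val * y.val, closed_mul x.property y.property⟩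
  neg x := ⟨-x.val, closed_neg x.property⟩
  inv x := ⟨Ring.inverse x.val, closed_inv x.property⟩
  padd := add
  mul_assoc x y z := RingPartialField.ext (mul_assoc x.val y.val z.val)
  mul_comm x y := RingPartialField.ext (mul_comm x.val y.val)
  one_mul x := RingPartialField.ext (one_mul x.val)
  mul_one x := RingPartialField.ext (mul_one x.val)
  zero_mul x := RingPartialField.ext (zero_mul x.val)
  mul_zero x := RingPartialField.ext (mul_zero x.val)
  exists_pair_ne := ⟨⟨0, Or.inl rfl⟩, ⟨1, Or.inr ⟨1, one_mem _, by simp⟩⟩,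
    fun h => zero_ne_one (congrArg RingPartialField.val h)⟩
  inv_zero := RingPartialField.ext (Ring.inverse_zero R)
  mul_inv_cancel x hx := by
    obtain ⟨x, rfl | ⟨u, hu, rfl⟩⟩ := x
    · exact absurd rfl hx
    · exact RingPartialField.ext (Ring.mul_inverse_cancel _ u.isUnit)
  padd_zero x := Part.eq_some_iff.2 (mem_add.2 (add_zero x.val).symm)
  zero_mem_padd_neg x := mem_add.2 (add_neg_cancel x.val).symm
  eq_neg_of_zero_mem_padd x y h :=
    RingPartialField.ext (eq_neg_of_add_eq_zero_right (mem_add.1 h).symm)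
  padd_comm x y := Part.ext fun z => by rw [mem_add, mem_add, add_comm]
  mul_padd p q r hp := by
    obtain ⟨p, rfl | ⟨u, hu, rfl⟩⟩ := p
    · exact absurd rfl hp
    refine Part.ext' ⟨fun h => ?_, fun h => ?_⟩ fun h₁ h₂ => RingPartialField.ext (mul_add _ _ _).symm
    · have h' : (u : R) * q.val + u * r.val = 0 ∨
          ∃ v ∈ Subgroup.closure (S ∪ {-1}), (v : R) = u * q.val + u * r.val := h
      have hinv : ((u⁻¹ : Rˣ) : R) = 0 ∨
          ∃ v ∈ Subgroup.closure (S ∪ {-1}), (v : R) = (u⁻¹ : Rˣ) :=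
        Or.inr ⟨u⁻¹, Subgroup.inv_mem _ hu, rfl⟩
      have key := closed_mul hinv h'
      rw [← mul_add, Units.inv_mul_cancel_left] at key
      exact key
    · have key := closed_mul (Or.inr ⟨u, hu, rfl⟩) h
      rw [mul_add] at key
      exact key
  associative_law A B r u w h hA hB := by
    have key : ∀ p q r : RingPartialField R S, r ∈ add p q → r.val = p.val + q.val :=
      fun p q r => mem_add.1
    have hr : r.val = u.val + w.val := by
      rw [PartialField.map_association _ key h, PartialField.map_association _ key hA,
        PartialField.map_association _ key hB, Multiset.map_add, Multiset.sum_add]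
    exact mem_add.2 hr

end RingPartialField

/-! ### The direct product -/

/-- The underlying set of the direct product `ℙ₁ ⊗ ℙ₂` of two partial fields. -/
@[ext]
structure ProdPartialField (P₁ P₂ : Type*) [PartialField P₁] [PartialField P₂] where
  /-- The first component. -/
  fst : P₁
  /-- The second component. -/
  snd : P₂
  ne_zero_iff : fst ≠ 0 ↔ snd ≠ 0

namespace ProdPartialField

variable {P₁ P₂ : Type*} [PartialField P₁] [PartialField P₂]

theorem neg_ne_zero_iff {P : Type*} [PartialField P] (p : P) : -p ≠ 0 ↔ p ≠ 0 := by
  refine not_congr ⟨fun h => ?_, fun h => ?_⟩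
  · have h₀ := PartialField.zero_mem_padd_neg p
    rw [h, PartialField.padd_zero, Part.mem_some_iff] at h₀
    exact h₀.symm
  · subst h
    refine (PartialField.eq_neg_of_zero_mem_padd (0 : P) 0 ?_).symm
    rw [PartialField.padd_zero]
    exact Part.mem_some 0

/-- Addition in `ℙ₁ ⊗ ℙ₂` is componentwise; `(p₁, p₂) + (q₁, q₂)` is defined if and only if both
`p₁ + q₁` and `p₂ + q₂` are defined, and one of these sums is `0` exactly when the other is. -/
def add (x y : ProdPartialField P₁ P₂) : Part (ProdPartialField P₁ P₂) :=
  (PartialField.padd x.fst y.fst).bind fun a =>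
    (PartialField.padd x.snd y.snd).bind fun b =>
      Part.assert (a ≠ 0 ↔ b ≠ 0) fun h => Part.some ⟨a, b, h⟩

theorem mem_add {x y z : ProdPartialField P₁ P₂} : z ∈ add x y ↔
    z.fst ∈ PartialField.padd x.fst y.fst ∧ z.snd ∈ PartialField.padd x.snd y.snd := by
  simp only [add, Part.mem_bind_iff, Part.mem_assert_iff]
  constructor
  · rintro ⟨a, ha, b, hb, h, hz⟩
    rw [Part.mem_some_iff] at hz
    subst hz
    exact ⟨ha, hb⟩
  · rintro ⟨h₁, h₂⟩
    exact ⟨_, h₁, _, h₂, z.ne_zero_iff, Part.mem_some _⟩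

theorem association_fst_snd {S : Multiset (ProdPartialField P₁ P₂)} {r : ProdPartialField P₁ P₂}
    (h : Association add S r) :
    Association PartialField.padd (S.map ProdPartialField.fst) r.fst ∧
      Association PartialField.padd (S.map ProdPartialField.snd) r.snd := by
  induction h with
  | leaf p => exact ⟨.leaf _, .leaf _⟩
  | node _ _ h ih₁ ih₂ =>
    rw [Multiset.map_add, Multiset.map_add]
    exact ⟨.node ih₁.1 ih₂.1 (mem_add.1 h).1, .node ih₁.2 ih₂.2 (mem_add.1 h).2⟩

theorem ne_zero_and_ne_zero {x : ProdPartialField P₁ P₂} (hx : x ≠ ⟨0, 0, by simp⟩) :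
    x.fst ≠ 0 ∧ x.snd ≠ 0 := by
  by_contra hc
  have hx₁ := x.ne_zero_iff
  have e₁ : x.fst = 0 := by tauto
  have e₂ : x.snd = 0 := by tauto
  exact hx (ProdPartialField.ext e₁ e₂)

/-- The direct product `ℙ₁ ⊗ ℙ₂`, with componentwise operations. -/
noncomputable instance : PartialField (ProdPartialField P₁ P₂) where
  zero := ⟨0, 0, by simp⟩
  one := ⟨1, 1, by simp⟩
  mul x y := ⟨x.fst * y.fst, x.snd * y.snd, by
    have hx := x.ne_zero_iff
    have hy := y.ne_zero_iff
    simp only [mul_ne_zero_iff]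
    rw [hx, hy]⟩
  neg x := ⟨-x.fst, -x.snd, by
    have hx := x.ne_zero_iff
    simpa only [neg_ne_zero_iff] using hx⟩
  inv x := ⟨x.fst⁻¹, x.snd⁻¹, by
    have hx := x.ne_zero_iff
    simpa only [ne_eq, inv_eq_zero] using hx⟩
  padd := add
  mul_assoc x y z := ProdPartialField.ext (mul_assoc _ _ _) (mul_assoc _ _ _)
  mul_comm x y := ProdPartialField.ext (mul_comm _ _) (mul_comm _ _)
  one_mul x := ProdPartialField.ext (one_mul _) (one_mul _)
  mul_one x := ProdPartialField.ext (mul_one _) (mul_one _)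
  zero_mul x := ProdPartialField.ext (zero_mul _) (zero_mul _)
  mul_zero x := ProdPartialField.ext (mul_zero _) (mul_zero _)
  exists_pair_ne := ⟨⟨0, 0, by simp⟩, ⟨1, 1, by simp⟩,
    fun h => zero_ne_one (congrArg ProdPartialField.fst h)⟩
  inv_zero := ProdPartialField.ext inv_zero inv_zero
  mul_inv_cancel x hx := ProdPartialField.ext (mul_inv_cancel₀ (ne_zero_and_ne_zero hx).1)
    (mul_inv_cancel₀ (ne_zero_and_ne_zero hx).2)
  padd_zero x := by
    refine Part.eq_some_iff.2 (mem_add.2 ⟨?_, ?_⟩)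
    · exact (PartialField.padd_zero x.fst).symm ▸ Part.mem_some _
    · exact (PartialField.padd_zero x.snd).symm ▸ Part.mem_some _
  zero_mem_padd_neg x := mem_add.2
    ⟨PartialField.zero_mem_padd_neg x.fst, PartialField.zero_mem_padd_neg x.snd⟩
  eq_neg_of_zero_mem_padd x y h := ProdPartialField.ext
    (PartialField.eq_neg_of_zero_mem_padd _ _ (mem_add.1 h).1)
    (PartialField.eq_neg_of_zero_mem_padd _ _ (mem_add.1 h).2)
  padd_comm x y := Part.ext fun z => by
    rw [mem_add, mem_add, PartialField.padd_comm x.fst, PartialField.padd_comm x.snd]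
  mul_padd p q r hp := by
    obtain ⟨h₁, h₂⟩ := ne_zero_and_ne_zero hp
    ext z
    rw [mem_add, Part.mem_map_iff]
    change z.fst ∈ PartialField.padd (p.fst * q.fst) (p.fst * r.fst) ∧
      z.snd ∈ PartialField.padd (p.snd * q.snd) (p.snd * r.snd) ↔ _
    rw [PartialField.mul_padd _ _ _ h₁, PartialField.mul_padd _ _ _ h₂, Part.mem_map_iff,
      Part.mem_map_iff]
    constructor
    · rintro ⟨⟨a, ha, hza⟩, b, hb, hzb⟩
      have hz := z.ne_zero_iff
      rw [← hza, ← hzb, mul_ne_zero_iff, mul_ne_zero_iff] at hz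
      exact ⟨⟨a, b, by tauto⟩, mem_add.2 ⟨ha, hb⟩, ProdPartialField.ext hza hzb⟩
    · rintro ⟨a, ha, rfl⟩
      exact ⟨⟨_, (mem_add.1 ha).1, rfl⟩, _, (mem_add.1 ha).2, rfl⟩
  associative_law A B r u w h hA hB := by
    have h' := association_fst_snd h
    rw [Multiset.map_add, Multiset.map_add] at h'
    exact mem_add.2
      ⟨PartialField.associative_law _ _ _ _ _ h'.1 (association_fst_snd hA).1
        (association_fst_snd hB).1,
      PartialField.associative_law _ _ _ _ _ h'.2 (association_fst_snd hA).2
        (association_fst_snd hB).2⟩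

end ProdPartialField

/-! ### The partial fields of the theorem -/

/-- The field `GF(4)`. -/
abbrev GF4 : Type := GaloisField 2 2

/-- The Gaussian partial field `ℍ₂ = ℙ(ℂ, {i, 1 - i})`. -/
abbrev GaussianPF : Type :=
  RingPartialField ℂ {Units.mk0 Complex.I Complex.I_ne_zero,
    Units.mk0 (1 - Complex.I) (fun h => by simpa using congrArg Complex.re h)}

theorem ratFunc_X_sub_one_ne_zero : (RatFunc.X - 1 : RatFunc ℚ) ≠ 0 := by
  have h : (RatFunc.X - 1 : RatFunc ℚ) =
      algebraMap (Polynomial ℚ) (RatFunc ℚ) (Polynomial.X - Polynomial.C 1) := by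
    simp
  rw [h]
  exact RatFunc.algebraMap_ne_zero (Polynomial.X_sub_C_ne_zero 1)

theorem ratFunc_X_add_one_ne_zero : (RatFunc.X + 1 : RatFunc ℚ) ≠ 0 := by
  have h : (RatFunc.X + 1 : RatFunc ℚ) =
      algebraMap (Polynomial ℚ) (RatFunc ℚ) (Polynomial.X + Polynomial.C 1) := by
    simp
  rw [h]
  exact RatFunc.algebraMap_ne_zero (Polynomial.X_add_C_ne_zero 1)

/-- The 2-cyclotomic partial field `𝕂₂ = ℙ(ℚ(α), {α, α - 1, α + 1})`. -/
abbrev TwoCyclotomicPF : Type :=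
  RingPartialField (RatFunc ℚ) {Units.mk0 RatFunc.X RatFunc.X_ne_zero,
    Units.mk0 (RatFunc.X - 1) ratFunc_X_sub_one_ne_zero,
    Units.mk0 (RatFunc.X + 1) ratFunc_X_add_one_ne_zero}

/-! ### Matrices all of whose subdeterminants lie in a multiplicative subset -/

/-! From `𝕂₂` to `GF(4) ⊗ ℍ₂` one specialises: `TwoCyclotomic.toProd` sends `α` to `(ω, i)`,
respects sums and kills only `0`, so entrywise application keeps minors defined and keeps them zero
or nonzero.

For the converse, matrices must be lifted along `toProd`, which is far from injective (`α ^ 12` maps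
to `1`). What saves the situation is that only fundamental elements matter, the `x` for which `1 -
x` is defined: they are the cross ratios of the `2 × 2` submatrices. `toProd` is a bijection between
the fundamental elements of the two partial fields, and its inverse is compatible with quotients and
signs as required by `IsLifting`. Given such data, `IsLifting.hasLift` lifts every matrix, by
induction on the rows and columns that support it. If the bipartite graph of nonzero entries is
connected with a vertex of degree three, there are two parallel lines `u`, `w` whose removal leaves
it connected (`ConnOn.exists_pair`). The matrices without `u` and without `w` lift by induction.
Lifts are unique up to scaling (`IsLifting.scaleOn`), so the two can be glued. That the glued matrix
has all minors in the partial field is `TwoColumns.detGood`: pivoting outside `u`, `w` reduces every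
minor to one inside these two columns, and `RowChain.shorten` brings its two rows within two steps
of each other, where explicit cross ratio identities finish. The remaining graphs are disconnected,
have a vertex of degree at most one, or are cycles; a pivot on a cycle of length above four creates
a vertex of degree three, and a `2 × 2` matrix is lifted through its cross ratio.

Determinants here are formal partial sums. `PartialField.isPMatrix_iff` shows that it is enough for
the minors, computed in an ambient ring, to lie in the partial field; the tool is the ring presented
by all defined sums (`PartialField.sumIs_of_toUniversal`).

The fundamental elements are found by solving unit equations. For `ℍ₂` this is divisibility by `1 +
i` (`GaussianUnits.mem_exponents`). For `𝕂₂`, evaluation at `2`, `1/2` and `3` leads to `x + y = 1`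
in numbers `± 2 ^ m * 3 ^ n` (`UnitEquation.mem_exponents`). The rest is a finite check. -/

namespace PivotMatrix

section Basic

variable {P R : Type*} [CommGroupWithZero P] [CommRing R] (v : P →*₀ R)

/-- `r` is the value of an element of `P`. -/
def Good (r : R) : Prop := ∃ p : P, v p = r

variable {v}

theorem good_zero : Good v 0 := ⟨0, map_zero v⟩

theorem good_one : Good v 1 := ⟨1, map_one v⟩

theorem good_val (p : P) : Good v (v p) := ⟨p, rfl⟩

theorem Good.mul {r s : R} (hr : Good v r) (hs : Good v s) : Good v (r * s) := by
  obtain ⟨p, rfl⟩ := hr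
  obtain ⟨q, rfl⟩ := hs
  exact ⟨p * q, map_mul v p q⟩

theorem Good.neg (h1 : Good v (-1)) {r : R} (hr : Good v r) : Good v (-r) := by
  simpa using h1.mul hr

theorem Good.neg_one_pow (h1 : Good v (-1)) (n : ℕ) : Good v ((-1) ^ n) := by
  obtain ⟨p, hp⟩ := h1
  exact ⟨p ^ n, by rw [map_pow, hp]⟩

theorem val_mul_inv {p : P} (hp : p ≠ 0) : v p * v p⁻¹ = 1 := by
  rw [← map_mul, mul_inv_cancel₀ hp, map_one]

theorem Good.of_mul {p : P} (hp : p ≠ 0) {r : R} (h : Good v (v p * r)) : Good v r := by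
  have h2 := (good_val (v := v) p⁻¹).mul h
  rwa [← mul_assoc, mul_comm (v p⁻¹), val_mul_inv hp, one_mul] at h2

theorem good_prod {ι : Type*} (s : Finset ι) (f : ι → P) : Good v (∏ i ∈ s, v (f i)) :=
  ⟨∏ i ∈ s, f i, map_prod v f s⟩

end Basic

/-- Expansion of a determinant by the Schur complement of a unit entry. -/
theorem det_schur {R : Type*} [CommRing R] {k : ℕ} (M : Matrix (Fin (k + 1)) (Fin (k + 1)) R)
    (p q : Fin (k + 1)) (a' : R) (ha : M p q * a' = 1) :
    M.det = (-1) ^ (p + q : ℕ) * M p q * (Matrix.of fun i j =>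
      M (p.succAbove i) (q.succAbove j) - M (p.succAbove i) q * a' * M p (q.succAbove j)).det := by
  classical
  let B : Matrix (Fin (k + 1)) (Fin (k + 1)) R := Matrix.of fun i j =>
    if i = p then M p j else M i j - M i q * a' * M p j
  -- Subtracting multiples of row `p` from the other rows clears column `q` outside row `p`; the
  -- determinant is then expanded along column `q`.
  have hdet : M.det = B.det := by
    refine Matrix.det_eq_of_forall_row_eq_smul_add_const
      (fun i => if i = p then 0 else M i q * a') p (by simp) fun i j => ?_
    by_cases hi : i = p
    · subst hi
      simp [B]
    · simp [B, hi]
  rw [hdet, Matrix.det_succ_column B q, Finset.sum_eq_single p]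
  · congr 2
    · simp [B]
    · ext i j
      simp [B, Fin.succAbove_ne]
  · intro i _ hi
    have : B i q = 0 := by
      simp only [B, Matrix.of_apply, if_neg hi]
      linear_combination (-M i q) * ha
    simp [this]
  · simp

/-! ### Pivoting and its effect on minors -/

section Pivot

variable {P R X Y : Type*} [CommGroupWithZero P] [CommRing R] (v : P →*₀ R)

/-- The minor of `A` with rows `f` and columns `g`. -/
def minor (A : X → Y → P) {k : ℕ} (f : Fin k → X) (g : Fin k → Y) : R :=
  (Matrix.of fun i j => v (A (f i) (g j))).det

/-- All minors of `A` are values of elements of `P`. -/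
def DetGood (A : X → Y → P) : Prop :=
  ∀ (k : ℕ) (f : Fin k → X) (g : Fin k → Y), Good v (minor v A f g)

/-- `A'` is obtained from `A` by pivoting on the entry `(x, y)`. -/
structure IsPivot (A : X → Y → P) (x : X) (y : Y) (A' : X → Y → P) : Prop where
  ne : A x y ≠ 0
  entry : v (A' x y) * v (A x y) = -1
  row : ∀ j, j ≠ y → A' x j = A x j * (A x y)⁻¹
  col : ∀ i, i ≠ x → A' i y = A i y * (A x y)⁻¹
  other : ∀ i j, i ≠ x → j ≠ y → v (A' i j) = v (A i j) - v (A i y) * v (A x j) * v (A x y)⁻¹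

variable {v}

/-- The sign convention is chosen for this symmetry: the sign sits on the pivot entry alone, and the
pivot row and column are both divided by the pivot without sign. Every fact about rows thus yields
one about columns. -/
theorem IsPivot.transpose {A A' : X → Y → P} {x : X} {y : Y} (h : IsPivot v A x y A') :
    IsPivot v (fun j i => A i j) y x (fun j i => A' i j) where
  ne := h.ne
  entry := h.entry
  row := h.col
  col := h.row
  other i j hi hj := by rw [h.other j i hj hi, mul_comm (v (A j y))]

theorem minor_transpose (A : X → Y → P) {k : ℕ} (f : Fin k → X) (g : Fin k → Y) :
    minor v (fun j i => A i j) g f = minor v A f g := by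
  rw [minor, ← Matrix.det_transpose]
  rfl

theorem minor_eq_zero_of_row (A : X → Y → P) {k : ℕ} {f : Fin k → X} (hf : ¬ f.Injective)
    (g : Fin k → Y) : minor v A f g = 0 := by
  obtain ⟨i, j, h, hij⟩ : ∃ i j, f i = f j ∧ i ≠ j := by
    simpa [Function.Injective] using hf
  exact Matrix.det_zero_of_row_eq hij (by ext; simp [h])

theorem minor_eq_zero_of_col (A : X → Y → P) {k : ℕ} (f : Fin k → X) {g : Fin k → Y}
    (hg : ¬ g.Injective) : minor v A f g = 0 := by
  rw [← minor_transpose]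
  exact minor_eq_zero_of_row _ hg f

/-- The Schur complement of the entry `(x, y)` in `A'` undoes the pivot and gives back the entries
of `A`. -/
theorem minor_pivot_mem_mem {A A' : X → Y → P} {x : X} {y : Y} (h : IsPivot v A x y A') {k : ℕ}
    {f : Fin (k + 1) → X} {g : Fin (k + 1) → Y} (hf : f.Injective) (hg : g.Injective)
    {p q : Fin (k + 1)} (hp : f p = x) (hq : g q = y) :
    minor v A' f g = (-1) ^ (p + q : ℕ) * v (A' x y) *
      minor v A (f ∘ p.succAbove) (g ∘ q.succAbove) := by
  subst hp hq
  have e := val_mul_inv (v := v) h.ne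
  rw [minor, det_schur _ p q (-v (A (f p) (g q))) (by
    simp only [Matrix.of_apply]
    linear_combination -h.entry)]
  simp only [Matrix.of_apply, minor, Function.comp_apply]
  congr 3
  ext i j
  have hi : f (p.succAbove i) ≠ f p := fun hh => Fin.succAbove_ne p i (hf hh)
  have hj : g (q.succAbove j) ≠ g q := fun hh => Fin.succAbove_ne q j (hg hh)
  rw [h.other _ _ hi hj, h.row _ hj, h.col _ hi, map_mul, map_mul]
  linear_combination (v (A (f (p.succAbove i)) (g q)) * v (A (f p) (g (q.succAbove j))) *
    v (A (f p) (g q))⁻¹) * e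

theorem minor_eq_minor_pivot {A A' : X → Y → P} {x : X} {y : Y} (h : IsPivot v A x y A') {k : ℕ}
    {f : Fin (k + 1) → X} {g : Fin (k + 1) → Y} (hf : f.Injective) (hg : g.Injective)
    {p q : Fin (k + 1)} (hp : f p = x) (hq : g q = y) :
    minor v A f g = (-1) ^ (p + q : ℕ) * v (A x y) *
      minor v A' (f ∘ p.succAbove) (g ∘ q.succAbove) := by
  subst hp hq
  rw [minor, det_schur _ p q (v (A (f p) (g q))⁻¹) (val_mul_inv h.ne)]
  simp only [Matrix.of_apply, minor, Function.comp_apply]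
  congr 3
  ext i j
  have hi : f (p.succAbove i) ≠ f p := fun hh => Fin.succAbove_ne p i (hf hh)
  have hj : g (q.succAbove j) ≠ g q := fun hh => Fin.succAbove_ne q j (hg hh)
  rw [h.other _ _ hi hj]
  ring

/-- Away from column `y`, a pivot only subtracts multiples of row `x` from other rows and divides
row `x` by the pivot. -/
theorem minor_pivot_mem_notMem {A A' : X → Y → P} {x : X} {y : Y} (h : IsPivot v A x y A') {k : ℕ}
    {f : Fin k → X} {g : Fin k → Y} (hf : f.Injective) {p : Fin k} (hp : f p = x)
    (hy : ∀ j, g j ≠ y) : minor v A' f g = v (A x y)⁻¹ * minor v A f g := by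
  classical
  subst hp
  let C : Matrix (Fin k) (Fin k) R := Matrix.of fun i j =>
    v (A (f i) (g j)) - if i = p then 0 else v (A (f i) y) * v (A (f p) (g j)) * v (A (f p) y)⁻¹
  have h₁ : minor v A f g = C.det := by
    refine Matrix.det_eq_of_forall_row_eq_smul_add_const
      (fun i => if i = p then 0 else v (A (f i) y) * v (A (f p) y)⁻¹) p (by simp) fun i j => ?_
    by_cases hi : i = p
    · simp [C, hi]
    · simp only [C, hi, Matrix.of_apply, if_false, if_true]
      ring
  have h₂ : minor v A' f g = (Matrix.of fun i j =>
      (if i = p then v (A (f p) y)⁻¹ else 1) * C i j).det := by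
    unfold minor
    congr 1
    ext i j
    by_cases hi : i = p
    · subst hi
      simp [C, h.row _ (hy j), mul_comm]
    · have : f i ≠ f p := fun hh => hi (hf hh)
      simp [C, hi, h.other _ _ this (hy j)]
  rw [h₂, Matrix.det_mul_column, h₁]
  congr 1
  simp

/-- Pivoting preserves the property that all minors lie in `P`. -/
theorem DetGood.pivot (h1 : Good v (-1)) {A A' : X → Y → P} {x : X} {y : Y}
    (hA : DetGood v A) (h : IsPivot v A x y A') : DetGood v A' := by
  intro k f g
  by_cases hf : f.Injective
  swap
  · rw [minor_eq_zero_of_row _ hf]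
    exact good_zero
  by_cases hg : g.Injective
  swap
  · rw [minor_eq_zero_of_col _ _ hg]
    exact good_zero
  by_cases hx : ∃ p, f p = x
  · obtain ⟨p, hp⟩ := hx
    by_cases hy : ∃ q, g q = y
    · obtain ⟨q, hq⟩ := hy
      obtain _ | k := k
      · exact p.elim0
      rw [minor_pivot_mem_mem h hf hg hp hq]
      exact ((h1.neg_one_pow _).mul (good_val _)).mul (hA _ _ _)
    · rw [minor_pivot_mem_notMem h hf hp (not_exists.1 hy)]
      exact (good_val _).mul (hA _ _ _)
  · by_cases hy : ∃ q, g q = y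
    · obtain ⟨q, hq⟩ := hy
      rw [← minor_transpose, minor_pivot_mem_notMem h.transpose hg hq (not_exists.1 hx),
        minor_transpose]
      exact (good_val _).mul (hA _ _ _)
    · push Not at hx hy
      -- A minor avoiding both pivot lines is, up to the pivot, the minor of `A` bordered by row `x`
      -- and column `y`.
      have key := minor_eq_minor_pivot h (f := Fin.cons x f) (g := Fin.cons y g) (p := 0) (q := 0)
        (Fin.cons_injective_iff.2 ⟨by simpa using hx, hf⟩)
        (Fin.cons_injective_iff.2 ⟨by simpa using hy, hg⟩) rfl rfl
      refine Good.of_mul h.ne ?_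
      have h2 := hA _ (Fin.cons x f) (Fin.cons y g)
      rw [key] at h2
      simpa [Function.comp_def] using h2

theorem minor_two (A : X → Y → P) (f : Fin 2 → X) (g : Fin 2 → Y) :
    minor v A f g = v (A (f 0) (g 0)) * v (A (f 1) (g 1)) - v (A (f 0) (g 1)) * v (A (f 1) (g 0)) := by
  rw [minor, Matrix.det_fin_two]
  rfl

theorem DetGood.two {A : X → Y → P} (hA : DetGood v A) (a b : X) (u w : Y) :
    Good v (v (A a u) * v (A b w) - v (A a w) * v (A b u)) := by
  have := hA 2 ![a, b] ![u, w]
  rwa [minor_two] at this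

/-- Only the `2 × 2` minors through the pivot enter. This weak form is needed for matrices whose
other minors are not yet under control. -/
theorem exists_isPivot_of_minors (h1 : Good v (-1)) {A : X → Y → P} {x : X} {y : Y}
    (ne : A x y ≠ 0) (h2 : ∀ i j, Good v (v (A x y) * v (A i j) - v (A x j) * v (A i y))) :
    ∃ A', IsPivot v A x y A' := by
  classical
  obtain ⟨m, hm⟩ := h1
  have h : ∀ i j, ∃ r : P, v r = v (A i j) - v (A i y) * v (A x j) * v (A x y)⁻¹ := by
    intro i j
    refine Good.of_mul ne ?_
    convert h2 i j using 1
    linear_combination (-v (A i y) * v (A x j)) * val_mul_inv (v := v) ne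
  choose r hr using h
  refine ⟨fun i j => if i = x then if j = y then m * (A x y)⁻¹ else A x j * (A x y)⁻¹ else
    if j = y then A i y * (A x y)⁻¹ else r i j, ne, ?_, ?_, ?_, ?_⟩
  · simp only [if_true, map_mul, hm]
    linear_combination -(val_mul_inv (v := v) ne)
  · intro j hj
    simp [hj]
  · intro i hi
    simp [hi]
  · intro i j hi hj
    simp [hi, hj, hr]

/-- Every nonzero entry of a matrix with minors in `P` admits a pivot. -/
theorem DetGood.exists_isPivot (h1 : Good v (-1)) {A : X → Y → P} (hA : DetGood v A) {x : X} {y : Y}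
    (ne : A x y ≠ 0) : ∃ A', IsPivot v A x y A' :=
  exists_isPivot_of_minors h1 ne fun i j => hA.two x i y j

/-- A class of matrices that is closed under pivoting outside the set `U` of columns, and whose
members have minors in `P` as far as the columns in `U` are concerned. -/
theorem detGood_of_class (h1 : Good v (-1)) (U : Set Y) (𝒮 : Set (X → Y → P))
    (hpiv : ∀ A ∈ 𝒮, ∀ x, ∀ y ∉ U, A x y ≠ 0 → ∃ A' ∈ 𝒮, IsPivot v A x y A')
    (hU : ∀ A ∈ 𝒮, ∀ (k : ℕ) (f : Fin k → X) (g : Fin k → Y), (∀ j, g j ∈ U) → Good v (minor v A f g))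
    {A : X → Y → P} (hA : A ∈ 𝒮) : DetGood v A := by
  intro k
  induction k generalizing A with
  | zero =>
    intro f g
    exact hU A hA 0 f g fun j => j.elim0
  | succ k ih =>
    intro f g
    by_cases hf : f.Injective
    swap
    · rw [minor_eq_zero_of_row _ hf]
      exact good_zero
    by_cases hg : g.Injective
    swap
    · rw [minor_eq_zero_of_col _ _ hg]
      exact good_zero
    by_cases hgU : ∀ j, g j ∈ U
    · exact hU A hA _ f g hgU
    push Not at hgU
    obtain ⟨q, hq⟩ := hgU
    -- Induction on the size: a nonzero entry in a column outside `U` is pivoted on, which turns the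
    -- minor into a smaller minor of another member of the class.
    by_cases hz : ∀ i, A (f i) (g q) = 0
    · have : minor v A f g = 0 := Matrix.det_eq_zero_of_column_eq_zero q fun i => by simp [hz i]
      rw [this]
      exact good_zero
    · push Not at hz
      obtain ⟨p, hp⟩ := hz
      obtain ⟨A', hA', hpv⟩ := hpiv A hA _ _ hq hp
      rw [minor_eq_minor_pivot hpv hf hg rfl rfl]
      exact ((h1.neg_one_pow _).mul (good_val _)).mul (ih hA' _ _)

theorem good_minor_of_two (h1 : Good v (-1)) {A : X → Y → P} {u w : Y}
    (h2 : ∀ a b, Good v (v (A a u) * v (A b w) - v (A a w) * v (A b u)))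
    {k : ℕ} (f : Fin k → X) (g : Fin k → Y) (hg : ∀ j, g j ∈ ({u, w} : Set Y)) :
    Good v (minor v A f g) := by
  by_cases hinj : g.Injective
  swap
  · rw [minor_eq_zero_of_col _ _ hinj]
    exact good_zero
  match k, f, g, hg, hinj with
  | 0, f, g, _, _ =>
    rw [minor, Matrix.det_fin_zero]
    exact good_one
  | 1, f, g, _, _ =>
    rw [minor, Matrix.det_fin_one]
    exact good_val _
  | 2, f, g, hg, hinj =>
    rw [minor_two]
    have h01 : g 0 ≠ g 1 := fun h => by simpa using hinj h
    rcases hg 0 with e0 | e0 <;> rcases hg 1 with e1 | e1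
    · exact absurd (e0.trans e1.symm) h01
    · rw [e0, e1]
      exact h2 _ _
    · rw [e0, e1]
      convert Good.neg h1 (h2 (f 0) (f 1)) using 1
      ring
    · exact absurd (e0.trans e1.symm) h01
  -- Three distinct columns do not fit into `{u, w}`.
  | k + 3, f, g, hg, hinj =>
    exfalso
    have h (i j : ℕ) (hi : i < k + 3) (hj : j < k + 3) (hij : i ≠ j) : g ⟨i, hi⟩ ≠ g ⟨j, hj⟩ :=
      fun h => hij (Fin.mk.inj (hinj h))
    have h01 := h 0 1 (by omega) (by omega) (by omega)
    have h02 := h 0 2 (by omega) (by omega) (by omega)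
    have h12 := h 1 2 (by omega) (by omega) (by omega)
    have a0 := hg ⟨0, by omega⟩
    have a1 := hg ⟨1, by omega⟩
    have a2 := hg ⟨2, by omega⟩
    simp only [Set.mem_insert_iff, Set.mem_singleton_iff] at a0 a1 a2
    grind

end Pivot

end PivotMatrix

namespace PivotMatrix

open Sum

/-! ### Operations on matrices with good minors -/

section Closure

variable {P R X Y : Type*} [CommGroupWithZero P] [CommRing R] {v : P →*₀ R}

theorem val_eq_zero (hinj : Function.Injective v) {p : P} : v p = 0 ↔ p = 0 := by
  rw [← map_zero v, hinj.eq_iff]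

theorem DetGood.transpose {A : X → Y → P} (hA : DetGood v A) : DetGood v fun j i => A i j := by
  intro k f g
  rw [minor_transpose]
  exact hA _ _ _

theorem DetGood.submatrix {X' Y' : Type*} {A : X → Y → P} (hA : DetGood v A) (f : X' → X)
    (g : Y' → Y) : DetGood v fun i j => A (f i) (g j) :=
  fun k f' g' => hA k (f ∘ f') (g ∘ g')

theorem DetGood.scale {A : X → Y → P} (hA : DetGood v A) (s : X → P) (t : Y → P) :
    DetGood v fun i j => s i * A i j * t j := by
  intro k f g
  have : minor v (fun i j => s i * A i j * t j) f g =
      (∏ i, v (s (f i))) * ((∏ j, v (t (g j))) * minor v A f g) := by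
    simp only [minor]
    rw [← Matrix.det_mul_row, ← Matrix.det_mul_column]
    congr 1
    ext i j
    simp only [Matrix.of_apply, map_mul]
    ring
  rw [this]
  exact (good_prod _ _).mul ((good_prod _ _).mul (hA _ _ _))

open Classical in
/-- The matrix `A` with all entries outside the rows and columns in `W` replaced by `0`. -/
noncomputable def mask (W : Set (X ⊕ Y)) (A : X → Y → P) (x : X) (y : Y) : P :=
  if inl x ∈ W ∧ inr y ∈ W then A x y else 0

theorem mask_of_mem {W : Set (X ⊕ Y)} {A : X → Y → P} {x : X} {y : Y} (hx : inl x ∈ W)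
    (hy : inr y ∈ W) : mask W A x y = A x y := if_pos ⟨hx, hy⟩

theorem mask_of_row {W : Set (X ⊕ Y)} {A : X → Y → P} {x : X} {y : Y} (hx : inl x ∉ W) :
    mask W A x y = 0 := if_neg fun h => hx h.1

theorem mask_of_col {W : Set (X ⊕ Y)} {A : X → Y → P} {x : X} {y : Y} (hy : inr y ∉ W) :
    mask W A x y = 0 := if_neg fun h => hy h.2

theorem mask_ne_zero {W : Set (X ⊕ Y)} {A : X → Y → P} {x : X} {y : Y} (h : mask W A x y ≠ 0) :
    inl x ∈ W ∧ inr y ∈ W ∧ A x y ≠ 0 := by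
  unfold mask at h
  split_ifs at h with hW
  · exact ⟨hW.1, hW.2, h⟩
  · exact absurd rfl h

theorem DetGood.mask {A : X → Y → P} (hA : DetGood v A) (W : Set (X ⊕ Y)) :
    DetGood v (mask W A) := by
  intro k f g
  by_cases hf : ∀ i, inl (f i) ∈ W
  · by_cases hg : ∀ j, inr (g j) ∈ W
    · have : minor v (PivotMatrix.mask W A) f g = minor v A f g := by
        simp only [minor, mask_of_mem (hf _) (hg _)]
      rw [this]
      exact hA _ _ _
    · push Not at hg
      obtain ⟨j, hj⟩ := hg
      have : minor v (PivotMatrix.mask W A) f g = 0 :=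
        Matrix.det_eq_zero_of_column_eq_zero j fun i => by simp [mask_of_col hj]
      rw [this]
      exact good_zero
  · push Not at hf
    obtain ⟨i, hi⟩ := hf
    have : minor v (PivotMatrix.mask W A) f g = 0 :=
      Matrix.det_eq_zero_of_row_eq_zero i fun j => by simp [mask_of_row hi]
    rw [this]
    exact good_zero

theorem IsPivot.mask {A A' : X → Y → P} {x : X} {y : Y} (h : IsPivot v A x y A')
    {W : Set (X ⊕ Y)} (hx : inl x ∈ W) (hy : inr y ∈ W) :
    IsPivot v (mask W A) x y (mask W A') where
  ne := by
    rw [mask_of_mem hx hy]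
    exact h.ne
  entry := by
    rw [mask_of_mem hx hy, mask_of_mem hx hy]
    exact h.entry
  row j hj := by
    rw [mask_of_mem hx hy]
    by_cases hW : inr j ∈ W
    · rw [mask_of_mem hx hW, mask_of_mem hx hW, h.row j hj]
    · rw [mask_of_col hW, mask_of_col hW, zero_mul]
  col i hi := by
    rw [mask_of_mem hx hy]
    by_cases hW : inl i ∈ W
    · rw [mask_of_mem hW hy, mask_of_mem hW hy, h.col i hi]
    · rw [mask_of_row hW, mask_of_row hW, zero_mul]
  other i j hi hj := by
    rw [mask_of_mem hx hy]
    by_cases hW : inl i ∈ W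
    · by_cases hW' : inr j ∈ W
      · rw [mask_of_mem hW hW', mask_of_mem hW hW', mask_of_mem hW hy, mask_of_mem hx hW',
          h.other i j hi hj]
      · rw [mask_of_col hW', mask_of_col hW', mask_of_col hW']
        simp
    · rw [mask_of_row hW, mask_of_row hW, mask_of_row hW]
      simp

theorem IsPivot.unique (hinj : Function.Injective v) {A A₁ A₂ : X → Y → P} {x : X} {y : Y}
    (h₁ : IsPivot v A x y A₁) (h₂ : IsPivot v A x y A₂) : A₁ = A₂ := by
  ext i j
  by_cases hi : i = x
  · subst hi
    by_cases hj : j = y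
    · subst hj
      apply hinj
      have e := val_mul_inv (v := v) h₁.ne
      linear_combination v (A i j)⁻¹ * (h₁.entry - h₂.entry) - (v (A₁ i j) - v (A₂ i j)) * e
    · rw [h₁.row j hj, h₂.row j hj]
  · by_cases hj : j = y
    · subst hj
      rw [h₁.col i hi, h₂.col i hi]
    · apply hinj
      rw [h₁.other i j hi hj, h₂.other i j hi hj]

theorem IsPivot.entry_ne (hinj : Function.Injective v) {A A' : X → Y → P} {x : X} {y : Y}
    (h : IsPivot v A x y A') : A' x y ≠ 0 := by
  intro h0
  have e := h.entry
  rw [h0, map_zero, zero_mul] at e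
  have : v 1 = v 0 := by
    rw [map_one, map_zero]
    linear_combination e
  exact one_ne_zero (hinj this)

theorem IsPivot.row_ne_zero_iff (hinj : Function.Injective v) {A A' : X → Y → P} {x : X} {y : Y}
    (h : IsPivot v A x y A') (j : Y) : A' x j ≠ 0 ↔ A x j ≠ 0 := by
  by_cases hj : j = y
  · subst hj
    exact iff_of_true (h.entry_ne hinj) h.ne
  · rw [h.row j hj, mul_ne_zero_iff, and_iff_left (inv_ne_zero h.ne)]

theorem IsPivot.col_ne_zero_iff (hinj : Function.Injective v) {A A' : X → Y → P} {x : X} {y : Y}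
    (h : IsPivot v A x y A') (i : X) : A' i y ≠ 0 ↔ A i y ≠ 0 :=
  h.transpose.row_ne_zero_iff hinj i

/-- Rows that vanish in the pivot column are not affected by pivoting. -/
theorem IsPivot.row_eq (hinj : Function.Injective v) {A A' : X → Y → P} {x : X} {y : Y}
    (h : IsPivot v A x y A') {i : X} (hi : A i y = 0) (j : Y) : A' i j = A i j := by
  have hix : i ≠ x := by
    rintro rfl
    exact h.ne hi
  by_cases hj : j = y
  · subst hj
    rw [h.col i hix, hi, zero_mul]
  · apply hinj
    rw [h.other i j hix hj, hi, map_zero]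
    ring

theorem IsPivot.col_eq (hinj : Function.Injective v) {A A' : X → Y → P} {x : X} {y : Y}
    (h : IsPivot v A x y A') {j : Y} (hj : A x j = 0) (i : X) : A' i j = A i j :=
  h.transpose.row_eq hinj hj i

theorem IsPivot.other_ne_zero (hinj : Function.Injective v) {A A' : X → Y → P} {x : X} {y : Y}
    (h : IsPivot v A x y A') {i : X} {j : Y} (hij : A i j = 0) (hi : A i y ≠ 0) (hj : A x j ≠ 0) :
    A' i j ≠ 0 := by
  have hix : i ≠ x := by
    rintro rfl
    exact hj hij
  have hjy : j ≠ y := by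
    rintro rfl
    exact hi hij
  intro h0
  have e := h.other i j hix hjy
  rw [h0, hij, map_zero, zero_sub, eq_comm, neg_eq_zero, ← map_mul, ← map_mul,
    val_eq_zero hinj] at e
  exact mul_ne_zero (mul_ne_zero hi hj) (inv_ne_zero h.ne) e

/-- Pivoting twice on the same entry changes the signs of a row and a column. -/
theorem IsPivot.back (hinj : Function.Injective v) [DecidableEq X] [DecidableEq Y] {m : P}
    (hm : v m = -1) {A A' : X → Y → P} {x : X} {y : Y} (h : IsPivot v A x y A') :
    IsPivot v A' x y fun i j => (if i = x then m else 1) * A i j * (if j = y then m else 1) := by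
  have hmm : m * m = 1 := hinj (by simp [hm])
  have e := val_mul_inv (v := v) h.ne
  have ha : A' x y = m * (A x y)⁻¹ := by
    apply hinj
    rw [map_mul, hm]
    linear_combination (v (A x y)⁻¹) * h.entry - v (A' x y) * e
  have ha' : (A' x y)⁻¹ = m * A x y := by
    rw [ha, mul_inv, inv_inv, inv_eq_of_mul_eq_one_right hmm]
  refine ⟨h.entry_ne hinj, ?_, ?_, ?_, ?_⟩
  · have : v m * v m = 1 := by rw [← map_mul, hmm, map_one]
    simp only [if_true, map_mul]
    linear_combination h.entry + v (A x y) * v (A' x y) * this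
  · intro j hj
    simp only [hj, if_true, if_false, mul_one]
    rw [ha', h.row j hj]
    field_simp [h.ne]
  · intro i hi
    simp only [hi, if_true, if_false, one_mul]
    rw [ha', h.col i hi]
    field_simp [h.ne]
  · intro i j hi hj
    simp only [hi, hj, if_false, one_mul, mul_one]
    rw [ha', h.row j hj, h.col i hi, h.other i j hi hj]
    simp only [map_mul, hm]
    linear_combination (-v (A i y) * v (A x j) * v (A x y)⁻¹) * e

/-- A block diagonal matrix has minors in `P` if its blocks do. -/
theorem DetGood.of_blocks (h1 : Good v (-1)) {A : X → Y → P}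
    (C : Set (X ⊕ Y)) (h₁ : DetGood v (PivotMatrix.mask C A))
    (h₂ : DetGood v (PivotMatrix.mask Cᶜ A))
    (h0 : ∀ x y, A x y ≠ 0 → (inl x ∈ C ↔ inr y ∈ C)) : DetGood v A := by
  classical
  -- Block matrices with good blocks form a class closed under pivoting, since a pivot inside one
  -- block leaves the other alone. It suffices to pivot in `C`, as `C` may be replaced by its
  -- complement.
  suffices key : ∀ (C : Set (X ⊕ Y)) (A : X → Y → P), DetGood v (PivotMatrix.mask C A) →
      DetGood v (PivotMatrix.mask Cᶜ A) → (∀ x y, A x y ≠ 0 → (inl x ∈ C ↔ inr y ∈ C)) →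
      ∀ x y, inl x ∈ C → A x y ≠ 0 → ∃ A', DetGood v (PivotMatrix.mask C A') ∧
      DetGood v (PivotMatrix.mask Cᶜ A') ∧ (∀ x y, A' x y ≠ 0 → (inl x ∈ C ↔ inr y ∈ C)) ∧
      IsPivot v A x y A' by
    refine detGood_of_class h1 ∅ {A | DetGood v (PivotMatrix.mask C A) ∧
      DetGood v (PivotMatrix.mask Cᶜ A) ∧ ∀ x y, A x y ≠ 0 → (inl x ∈ C ↔ inr y ∈ C)} ?_ ?_
      ⟨h₁, h₂, h0⟩
    · rintro A ⟨h₁, h₂, h0⟩ x y - hxy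
      by_cases hx : inl x ∈ C
      · obtain ⟨A', a1, a2, a3, a4⟩ := key C A h₁ h₂ h0 x y hx hxy
        exact ⟨A', ⟨a1, a2, a3⟩, a4⟩
      · obtain ⟨A', a1, a2, a3, a4⟩ := key Cᶜ A h₂ (by rwa [compl_compl])
          (fun x y h => not_congr (h0 x y h)) x y hx hxy
        exact ⟨A', ⟨by rwa [compl_compl] at a2, a1, fun x y h => not_iff_not.1 (a3 x y h)⟩, a4⟩
    · intro A _ k f g hg
      obtain _ | k := k
      · rw [minor, Matrix.det_fin_zero]
        exact good_one
      · exact (hg 0).elim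
  intro C A h₁ h₂ h0 x y hx hxy
  have hy := (h0 x y hxy).1 hx
  obtain ⟨D, hD⟩ := h₁.exists_isPivot h1 (x := x) (y := y) (by rwa [mask_of_mem hx hy])
  have hDg := h₁.pivot h1 hD
  have hxj : ∀ j, inr j ∉ C → A x j = 0 := fun j hj => by
    by_contra h
    exact hj ((h0 x j h).1 hx)
  have hiy : ∀ i, inl i ∉ C → A i y = 0 := fun i hi => by
    by_contra h
    exact hi ((h0 i y h).2 hy)
  refine ⟨fun i j => if inl i ∈ C ∧ inr j ∈ C then D i j else A i j, ?_, ?_, ?_, ?_⟩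
  · convert hDg.mask C using 1
    ext i j
    simp only [PivotMatrix.mask]
    split_ifs <;> rfl
  · convert h₂ using 1
    ext i j
    simp only [PivotMatrix.mask, Set.mem_compl_iff]
    split_ifs <;> tauto
  · intro i j hij
    by_cases hC : inl i ∈ C ∧ inr j ∈ C
    · tauto
    · simp only [hC, if_false] at hij
      exact h0 i j hij
  · refine ⟨hxy, ?_, ?_, ?_, ?_⟩
    · have := hD.entry
      rw [mask_of_mem hx hy] at this
      simpa only [hx, hy, and_self, if_true] using this
    · intro j hj
      by_cases hC : inr j ∈ C
      · have := hD.row j hj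
        rw [mask_of_mem hx hy, mask_of_mem hx hC] at this
        simpa only [hx, hC, and_self, if_true] using this
      · simp [hC, hxj j hC]
    · intro i hi
      by_cases hC : inl i ∈ C
      · have := hD.col i hi
        rw [mask_of_mem hx hy, mask_of_mem hC hy] at this
        simpa only [hy, hC, and_self, if_true] using this
      · simp [hC, hiy i hC]
    · intro i j hi hj
      by_cases hC : inl i ∈ C
      · by_cases hC' : inr j ∈ C
        · have := hD.other i j hi hj
          rw [mask_of_mem hx hy, mask_of_mem hC hy, mask_of_mem hx hC', mask_of_mem hC hC'] at this
          simpa only [hC, hC', and_self, if_true] using this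
        · simp [hC', hxj j hC']
      · simp [hC, hiy i hC]

/-- Adding a column with at most one nonzero entry. -/
theorem DetGood.of_unit_col (h1 : Good v (-1)) {A : X → Y → P} {u : Y} {x₀ : X}
    (hA : DetGood v (PivotMatrix.mask {inr u}ᶜ A)) (hu : ∀ x, x ≠ x₀ → A x u = 0) :
    DetGood v A := by
  have hmask : ∀ x y, y ≠ u → PivotMatrix.mask {inr u}ᶜ A x y = A x y := fun x y hy =>
    mask_of_mem (by simp) (by simpa using hy)
  intro k f g
  by_cases hf : f.Injective
  swap
  · rw [minor_eq_zero_of_row _ hf]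
    exact good_zero
  by_cases hg : g.Injective
  swap
  · rw [minor_eq_zero_of_col _ _ hg]
    exact good_zero
  by_cases hgu : ∃ q, g q = u
  · obtain ⟨q, hq⟩ := hgu
    obtain _ | k := k
    · exact q.elim0
    by_cases hfx : ∃ p, f p = x₀
    · obtain ⟨p, hp⟩ := hfx
      rw [minor, Matrix.det_succ_column _ q, Finset.sum_eq_single p]
      · refine ((h1.neg_one_pow _).mul (good_val _)).mul ?_
        convert hA _ (f ∘ p.succAbove) (g ∘ q.succAbove) using 1
        unfold minor
        congr 1
        ext i j
        have : g (q.succAbove j) ≠ u := fun h => Fin.succAbove_ne q j (hg (h.trans hq.symm))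
        simp [hmask _ _ this]
      · intro i _ hi
        have : f i ≠ x₀ := fun h => hi (hf (h.trans hp.symm))
        simp [hq, hu _ this]
      · simp
    · push Not at hfx
      have : minor v A f g = 0 :=
        Matrix.det_eq_zero_of_column_eq_zero q fun i => by simp [hq, hu _ (hfx i)]
      rw [this]
      exact good_zero
  · push Not at hgu
    convert hA _ f g using 1
    unfold minor
    congr 1
    ext i j
    simp [hmask _ _ (hgu j)]

end Closure

end PivotMatrix

namespace PivotMatrix

open Sum

/-! ### The bipartite graph of nonzero entries -/

section Connectivity

variable {P R X Y : Type*} [CommGroupWithZero P] [CommRing R] {v : P →*₀ R}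

/-- Adjacency in the bipartite graph of the nonzero entries of `A`. -/
def Adj (A : X → Y → P) : X ⊕ Y → X ⊕ Y → Prop
  | inl x, inr y => A x y ≠ 0
  | inr y, inl x => A x y ≠ 0
  | _, _ => False

theorem Adj.symm {A : X → Y → P} : ∀ {a b : X ⊕ Y}, Adj A a b → Adj A b a
  | inl _, inr _, h => h
  | inr _, inl _, h => h

theorem Adj.ne {A : X → Y → P} : ∀ {a b : X ⊕ Y}, Adj A a b → a ≠ b
  | inl _, inr _, _ => by simp
  | inr _, inl _, _ => by simp

/-- The bipartite graph of `A` induces a connected graph on `W`. -/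
def ConnOn (A : X → Y → P) (W : Set (X ⊕ Y)) : Prop :=
  ∀ C : Set (X ⊕ Y), (∃ w ∈ W, w ∈ C) →
    (∀ a ∈ W, ∀ b ∈ W, Adj A a b → a ∈ C → b ∈ C) → W ⊆ C

theorem connOn_singleton (A : X → Y → P) (z : X ⊕ Y) : ConnOn A {z} := by
  rintro C ⟨w, rfl, hw⟩ _
  simpa using hw

theorem ConnOn.of_dominating {A : X → Y → P} {K W : Set (X ⊕ Y)} (hK : ConnOn A K) (hKW : K ⊆ W)
    (hdom : ∀ w ∈ W, w ∉ K → ∃ k ∈ K, Adj A k w) : ConnOn A W := by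
  rintro C ⟨w, hw, hwC⟩ hC
  have hKC : K ⊆ C := by
    refine hK C ?_ fun a ha b hb => hC a (hKW ha) b (hKW hb)
    by_cases hwK : w ∈ K
    · exact ⟨w, hwK, hwC⟩
    · obtain ⟨k, hk, hkw⟩ := hdom w hw hwK
      exact ⟨k, hk, hC w hw k (hKW hk) hkw.symm hwC⟩
  intro x hx
  by_cases hxK : x ∈ K
  · exact hKC hxK
  · obtain ⟨k, hk, hkx⟩ := hdom x hx hxK
    exact hC k (hKW hk) x hx hkx (hKC hk)

theorem ConnOn.insert_of_adj {A : X → Y → P} {K : Set (X ⊕ Y)} (hK : ConnOn A K) {k n : X ⊕ Y}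
    (hk : k ∈ K) (hkn : Adj A k n) : ConnOn A (insert n K) := by
  refine hK.of_dominating (Set.subset_insert n K) fun w hw hwK => ?_
  rcases hw with rfl | hw
  · exact ⟨k, hk, hkn⟩
  · exact absurd hw hwK

theorem ConnOn.exists_adj {A : X → Y → P} {K W : Set (X ⊕ Y)} (hW : ConnOn A W)
    (hK : ∃ w ∈ W, w ∈ K) (hne : ¬ W ⊆ K) : ∃ a ∈ K, a ∈ W ∧ ∃ b ∈ W, b ∉ K ∧ Adj A a b := by
  by_contra hcon
  push Not at hcon
  refine hne (hW K hK fun a ha b hb hab haK => ?_)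
  by_contra hbK
  exact hcon a haK ha b hb hbK hab

theorem ConnOn.transpose {A : X → Y → P} {W : Set (X ⊕ Y)} (hW : ConnOn A W) :
    ConnOn (fun j i => A i j) (Sum.swap ⁻¹' W) := by
  rintro C ⟨w, hw, hwC⟩ hC x hx
  have := hW (Sum.swap ⁻¹' C) ⟨w.swap, hw, by simpa using hwC⟩ (fun a ha b hb hab haC => by
    refine hC a.swap (by simpa using ha) b.swap (by simpa using hb) ?_ haC
    revert hab
    rcases a with a | a <;> rcases b with b | b <;> exact id) hx
  simpa using this

/-- If the pivot destroys the edge `i j`, then `A i y` and `A x j` were nonzero and stay so; the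
path `i`, `y`, `x`, `j` replaces the lost edge. -/
theorem IsPivot.connOn (hinj : Function.Injective v) {A A' : X → Y → P} {x : X} {y : Y}
    (h : IsPivot v A x y A') {W : Set (X ⊕ Y)} (hx : inl x ∈ W) (hy : inr y ∈ W)
    (hW : ConnOn A W) : ConnOn A' W := by
  intro C hne hC
  refine hW C hne ?_
  have hxy : inl x ∈ C ↔ inr y ∈ C :=
    ⟨hC _ hx _ hy (h.entry_ne hinj), hC _ hy _ hx (h.entry_ne hinj)⟩
  have key : ∀ i j, inl i ∈ W → inr j ∈ W → A i j ≠ 0 → (inl i ∈ C ↔ inr j ∈ C) := by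
    intro i j hi hj hij
    by_cases hij' : A' i j = 0
    · have hix : i ≠ x := by
        rintro rfl
        exact (h.row_ne_zero_iff hinj j).2 hij hij'
      have hjy : j ≠ y := by
        rintro rfl
        exact (h.col_ne_zero_iff hinj i).2 hij hij'
      have e := h.other i j hix hjy
      rw [hij', map_zero] at e
      have h₁ : A' i y ≠ 0 := (h.col_ne_zero_iff hinj i).2 fun h0 => hij <| by
        rw [← val_eq_zero hinj]
        simpa [h0, eq_comm] using e
      have h₂ : A' x j ≠ 0 := (h.row_ne_zero_iff hinj j).2 fun h0 => hij <| by
        rw [← val_eq_zero hinj]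
        simpa [h0, eq_comm] using e
      have e₁ : inl i ∈ C ↔ inr y ∈ C := ⟨hC _ hi _ hy h₁, hC _ hy _ hi h₁⟩
      have e₂ : inl x ∈ C ↔ inr j ∈ C := ⟨hC _ hx _ hj h₂, hC _ hj _ hx h₂⟩
      rw [e₁, ← hxy, e₂]
    · exact ⟨hC _ hi _ hj hij', hC _ hj _ hi hij'⟩
  rintro (i | j) ha (i' | j') hb hab
  · exact hab.elim
  · exact (key i j' ha hb hab).1
  · exact (key i' j hb ha hab).2
  · exact hab.elim

/-- A connected bipartite graph with a vertex of degree at least three has two vertices on the same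
side whose deletion leaves a connected graph. -/
theorem ConnOn.exists_pair [Finite X] [Finite Y] {A : X → Y → P} {W : Set (X ⊕ Y)}
    (hW : ConnOn A W) {z n₁ n₂ n₃ : X ⊕ Y} (hz : z ∈ W) (h₁ : n₁ ∈ W) (h₂ : n₂ ∈ W) (h₃ : n₃ ∈ W)
    (h₁₂ : n₁ ≠ n₂) (h₁₃ : n₁ ≠ n₃) (h₂₃ : n₂ ≠ n₃) (a₁ : Adj A z n₁) (a₂ : Adj A z n₂)
    (a₃ : Adj A z n₃) :
    (∃ u w : X, u ≠ w ∧ inl u ∈ W ∧ inl w ∈ W ∧ ConnOn A (W \ {inl u, inl w})) ∨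
    ∃ u w : Y, u ≠ w ∧ inr u ∈ W ∧ inr w ∈ W ∧ ConnOn A (W \ {inr u, inr w}) := by
  let bd : Set (X ⊕ Y) → X ⊕ Y → Prop := fun K b => b ∈ W ∧ b ∉ K ∧ ∃ k ∈ K, Adj A k b
  -- A maximal connected `K` with at least three outside neighbours is taken, starting from `{z}`.
  -- Maximality forces every vertex of `W` outside `K` to be a neighbour of `K`.
  let 𝓕 : Set (Set (X ⊕ Y)) := {K | K ⊆ W ∧ K.Nonempty ∧ ConnOn A K ∧
    ∃ b₁ b₂ b₃, b₁ ≠ b₂ ∧ b₁ ≠ b₃ ∧ b₂ ≠ b₃ ∧ bd K b₁ ∧ bd K b₂ ∧ bd K b₃}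
  obtain ⟨K, hK⟩ := (Set.toFinite 𝓕).exists_maximal ⟨{z}, by simpa using hz, by simp,
    connOn_singleton A z, n₁, n₂, n₃, h₁₂, h₁₃, h₂₃, ⟨h₁, by simpa using a₁.ne.symm, z, rfl, a₁⟩,
    ⟨h₂, by simpa using a₂.ne.symm, z, rfl, a₂⟩, ⟨h₃, by simpa using a₃.ne.symm, z, rfl, a₃⟩⟩
  obtain ⟨⟨hKW, ⟨k₀, hk₀⟩, hKc, b₁, b₂, b₃, h12, h13, h23, hb₁, hb₂, hb₃⟩, hmax⟩ := hK
  have hdom : ∀ w ∈ W, w ∉ K → ∃ k ∈ K, Adj A k w := by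
    by_contra hcon
    push Not at hcon
    obtain ⟨w, hwW, hwK, hw⟩ := hcon
    obtain ⟨a, haD, haW, b, hbW, hbD, hab⟩ :=
      hW.exists_adj (K := {w | w ∈ K ∨ bd K w}) ⟨k₀, hKW hk₀, Or.inl hk₀⟩ (fun hsub => by
        rcases hsub hwW with h | ⟨_, _, k, hk, hkw⟩
        · exact hwK h
        · exact hw k hk hkw)
    have hbK : b ∉ K := fun h => hbD (Or.inl h)
    have hbb : ¬ bd K b := fun h => hbD (Or.inr h)
    rcases haD with haK | haB
    · exact hbb ⟨hbW, hbK, a, haK, hab⟩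
    obtain ⟨_, haK, k, hk, hka⟩ := haB
    have hne : ∀ c, bd K c → c ≠ b := by
      rintro c hc rfl
      exact hbb hc
    have hbd : ∀ c, bd K c → c ≠ a → bd (insert a K) c := fun c hc hca =>
      ⟨hc.1, by simp [hca, hc.2.1], hc.2.2.imp fun k hk => ⟨Or.inr hk.1, hk.2⟩⟩
    have hbdb : bd (insert a K) b := ⟨hbW, by simp [hab.ne.symm, hbK], a, Or.inl rfl, hab⟩
    -- Absorbing `a` costs one boundary vertex and gains the new one `b`, so three remain.
    have hmem : insert a K ∈ 𝓕 := by
      refine ⟨Set.insert_subset haW hKW, ⟨a, Or.inl rfl⟩, hKc.insert_of_adj hk hka, ?_⟩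
      by_cases e₁ : b₁ = a
      · subst e₁
        exact ⟨b, b₂, b₃, (hne _ hb₂).symm, (hne _ hb₃).symm, h23, hbdb, hbd _ hb₂ h12.symm,
          hbd _ hb₃ h13.symm⟩
      by_cases e₂ : b₂ = a
      · subst e₂
        exact ⟨b₁, b, b₃, hne _ hb₁, h13, (hne _ hb₃).symm, hbd _ hb₁ h12, hbdb, hbd _ hb₃ h23.symm⟩
      · exact ⟨b₁, b₂, b, h12, hne _ hb₁, hne _ hb₂, hbd _ hb₁ e₁, hbd _ hb₂ e₂, hbdb⟩
    exact haK (hmax hmem (Set.subset_insert a K) (Or.inl rfl))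
  -- Since `K` dominates `W`, boundary vertices can be removed without disconnecting anything; two
  -- of the three lie on the same side.
  have hfin : ∀ c d, bd K c → bd K d → ConnOn A (W \ {c, d}) := fun c d hc hd =>
    hKc.of_dominating (fun k hk => ⟨hKW hk, by
      rintro (rfl | rfl)
      · exact hc.2.1 hk
      · exact hd.2.1 hk⟩) fun w hw => hdom w hw.1
  rcases b₁ with b₁ | b₁ <;> rcases b₂ with b₂ | b₂ <;> rcases b₃ with b₃ | b₃
  · exact Or.inl ⟨b₁, b₂, by simpa using h12, hb₁.1, hb₂.1, hfin _ _ hb₁ hb₂⟩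
  · exact Or.inl ⟨b₁, b₂, by simpa using h12, hb₁.1, hb₂.1, hfin _ _ hb₁ hb₂⟩
  · exact Or.inl ⟨b₁, b₃, by simpa using h13, hb₁.1, hb₃.1, hfin _ _ hb₁ hb₃⟩
  · exact Or.inr ⟨b₂, b₃, by simpa using h23, hb₂.1, hb₃.1, hfin _ _ hb₂ hb₃⟩
  · exact Or.inl ⟨b₂, b₃, by simpa using h23, hb₂.1, hb₃.1, hfin _ _ hb₂ hb₃⟩
  · exact Or.inr ⟨b₁, b₃, by simpa using h13, hb₁.1, hb₃.1, hfin _ _ hb₁ hb₃⟩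
  · exact Or.inr ⟨b₁, b₂, by simpa using h12, hb₁.1, hb₂.1, hfin _ _ hb₁ hb₂⟩
  · exact Or.inr ⟨b₁, b₂, by simpa using h12, hb₁.1, hb₂.1, hfin _ _ hb₁ hb₂⟩

/-- There is a chain of `n + 1` rows from `a` to `b`, in which consecutive rows have a common
nonzero position outside the columns in `U`. -/
def RowChain (A : X → Y → P) (U : Set Y) : ℕ → X → X → Prop
  | 0, a, b => a = b
  | n + 1, a, b => ∃ c, (∃ y ∉ U, A a y ≠ 0 ∧ A c y ≠ 0) ∧ RowChain A U n c b

theorem ConnOn.exists_rowChain {A : X → Y → P} {U : Set Y} {W : Set (X ⊕ Y)} (hW : ConnOn A W)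
    (hU : ∀ y, inr y ∈ W → y ∉ U) {a b : X} (ha : inl a ∈ W) (hb : inl b ∈ W) :
    ∃ n, RowChain A U n a b := by
  have := hW (Sum.elim (fun x => ∃ n, RowChain A U n x b)
    fun y => ∃ x, A x y ≠ 0 ∧ ∃ n, RowChain A U n x b) ⟨inl b, hb, 0, rfl⟩ (by
      rintro (i | j) ha (i' | j') hb hab hC
      · exact hab.elim
      · exact ⟨i, hab, hC⟩
      · obtain ⟨x, hx, n, hn⟩ := hC
        exact ⟨n + 1, x, ⟨j, hU j ha, hab, hx⟩, hn⟩
      · exact hab.elim) ha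
  exact this

theorem RowChain.congr {A A' : X → Y → P} {U : Set Y} {b : X} : ∀ {k : ℕ} {x : X},
    (∀ j ≤ k, ∀ x, RowChain A U j x b → A' x = A x) → RowChain A U k x b → RowChain A' U k x b
  | 0, _, _, h => h
  | k + 1, x, hrow, ⟨c, ⟨y, hy, hxy, hcy⟩, hc⟩ => by
    refine ⟨c, ⟨y, hy, ?_, ?_⟩, RowChain.congr (fun j hj => hrow j (hj.trans k.le_succ)) hc⟩
    · rwa [hrow (k + 1) le_rfl x ⟨c, ⟨y, hy, hxy, hcy⟩, hc⟩]
    · rwa [hrow k k.le_succ c hc]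

/-- Chains of rows can be shortened by pivoting, without affecting the rows at the ends. -/
theorem RowChain.shorten (hinj : Function.Injective v) {U : Set Y} {𝒮 : Set (X → Y → P)}
    (hpiv : ∀ A ∈ 𝒮, ∀ x, ∀ y ∉ U, A x y ≠ 0 → ∃ A' ∈ 𝒮, IsPivot v A x y A')
    {Φ : (Y → P) → (Y → P) → Prop}
    (hΦ : ∀ A ∈ 𝒮, ∀ n ≤ 2, ∀ a b, RowChain A U n a b → Φ (A a) (A b)) (n : ℕ) :
    ∀ A ∈ 𝒮, ∀ a b, RowChain A U n a b → Φ (A a) (A b) := by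
  induction n using Nat.strong_induction_on with
  | _ n ih =>
  intro A hA a b hab
  by_cases hs : ∃ m < n, RowChain A U m a b
  · obtain ⟨m, hm, hmab⟩ := hs
    exact ih m hm A hA a b hmab
  push Not at hs
  match n, ih, hab, hs with
  | 0, _, hab, _ => exact hΦ A hA 0 (by omega) a b hab
  | 1, _, hab, _ => exact hΦ A hA 1 (by omega) a b hab
  | 2, _, hab, _ => exact hΦ A hA 2 (by omega) a b hab
  | k + 3, ih, ⟨c, ⟨y₁, hy₁, ha₁, hc₁⟩, d, ⟨y₂, hy₂, hc₂, hd₂⟩, e, ⟨y₃, hy₃, hd₃, he₃⟩, heb⟩, hs =>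
    -- The chain `a, c, d, e, …, b` is shortest. Hence `a` and all rows from `e` on vanish in column
    -- `y₂` and survive the pivot unchanged, whereas `d`, which vanished in `y₁`, becomes nonzero
    -- there and is now linked directly to `a`. As `c` vanishes in `y₃`, the link from `d` to `e`
    -- persists, and `c` drops out of the chain.
    obtain ⟨A', hA', hp⟩ := hpiv A hA c y₂ hy₂ hc₂
    have hdb : RowChain A U (k + 1) d b := ⟨e, ⟨y₃, hy₃, hd₃, he₃⟩, heb⟩
    have ha₂ : A a y₂ = 0 := by
      by_contra h
      exact hs (k + 2) (by omega) ⟨d, ⟨y₂, hy₂, h, hd₂⟩, hdb⟩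
    have hd₁ : A d y₁ = 0 := by
      by_contra h
      exact hs (k + 2) (by omega) ⟨d, ⟨y₁, hy₁, ha₁, h⟩, hdb⟩
    have hc₃ : A c y₃ = 0 := by
      by_contra h
      exact hs (k + 2) (by omega) ⟨c, ⟨y₁, hy₁, ha₁, hc₁⟩, e, ⟨y₃, hy₃, h, he₃⟩, heb⟩
    have hrow : ∀ j ≤ k, ∀ x, RowChain A U j x b → A' x = A x := by
      intro j hj x hx
      have : A x y₂ = 0 := by
        by_contra h
        exact hs (j + 2) (by omega) ⟨c, ⟨y₁, hy₁, ha₁, hc₁⟩, x, ⟨y₂, hy₂, hc₂, h⟩, hx⟩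
      exact funext (hp.row_eq hinj this)
    have hea : A' a = A a := funext (hp.row_eq hinj ha₂)
    have heb' : A' b = A b := hrow 0 (Nat.zero_le k) b rfl
    rw [← hea, ← heb']
    refine ih (k + 2) (by omega) A' hA' a b ⟨d, ⟨y₁, hy₁, ?_, ?_⟩, e, ⟨y₃, hy₃, ?_, ?_⟩,
      RowChain.congr hrow heb⟩
    · rwa [hea]
    · exact hp.other_ne_zero hinj hd₁ hd₂ hc₁
    · rwa [hp.col_eq hinj hc₃]
    · rwa [hrow k le_rfl e heb]

end Connectivity

end PivotMatrix

/-! ### Cross ratios and the lifting of fundamental elements -/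

namespace PivotMatrix

open Sum

/-- This translates between `2 × 2` minors and fundamental elements: with `r` and `s` the two
products in the minor, `r / s` is its cross ratio. -/
theorem good_one_sub_div_iff {P R : Type*} [CommGroupWithZero P] [CommRing R] {v : P →*₀ R}
    {r s : P} (hs : s ≠ 0) : Good v (1 - v (r / s)) ↔ Good v (v s - v r) := by
  have e : v s - v r = v s * (1 - v (r / s)) := by
    rw [mul_sub, mul_one, ← map_mul, mul_div_cancel₀ _ hs]
  rw [e]
  exact ⟨fun h => (good_val s).mul h, fun h => h.of_mul hs⟩

/-- `φ : Q → P` is a homomorphism of partial fields along which the fundamental elements of `P`,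
those `x` for which `1 - x` is defined, can be lifted in a consistent way. -/
structure IsLifting {P Q RP RQ : Type*} [CommGroupWithZero P] [CommGroupWithZero Q] [CommRing RP]
    [CommRing RQ] (vQ : Q →*₀ RQ) (vP : P →*₀ RP) (φ : Q →*₀ P) : Prop where
  injQ : Function.Injective vQ
  injP : Function.Injective vP
  negQ : Good vQ (-1)
  negP : Good vP (-1)
  map_add : ∀ p q r, vQ r = vQ p + vQ q → vP (φ r) = vP (φ p) + vP (φ q)
  surj : Function.Surjective φ
  exists_fund : ∀ x, Good vP (1 - vP x) → ∃ q, Good vQ (1 - vQ q) ∧ φ q = x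
  inj_fund : ∀ p q, Good vQ (1 - vQ p) → Good vQ (1 - vQ q) → φ p = φ q → p = q
  div_fund : ∀ p q, p ≠ 0 → q ≠ 0 → Good vQ (1 - vQ p) → Good vQ (1 - vQ q) →
    Good vP (1 - vP (φ (p / q))) → Good vQ (1 - vQ (p / q))
  neg_fund : ∀ t, Good vQ (1 + vQ t) → Good vP (1 - vP (φ t)) → Good vQ (1 - vQ t)

section Lifting

variable {P Q RP RQ X Y : Type*} [CommGroupWithZero P] [CommGroupWithZero Q] [CommRing RP]
  [CommRing RQ] {vQ : Q →*₀ RQ} {vP : P →*₀ RP} {φ : Q →*₀ P}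

namespace IsLifting

variable (h : IsLifting vQ vP φ)

include h

theorem map_sub_mul {r p q s t : Q} (e : vQ r = vQ p * vQ q - vQ s * vQ t) :
    vP (φ r) = vP (φ p) * vP (φ q) - vP (φ s) * vP (φ t) := by
  have := h.map_add r (s * t) (p * q) (by
    rw [map_mul, map_mul]
    linear_combination -e)
  simp only [map_mul] at this
  linear_combination -this

theorem map_neg_one {m : Q} (hm : vQ m = -1) : vP (φ m) = -1 := by
  have := h.map_add m 1 0 (by simp [hm])
  simp only [map_zero, map_one] at this
  linear_combination -this

theorem map_isPivot {B B' : X → Y → Q} {x : X} {y : Y} (hp : IsPivot vQ B x y B') :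
    IsPivot vP (fun i j => φ (B i j)) x y fun i j => φ (B' i j) where
  ne := (map_ne_zero φ).2 hp.ne
  entry := by
    have e := hp.entry
    rw [← map_mul] at e
    rw [← map_mul, ← map_mul, h.map_neg_one e]
  row j hj := by rw [hp.row j hj, map_mul, map_inv₀]
  col i hi := by rw [hp.col i hi, map_mul, map_inv₀]
  other i j hi hj := by
    have := h.map_sub_mul (r := B' i j) (p := B i j) (q := 1) (s := B i y * B x j) (t := (B x y)⁻¹)
      (by rw [hp.other i j hi hj, map_one, mul_one, map_mul])
    rw [this]
    simp

/-- The case of two rows with a common nonzero entry in a further column. -/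
theorem good_of_common {au aw ay bu bw b_y : Q} (hay : ay ≠ 0) (hby : b_y ≠ 0)
    (hu : Good vQ (vQ ay * vQ bu - vQ au * vQ b_y)) (hw : Good vQ (vQ ay * vQ bw - vQ aw * vQ b_y))
    (hP : Good vP (vP (φ au) * vP (φ bw) - vP (φ aw) * vP (φ bu))) :
    Good vQ (vQ au * vQ bw - vQ aw * vQ bu) := by
  by_cases hau : au = 0
  · simpa [hau] using Good.neg h.negQ (good_val (v := vQ) (aw * bu))
  by_cases hbw : bw = 0
  · simpa [hbw] using Good.neg h.negQ (good_val (v := vQ) (aw * bu))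
  by_cases haw : aw = 0
  · simpa [haw] using good_val (v := vQ) (au * bw)
  by_cases hbu : bu = 0
  · simpa [hbu] using good_val (v := vQ) (au * bw)
  -- The two arguments are the cross ratios of the column pairs `y, u` and `y, w`; their quotient is
  -- the cross ratio for `u, w`.
  have key := h.div_fund (au * b_y / (ay * bu)) (aw * b_y / (ay * bw))
    (by simp [hau, hay, hbu, hby]) (by simp [haw, hay, hbw, hby])
    ((good_one_sub_div_iff (mul_ne_zero hay hbu)).2 (by simpa using hu))
    ((good_one_sub_div_iff (mul_ne_zero hay hbw)).2 (by simpa using hw))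
  have e : au * b_y / (ay * bu) / (aw * b_y / (ay * bw)) = au * bw / (aw * bu) := by
    field_simp
  rw [e, good_one_sub_div_iff (mul_ne_zero haw hbu), map_div₀, good_one_sub_div_iff
    ((map_ne_zero φ).2 (mul_ne_zero haw hbu))] at key
  have := key (by
    convert Good.neg h.negP hP using 1
    simp)
  convert Good.neg h.negQ this using 1
  simp

/-- Two rows connected by a third one, generic case. -/
theorem good_of_path {au aw a1 cu cw c1 bu bw g k d e f : Q} (ha1 : a1 ≠ 0) (hc1 : c1 ≠ 0)
    (hcu : cu ≠ 0) (hg0 : g ≠ 0) (hg : vQ g = vQ au * vQ c1 - vQ a1 * vQ cu)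
    (hk : vQ k = vQ aw * vQ c1 - vQ a1 * vQ cw) (hd : vQ d = vQ au * vQ cw - vQ aw * vQ cu)
    (he : vQ e = vQ cu * vQ bw - vQ cw * vQ bu) (hf : vQ f = vQ g * vQ bw - vQ k * vQ bu)
    (hP : Good vP (vP (φ au) * vP (φ bw) - vP (φ aw) * vP (φ bu))) :
    Good vQ (vQ au * vQ bw - vQ aw * vQ bu) := by
  by_cases hau : au = 0
  · simpa [hau] using Good.neg h.negQ (good_val (v := vQ) (aw * bu))
  by_cases hbu : bu = 0
  · simpa [hbu] using good_val (v := vQ) (au * bw)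
  -- The wanted minor, times `g`, becomes a difference of two monomials. Their ratio is a quotient
  -- of two fundamental elements, as `cu * f - bu * d * c1 = e * g` and `a1 * cu - au * c1 = -g`.
  have key : vQ g * (vQ au * vQ bw - vQ aw * vQ bu) = vQ au * vQ f - vQ bu * vQ a1 * vQ d := by
    rw [hf, hd, hk, hg]
    ring
  have keyP : vP (φ g) * (vP (φ au) * vP (φ bw) - vP (φ aw) * vP (φ bu)) =
      vP (φ au) * vP (φ f) - vP (φ bu) * vP (φ a1) * vP (φ d) := by
    rw [h.map_sub_mul hf, h.map_sub_mul hd, h.map_sub_mul hk, h.map_sub_mul hg]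
    ring
  refine Good.of_mul hg0 ?_
  rw [key]
  by_cases hf0 : f = 0
  · simpa [hf0] using Good.neg h.negQ (good_val (v := vQ) (bu * a1 * d))
  by_cases hd0 : d = 0
  · simpa [hd0] using good_val (v := vQ) (au * f)
  have key2 := h.div_fund (bu * d * c1 / (cu * f)) (au * c1 / (a1 * cu))
    (by simp [hbu, hd0, hc1, hcu, hf0]) (by simp [hau, hc1, ha1, hcu])
    ((good_one_sub_div_iff (mul_ne_zero hcu hf0)).2 (by
      convert good_val (v := vQ) (e * g) using 1
      simp only [map_mul]
      rw [hf, hd, he, hk, hg]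
      ring))
    ((good_one_sub_div_iff (mul_ne_zero ha1 hcu)).2 (by
      convert Good.neg h.negQ (good_val (v := vQ) g) using 1
      simp only [map_mul]
      rw [hg]
      ring))
  have e' : bu * d * c1 / (cu * f) / (au * c1 / (a1 * cu)) = bu * a1 * d / (au * f) := by
    field_simp
  rw [e', good_one_sub_div_iff (mul_ne_zero hau hf0), map_div₀, good_one_sub_div_iff
    ((map_ne_zero φ).2 (mul_ne_zero hau hf0))] at key2
  simpa using key2 (by
    convert (good_val (φ g)).mul hP using 1
    rw [keyP]
    simp)

/-- Two rows connected by a third one, special case. -/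
theorem good_of_path_special {au aw a1 cu c1 c2 bu bw b2 : Q} (hc1 : c1 ≠ 0) (hc2 : c2 ≠ 0)
    (hcu : cu ≠ 0) (hb2 : b2 ≠ 0) (hau : au * c1 = a1 * cu) (hbu : bu * c2 = b2 * cu)
    (hs : Good vQ (vQ aw * vQ c1 * vQ b2 + vQ a1 * vQ c2 * vQ bw))
    (hP : Good vP (vP (φ au) * vP (φ bw) - vP (φ aw) * vP (φ bu))) :
    Good vQ (vQ au * vQ bw - vQ aw * vQ bu) := by
  by_cases haw : aw = 0
  · simpa [haw] using good_val (v := vQ) (au * bw)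
  have hne : aw * b2 * c1 ≠ 0 := mul_ne_zero (mul_ne_zero haw hb2) hc1
  -- By proportionality in column `u`, the wanted minor is, up to units, `1 - t` for this `t`. The
  -- hypothesis `hs` controls only `1 + t`, and `hP` controls `1 - t` after applying `φ`.
  have key := h.neg_fund (a1 * c2 * bw / (aw * b2 * c1)) (by
    refine Good.of_mul hne ?_
    rw [mul_add, ← map_mul, mul_div_cancel₀ _ hne, mul_one]
    convert hs using 1
    simp only [map_mul]
    ring)
  rw [good_one_sub_div_iff hne, map_div₀, good_one_sub_div_iff ((map_ne_zero φ).2 hne)] at key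
  have e₁ := congrArg vQ hau
  have e₂ := congrArg vQ hbu
  have e₃ := congrArg (fun x => vP (φ x)) hau
  have e₄ := congrArg (fun x => vP (φ x)) hbu
  simp only [map_mul] at e₁ e₂ e₃ e₄
  refine Good.of_mul (mul_ne_zero hc1 hc2) ?_
  have := key (by
    refine Good.of_mul ((map_ne_zero φ).2 hcu) ?_
    convert Good.neg h.negP ((good_val (φ (c1 * c2))).mul hP) using 1
    simp only [map_mul]
    linear_combination (vP (φ c2) * vP (φ bw)) * e₃ - (vP (φ aw) * vP (φ c1)) * e₄)
  convert Good.neg h.negQ ((good_val cu).mul this) using 1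
  simp only [map_mul]
  linear_combination (vQ c2 * vQ bw) * e₁ - (vQ aw * vQ c1) * e₂

end IsLifting

end Lifting

end PivotMatrix

namespace PivotMatrix

open Sum

/-! ### Matrices with two uncontrolled columns -/

section TwoColumns

variable {P Q RP RQ X Y : Type*} [CommGroupWithZero P] [CommGroupWithZero Q] [CommRing RP]
  [CommRing RQ] {vQ : Q →*₀ RQ} {vP : P →*₀ RP} {φ : Q →*₀ P}

/-- `B` is a matrix over `Q` for which the image under `φ` has its minors in `P`, and all minors
of `B` that avoid one of the columns `u` and `w` are in `Q`. The matrix obtained by deleting both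
columns is connected, with set of rows and columns `W`. -/
structure TwoColumns (vQ : Q →*₀ RQ) (vP : P →*₀ RP) (φ : Q →*₀ P) (W : Set (X ⊕ Y)) (u w : Y)
    (B : X → Y → Q) : Prop where
  ne : u ≠ w
  fst_notMem : inr u ∉ W
  snd_notMem : inr w ∉ W
  image : DetGood vP fun x y => φ (B x y)
  fst : DetGood vQ (mask {inr u}ᶜ B)
  snd : DetGood vQ (mask {inr w}ᶜ B)
  conn : ConnOn B W
  row : ∀ x y, B x y ≠ 0 → inl x ∈ W
  col : ∀ x y, y ≠ u → y ≠ w → B x y ≠ 0 → inr y ∈ W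

namespace TwoColumns

variable {W : Set (X ⊕ Y)} {u w : Y} {B : X → Y → Q}

theorem symm (hB : TwoColumns vQ vP φ W u w B) : TwoColumns vQ vP φ W w u B :=
  ⟨hB.ne.symm, hB.snd_notMem, hB.fst_notMem, hB.image, hB.snd, hB.fst, hB.conn, hB.row,
    fun x y h₁ h₂ => hB.col x y h₂ h₁⟩

theorem good_two (hB : TwoColumns vQ vP φ W u w B) (a b : X) {y z : Y} (hy : y ≠ w) (hz : z ≠ w) :
    Good vQ (vQ (B a y) * vQ (B b z) - vQ (B a z) * vQ (B b y)) := by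
  have := hB.snd.two a b y z
  rwa [mask_of_mem (by simp) (by simpa using hy), mask_of_mem (by simp) (by simpa using hz),
    mask_of_mem (by simp) (by simpa using hz), mask_of_mem (by simp) (by simpa using hy)] at this

/-- A `2 × 2` minor through a column other than `u` and `w` omits one of these two, so it is already
good and the pivot exists. -/
theorem exists_pivot (h : IsLifting vQ vP φ) (hB : TwoColumns vQ vP φ W u w B) {x : X} {y : Y}
    (hyu : y ≠ u) (hyw : y ≠ w) (ne : B x y ≠ 0) :
    ∃ B', TwoColumns vQ vP φ W u w B' ∧ IsPivot vQ B x y B' := by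
  obtain ⟨B', hp⟩ := exists_isPivot_of_minors h.negQ ne fun i j => by
    by_cases hj : j = w
    · subst hj
      exact hB.symm.good_two x i hyu hB.ne.symm
    · exact hB.good_two x i hyw hj
  have hx := hB.row x y ne
  have hy := hB.col x y hyu hyw ne
  refine ⟨B', ⟨hB.ne, hB.fst_notMem, hB.snd_notMem, hB.image.pivot h.negP (h.map_isPivot hp),
    hB.fst.pivot h.negQ (hp.mask (by simp) (by simpa using hyu)),
    hB.snd.pivot h.negQ (hp.mask (by simp) (by simpa using hyw)),
    hp.connOn h.injQ hx hy hB.conn, ?_, ?_⟩, hp⟩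
  · intro i j hij
    by_cases hi : B i y = 0
    · rw [hp.row_eq h.injQ hi] at hij
      exact hB.row i j hij
    · exact hB.row i y hi
  · intro i j hju hjw hij
    by_cases hj : B x j = 0
    · rw [hp.col_eq h.injQ hj] at hij
      exact hB.col i j hju hjw hij
    · exact hB.col x j hju hjw hj

theorem good_of_common (h : IsLifting vQ vP φ) (hB : TwoColumns vQ vP φ W u w B) {a b : X} {y : Y}
    (hyu : y ≠ u) (hyw : y ≠ w) (ha : B a y ≠ 0) (hb : B b y ≠ 0) :
    Good vQ (vQ (B a u) * vQ (B b w) - vQ (B a w) * vQ (B b u)) :=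
  h.good_of_common ha hb (hB.good_two a b hyw hB.ne) (hB.symm.good_two a b hyu hB.ne.symm)
    (hB.image.two a b u w)

/-- Pivoting on `(c, y₁)` gives rows `a` and `b` the common column `y₂`; the minor in `u, w` after
the pivot supplies `f`, and the original minors of `a, c` and `c, b` supply `d` and `e'`. -/
theorem good_of_path (h : IsLifting vQ vP φ) (hB : TwoColumns vQ vP φ W u w B) {a b c : X}
    {y₁ y₂ : Y} (hu₁ : y₁ ≠ u) (hw₁ : y₁ ≠ w) (hu₂ : y₂ ≠ u) (hw₂ : y₂ ≠ w) (ha₁ : B a y₁ ≠ 0)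
    (hc₁ : B c y₁ ≠ 0) (hc₂ : B c y₂ ≠ 0) (hb₂ : B b y₂ ≠ 0) (ha₂ : B a y₂ = 0) (hb₁ : B b y₁ = 0)
    (hcu : B c u ≠ 0) (hne : B a u * B c y₁ ≠ B a y₁ * B c u) :
    Good vQ (vQ (B a u) * vQ (B b w) - vQ (B a w) * vQ (B b u)) := by
  obtain ⟨B', hB', hp⟩ := hB.exists_pivot h hu₁ hw₁ hc₁
  have hac : a ≠ c := by
    rintro rfl
    exact hc₂ ha₂
  have e := val_mul_inv (v := vQ) hc₁
  have hg : ∀ z, z ≠ y₁ → vQ (B' a z * B c y₁) = vQ (B a z) * vQ (B c y₁) - vQ (B a y₁) * vQ (B c z) := by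
    intro z hz
    rw [map_mul, hp.other a z hac hz]
    linear_combination (-vQ (B a y₁) * vQ (B c z)) * e
  have hbrow : ∀ z, B' b z = B b z := hp.row_eq h.injQ hb₁
  have hf := (hB'.good_of_common h hu₂ hw₂ (hp.other_ne_zero h.injQ ha₂ ha₁ hc₂)
    (by rwa [hbrow] : B' b y₂ ≠ 0)).mul (good_val (B c y₁))
  rw [hbrow, hbrow] at hf
  obtain ⟨f, hf⟩ := hf
  obtain ⟨d, hd⟩ := hB.good_of_common h hu₁ hw₁ ha₁ hc₁
  obtain ⟨e', he⟩ := hB.good_of_common h hu₂ hw₂ hc₂ hb₂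
  refine h.good_of_path ha₁ hc₁ hcu ?_ (hg u hu₁.symm) (hg w hw₁.symm) hd he (f := f) ?_
    (hB.image.two a b u w)
  · intro h0
    apply hne
    apply h.injQ
    have := hg u hu₁.symm
    rw [h0, map_zero] at this
    rw [map_mul, map_mul]
    linear_combination -this
  · rw [hf, map_mul, map_mul]
    ring

/-- The sum with a plus sign is a minor in the columns `w, y₂` after pivoting on `(c, y₁)`: the zero
`B a y₂` turns into a negative product, and column `w` is unchanged because `B c w = 0`. -/
theorem good_of_path_special (h : IsLifting vQ vP φ) (hB : TwoColumns vQ vP φ W u w B) {a b c : X}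
    {y₁ y₂ : Y} (hu₁ : y₁ ≠ u) (hw₁ : y₁ ≠ w) (hu₂ : y₂ ≠ u) (ha₁ : B a y₁ ≠ 0)
    (hc₁ : B c y₁ ≠ 0) (hc₂ : B c y₂ ≠ 0) (hb₂ : B b y₂ ≠ 0) (ha₂ : B a y₂ = 0) (hb₁ : B b y₁ = 0)
    (hcu : B c u ≠ 0) (hcw : B c w = 0) (hea : B a u * B c y₁ = B a y₁ * B c u)
    (heb : B b u * B c y₂ = B b y₂ * B c u) :
    Good vQ (vQ (B a u) * vQ (B b w) - vQ (B a w) * vQ (B b u)) := by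
  obtain ⟨B', hB', hp⟩ := hB.exists_pivot h hu₁ hw₁ hc₁
  have hac : a ≠ c := by
    rintro rfl
    exact hc₂ ha₂
  have h₂₁ : y₂ ≠ y₁ := by
    rintro rfl
    exact ha₁ ha₂
  have e := val_mul_inv (v := vQ) hc₁
  have hs := (hB'.symm.good_two a b hB.ne.symm hu₂).mul (good_val (B c y₁))
  rw [hp.row_eq h.injQ hb₁, hp.row_eq h.injQ hb₁, hp.col_eq h.injQ hcw,
    hp.other a y₂ hac h₂₁, ha₂, map_zero] at hs
  refine h.good_of_path_special hc₁ hc₂ hcu hb₂ hea heb ?_ (hB.image.two a b u w)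
  convert hs using 1
  linear_combination (-vQ (B a y₁) * vQ (B c y₂) * vQ (B b w)) * e

theorem good_of_rowChain (h : IsLifting vQ vP φ) (hB : TwoColumns vQ vP φ W u w B) {n : ℕ}
    (hn : n ≤ 2) {a b : X} (hab : RowChain B {u, w} n a b) :
    Good vQ (vQ (B a u) * vQ (B b w) - vQ (B a w) * vQ (B b u)) := by
  have swap : Good vQ (vQ (B a w) * vQ (B b u) - vQ (B a u) * vQ (B b w)) →
      Good vQ (vQ (B a u) * vQ (B b w) - vQ (B a w) * vQ (B b u)) := fun hg => by
    convert Good.neg h.negQ hg using 1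
    ring
  match n, hn, hab with
  | 0, _, hab =>
    obtain rfl : a = b := hab
    convert good_zero (v := vQ) using 1
    ring
  | 1, _, ⟨c, ⟨y, hy, ha, hc⟩, hcb⟩ =>
    obtain rfl : c = b := hcb
    simp only [Set.mem_insert_iff, Set.mem_singleton_iff, not_or] at hy
    exact hB.good_of_common h hy.1 hy.2 ha hc
  | 2, _, ⟨c, ⟨y₁, hy₁, ha₁, hc₁⟩, d, ⟨y₂, hy₂, hc₂, hb₂⟩, hdb⟩ =>
    obtain rfl : d = b := hdb
    simp only [Set.mem_insert_iff, Set.mem_singleton_iff, not_or] at hy₁ hy₂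
    by_cases ha₂ : B a y₂ = 0
    swap
    · exact hB.good_of_common h hy₂.1 hy₂.2 ha₂ hb₂
    by_cases hb₁ : B d y₁ = 0
    swap
    · exact hB.good_of_common h hy₁.1 hy₁.2 ha₁ hb₁
    have hu : B c u ≠ 0 → ¬ (B a u * B c y₁ = B a y₁ * B c u ∧ B d u * B c y₂ = B d y₂ * B c u) →
        Good vQ (vQ (B a u) * vQ (B d w) - vQ (B a w) * vQ (B d u)) := by
      intro hcu hne
      by_cases hne₁ : B a u * B c y₁ = B a y₁ * B c u
      · refine swap ?_
        have := hB.good_of_path h hy₂.1 hy₂.2 hy₁.1 hy₁.2 hb₂ hc₂ hc₁ ha₁ hb₁ ha₂ hcu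
          fun hne₂ => hne ⟨hne₁, hne₂⟩
        convert this using 1
        ring
      · exact hB.good_of_path h hy₁.1 hy₁.2 hy₂.1 hy₂.2 ha₁ hc₁ hc₂ hb₂ ha₂ hb₁ hcu hne₁
    have hw : B c w ≠ 0 → ¬ (B a w * B c y₁ = B a y₁ * B c w ∧ B d w * B c y₂ = B d y₂ * B c w) →
        Good vQ (vQ (B a u) * vQ (B d w) - vQ (B a w) * vQ (B d u)) := by
      intro hcw hne
      by_cases hne₁ : B a w * B c y₁ = B a y₁ * B c w
      · have := hB.symm.good_of_path h hy₂.2 hy₂.1 hy₁.2 hy₁.1 hb₂ hc₂ hc₁ ha₁ hb₁ ha₂ hcw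
          fun hne₂ => hne ⟨hne₁, hne₂⟩
        convert this using 1
        ring
      · exact swap
          (hB.symm.good_of_path h hy₁.2 hy₁.1 hy₂.2 hy₂.1 ha₁ hc₁ hc₂ hb₂ ha₂ hb₁ hcw hne₁)
    by_cases hcu : B c u = 0
    · by_cases hcw : B c w = 0
      -- With `c` zero in both columns, this pivot leaves `u` and `w` untouched while giving the end
      -- rows the common column `y₂`.
      · obtain ⟨B', hB', hp⟩ := hB.exists_pivot h hy₁.1 hy₁.2 hc₁
        have := hB'.good_of_common h hy₂.1 hy₂.2 (hp.other_ne_zero h.injQ ha₂ ha₁ hc₂)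
          (by rwa [hp.row_eq h.injQ hb₁] : B' d y₂ ≠ 0)
        rwa [hp.col_eq h.injQ hcu, hp.col_eq h.injQ hcu, hp.col_eq h.injQ hcw,
          hp.col_eq h.injQ hcw] at this
      · by_cases hne : B a w * B c y₁ = B a y₁ * B c w ∧ B d w * B c y₂ = B d y₂ * B c w
        · exact swap (hB.symm.good_of_path_special h hy₁.2 hy₁.1 hy₂.2 ha₁ hc₁ hc₂ hb₂ ha₂ hb₁ hcw
            hcu hne.1 hne.2)
        · exact hw hcw hne
    · by_cases hne : B a u * B c y₁ = B a y₁ * B c u ∧ B d u * B c y₂ = B d y₂ * B c u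
      swap
      · exact hu hcu hne
      by_cases hcw : B c w = 0
      · exact hB.good_of_path_special h hy₁.1 hy₁.2 hy₂.1 ha₁ hc₁ hc₂ hb₂ ha₂ hb₁ hcu
            hcw hne.1 hne.2
      · by_cases hne' : B a w * B c y₁ = B a y₁ * B c w ∧ B d w * B c y₂ = B d y₂ * B c w
        swap
        · exact hw hcw hne'
        -- Both end rows, restricted to `u, w`, are multiples of row `c`, so the minor is zero.
        have e₁ := congrArg vQ hne.1
        have e₂ := congrArg vQ hne.2
        have e₃ := congrArg vQ hne'.1
        have e₄ := congrArg vQ hne'.2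
        refine Good.of_mul (mul_ne_zero hc₁ hc₂) ?_
        convert good_zero (v := vQ) using 1
        simp only [map_mul] at e₁ e₂ e₃ e₄ ⊢
        linear_combination (vQ (B c y₂) * vQ (B d w)) * e₁ +
          (vQ (B a y₁) * vQ (B c u)) * e₄ - (vQ (B c y₂) * vQ (B d u)) * e₃ -
          (vQ (B a y₁) * vQ (B c w)) * e₂

/-- All minors of `B` are in `Q`. -/
theorem detGood (h : IsLifting vQ vP φ) (hB : TwoColumns vQ vP φ W u w B) : DetGood vQ B := by
  have hpiv : ∀ A ∈ {B | TwoColumns vQ vP φ W u w B}, ∀ x, ∀ y ∉ ({u, w} : Set Y), A x y ≠ 0 →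
      ∃ A' ∈ {B | TwoColumns vQ vP φ W u w B}, IsPivot vQ A x y A' := by
    intro A hA x y hy ne
    simp only [Set.mem_insert_iff, Set.mem_singleton_iff, not_or] at hy
    exact TwoColumns.exists_pivot h hA hy.1 hy.2 ne
  refine detGood_of_class h.negQ {u, w} {B | TwoColumns vQ vP φ W u w B} hpiv ?_ hB
  intro A hA k f g hg
  refine good_minor_of_two h.negQ (fun a b => ?_) f g hg
  by_cases ha : inl a ∈ W
  swap
  · have : ∀ y, A a y = 0 := fun y => by
      by_contra hy
      exact ha (hA.row a y hy)
    simpa [this] using good_zero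
  by_cases hb : inl b ∈ W
  swap
  · have : ∀ y, A b y = 0 := fun y => by
      by_contra hy
      exact hb (hA.row b y hy)
    simpa [this] using good_zero
  obtain ⟨n, hn⟩ := hA.conn.exists_rowChain (U := {u, w}) (by
    rintro y hy (rfl | rfl)
    · exact hA.fst_notMem hy
    · exact hA.snd_notMem hy) ha hb
  -- The rows of every pair are joined by a chain, and shortening leaves the end rows, hence the
  -- minor, unchanged.
  exact RowChain.shorten h.injQ hpiv
    (Φ := fun r s => Good vQ (vQ (r u) * vQ (s w) - vQ (r w) * vQ (s u)))
    (fun A hA n hn a b hab => TwoColumns.good_of_rowChain h hA hn hab) n A hA a b hn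

end TwoColumns

end TwoColumns

end PivotMatrix

namespace PivotMatrix

open Sum

/-! ### Uniqueness, gluing and construction of lifts -/

section Lifts

variable {P Q RP RQ X Y : Type*} [CommGroupWithZero P] [CommGroupWithZero Q] [CommRing RP]
  [CommRing RQ] {vQ : Q →*₀ RQ} {vP : P →*₀ RP} {φ : Q →*₀ P}

theorem ConnOn.congr {P' : Type*} [CommGroupWithZero P'] {A : X → Y → P} {A' : X → Y → P'}
    {W : Set (X ⊕ Y)} (hA : ConnOn A W)
    (h : ∀ x y, inl x ∈ W → inr y ∈ W → A x y ≠ 0 → A' x y ≠ 0) : ConnOn A' W := by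
  intro C hne hC
  refine hA C hne ?_
  rintro (i | j) ha (i' | j') hb hab
  · exact hab.elim
  · exact hC _ ha _ hb (h i j' ha hb hab)
  · exact hC _ ha _ hb (h i' j hb ha hab)
  · exact hab.elim

theorem mask_eq_mask {W : Set (X ⊕ Y)} {A A' : X → Y → P}
    (h : ∀ x y, inl x ∈ W → inr y ∈ W → A x y = A' x y) : mask W A = mask W A' := by
  ext x y
  unfold mask
  split_ifs with hW
  · exact h x y hW.1 hW.2
  · rfl

theorem mask_eq_self {W : Set (X ⊕ Y)} {A : X → Y → P}
    (h : ∀ x y, A x y ≠ 0 → inl x ∈ W ∧ inr y ∈ W) : mask W A = A := by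
  ext x y
  unfold mask
  split_ifs with hW
  · rfl
  · by_contra hne
    exact hW (h x y (Ne.symm hne))

theorem map_mask {W : Set (X ⊕ Y)} (A : X → Y → Q) (x : X) (y : Y) :
    φ (mask W A x y) = mask W (fun i j => φ (A i j)) x y := by
  unfold mask
  split_ifs
  · rfl
  · exact map_zero φ

/-- On the rows and columns in `K`, the matrices `B` and `B'` agree up to scaling by elements in the
kernel of `φ`. -/
def ScaleOn (φ : Q →*₀ P) (B B' : X → Y → Q) (K : Set (X ⊕ Y)) : Prop :=
  ∃ (s : X → Q) (t : Y → Q), (∀ x, φ (s x) = 1) ∧ (∀ y, φ (t y) = 1) ∧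
    ∀ x y, inl x ∈ K → inr y ∈ K → B' x y = s x * B x y * t y

theorem ScaleOn.transpose {B B' : X → Y → Q} {K : Set (X ⊕ Y)} (h : ScaleOn φ B B' K) :
    ScaleOn φ (fun j i => B i j) (fun j i => B' i j) (Sum.swap ⁻¹' K) := by
  obtain ⟨s, t, hs, ht, h⟩ := h
  refine ⟨t, s, ht, hs, fun y x hy hx => ?_⟩
  change B' x y = t y * B x y * s x
  rw [h x y hx hy, mul_comm, mul_comm (s x), mul_assoc]

/-- The two versions of column `u` are placed side by side in one matrix, whose image is the
original one with a column doubled. It satisfies `TwoColumns`, so minors mixing the versions are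
good. The resulting cross ratios are fundamental with image `1`, hence equal to `1`, and the columns
are proportional. -/
theorem IsLifting.exists_scale_col (h : IsLifting vQ vP φ) {B B' : X → Y → Q} (hB : DetGood vQ B)
    (hB' : DetGood vQ B') (hP : DetGood vP fun x y => φ (B x y))
    (hφ : ∀ x y, φ (B x y) = φ (B' x y)) {W : Set (X ⊕ Y)} {u : Y} (hu : inr u ∉ W)
    (hW : ConnOn B W) (hBB' : ∀ x y, inl x ∈ W → inr y ∈ W → B x y = B' x y) :
    ∃ t, φ t = 1 ∧ ∀ x, inl x ∈ W → B' x u = B x u * t := by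
  classical
  have hzero : ∀ x y, B x y ≠ 0 ↔ B' x y ≠ 0 := fun x y => by
    rw [← map_ne_zero φ, hφ, map_ne_zero φ]
  let W₁ : Set (X ⊕ Y) := insert (inr u) W
  have hW₁ : ∀ x, inl x ∈ W₁ ↔ inl x ∈ W := fun x => by simp [W₁]
  let g : Option Y → Y := fun y => y.getD u
  let M : X → Option Y → Q := fun x y => y.elim (mask W₁ B' x u) fun y => mask W₁ B x y
  have hM : TwoColumns vQ vP φ (Sum.map id some '' W) (some u) none M := by
    refine ⟨by simp, ?_, ?_, ?_, ?_, ?_, ?_, ?_, ?_⟩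
    · simpa using hu
    · simp
    · convert (hP.mask W₁).submatrix (id : X → X) g using 3 with x y
      rcases y with _ | y
      · simp only [M, g, Option.elim, Option.getD, id, map_mask, hφ]
      · simp only [M, g, Option.elim, Option.getD, id, map_mask]
    · convert ((hB'.mask W₁).submatrix (id : X → X) g).mask {inr (some u)}ᶜ using 1
      refine mask_eq_mask fun x y _ hy => ?_
      rcases y with _ | y
      · rfl
      · have hyu : y ≠ u := by simpa using hy
        simp only [M, g, Option.elim, Option.getD, id]
        unfold mask
        split_ifs with hxy
        · exact hBB' x y ((hW₁ x).1 hxy.1) (by simpa [W₁, hyu] using hxy.2)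
        · rfl
    · convert ((hB.mask W₁).submatrix (id : X → X) g).mask {inr none}ᶜ using 1
      refine mask_eq_mask fun x y _ hy => ?_
      rcases y with _ | y
      · simp at hy
      · rfl
    · rintro C ⟨_, ⟨w, hw, rfl⟩, hwC⟩ hC _ ⟨w', hw', rfl⟩
      refine hW (Sum.map id some ⁻¹' C) ⟨w, hw, hwC⟩ (fun a ha b hb hab haC => ?_) hw'
      refine hC _ ⟨a, ha, rfl⟩ _ ⟨b, hb, rfl⟩ ?_ haC
      rcases a with i | j <;> rcases b with i' | j'
      · exact hab.elim
      · change mask W₁ B i j' ≠ 0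
        rw [mask_of_mem (Or.inr ha) (Or.inr hb)]
        exact hab
      · change mask W₁ B i' j ≠ 0
        rw [mask_of_mem (Or.inr hb) (Or.inr ha)]
        exact hab
      · exact hab.elim
    · intro x y hxy
      have : inl x ∈ W := by
        rcases y with _ | y
        · exact (hW₁ x).1 (mask_ne_zero hxy).1
        · exact (hW₁ x).1 (mask_ne_zero hxy).1
      exact ⟨inl x, this, rfl⟩
    · intro x y hy hy' hxy
      rcases y with _ | y
      · exact absurd rfl hy'
      · refine ⟨inr y, ?_, rfl⟩
        have hyu : y ≠ u := by simpa using hy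
        simpa [W₁, hyu] using (mask_ne_zero hxy).2.1
  by_cases h0 : ∃ a, inl a ∈ W ∧ B a u ≠ 0
  · obtain ⟨a, ha, hau⟩ := h0
    have hau' := (hzero a u).1 hau
    have ht : φ (B' a u / B a u) = 1 := by
      rw [map_div₀, ← hφ, div_self ((map_ne_zero φ).2 hau)]
    refine ⟨B' a u / B a u, ht, fun b hb => ?_⟩
    by_cases hbu : B b u = 0
    · rw [hbu, zero_mul]
      by_contra hne
      exact (hzero b u).2 hne hbu
    have hbu' := (hzero b u).1 hbu
    have hg := (hM.detGood h).two a b (some u) none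
    simp only [M, Option.elim] at hg
    rw [mask_of_mem ((hW₁ a).2 ha) (Or.inl rfl), mask_of_mem ((hW₁ b).2 hb) (Or.inl rfl),
      mask_of_mem ((hW₁ a).2 ha) (Or.inl rfl), mask_of_mem ((hW₁ b).2 hb) (Or.inl rfl)] at hg
    have key := h.inj_fund (B' a u * B b u / (B a u * B' b u)) 1
      ((good_one_sub_div_iff (mul_ne_zero hau hbu')).2 (by simpa using hg))
      (by simpa using good_zero) (by
        have n₁ : φ (B a u) ≠ 0 := (map_ne_zero φ).2 hau
        have n₂ : φ (B b u) ≠ 0 := (map_ne_zero φ).2 hbu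
        rw [map_div₀, map_mul, map_mul, ← hφ, ← hφ, map_one, div_self (mul_ne_zero n₁ n₂)])
    rw [div_eq_one_iff_eq (mul_ne_zero hau hbu')] at key
    field_simp
    rw [mul_comm (B' b u), mul_comm (B b u), key]
  · push Not at h0
    refine ⟨1, map_one φ, fun x hx => ?_⟩
    rw [h0 x hx, zero_mul]
    by_contra hne
    exact (hzero x u).2 hne (h0 x hx)

theorem IsLifting.scaleOn_insert_col (h : IsLifting vQ vP φ) {B B' : X → Y → Q}
    (hB : DetGood vQ B) (hB' : DetGood vQ B') (hP : DetGood vP fun x y => φ (B x y))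
    (hφ : ∀ x y, φ (B x y) = φ (B' x y)) {K : Set (X ⊕ Y)} (hK : ConnOn B K)
    (hs : ScaleOn φ B B' K) (u : Y) (hu : inr u ∉ K) : ScaleOn φ B B' (insert (inr u) K) := by
  classical
  obtain ⟨s, t, hs, ht, hst⟩ := hs
  have ns : ∀ x, s x ≠ 0 := fun x => (map_ne_zero φ).1 (by rw [hs x]; exact one_ne_zero)
  have nt : ∀ y, t y ≠ 0 := fun y => (map_ne_zero φ).1 (by rw [ht y]; exact one_ne_zero)
  have hφ' : ∀ x y, φ (s x * B x y * t y) = φ (B x y) := fun x y => by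
    rw [map_mul, map_mul, hs, ht, one_mul, mul_one]
  obtain ⟨r, hr, hr'⟩ := h.exists_scale_col (hB.scale s t) hB' (by simpa only [hφ'] using hP)
    (fun x y => by rw [hφ', hφ]) hu
    (hK.congr fun x y _ _ hxy => mul_ne_zero (mul_ne_zero (ns x) hxy) (nt y))
    (fun x y hx hy => (hst x y hx hy).symm)
  refine ⟨s, fun y => if y = u then t u * r else t y, hs, fun y => ?_, fun x y hx hy => ?_⟩ <;> beta_reduce
  · split_ifs
    · rw [map_mul, ht, hr, one_mul]
    · exact ht y
  · replace hx : inl x ∈ K := by simpa using hx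
    by_cases hyu : y = u
    · subst hyu
      rw [hr' x hx, if_pos rfl, mul_assoc (s x * B x y)]
    · rw [if_neg hyu]
      exact hst x y hx (by simpa [hyu] using hy)

/-- Lifts of a connected matrix are unique up to scaling. -/
theorem IsLifting.scaleOn [Finite X] [Finite Y] (h : IsLifting vQ vP φ) {B B' : X → Y → Q}
    (hB : DetGood vQ B) (hB' : DetGood vQ B') (hP : DetGood vP fun x y => φ (B x y))
    (hφ : ∀ x y, φ (B x y) = φ (B' x y)) {W : Set (X ⊕ Y)} (hW : ConnOn B W) :
    ScaleOn φ B B' W := by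
  rcases W.eq_empty_or_nonempty with rfl | ⟨w, hw⟩
  · exact ⟨1, 1, by simp, by simp, by simp⟩
  obtain ⟨K, hK⟩ := (Set.toFinite {K : Set (X ⊕ Y) | K ⊆ W ∧ K.Nonempty ∧ ConnOn B K ∧
    ScaleOn φ B B' K}).exists_maximal ⟨{w}, by simpa using hw, by simp, connOn_singleton B w, 1, 1,
      by simp, by simp, fun x y hx hy => by
        rw [Set.mem_singleton_iff] at hx hy
        simp [← hx] at hy⟩
  obtain ⟨⟨hKW, ⟨k₀, hk₀⟩, hKc, hKs⟩, hmax⟩ := hK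
  by_cases hsub : W ⊆ K
  · rwa [Set.Subset.antisymm hKW hsub] at hKs
  obtain ⟨a, haK, _, b, hbW, hbK, hab⟩ := hW.exists_adj ⟨k₀, hKW hk₀, hk₀⟩ hsub
  have hins : ScaleOn φ B B' (insert b K) := by
    rcases b with x | y
    · have hKt : ConnOn (fun j i => B i j) (Sum.swap ⁻¹' K) := hKc.transpose
      have := (h.scaleOn_insert_col hB.transpose hB'.transpose hP.transpose (fun y x => hφ x y) hKt
        hKs.transpose x hbK).transpose
      convert this using 1
      ext z
      rcases z with z | z <;> simp
    · exact h.scaleOn_insert_col hB hB' hP hφ hKc hKs y hbK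
  exact absurd (hmax ⟨Set.insert_subset hbW hKW, ⟨b, Or.inl rfl⟩, hKc.insert_of_adj haK hab, hins⟩
    (Set.subset_insert b K) (Or.inl rfl)) hbK

/-- The matrix `A` lifts to a matrix over `Q` with minors in `Q`. -/
def HasLift (vQ : Q →*₀ RQ) (φ : Q →*₀ P) (A : X → Y → P) : Prop :=
  ∃ B : X → Y → Q, DetGood vQ B ∧ ∀ x y, φ (B x y) = A x y

theorem HasLift.transpose {A : X → Y → P} (hA : HasLift vQ φ A) :
    HasLift vQ φ fun j i => A i j := by
  obtain ⟨B, hB, hφ⟩ := hA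
  exact ⟨fun j i => B i j, hB.transpose, fun y x => hφ x y⟩

/-- Pivoting the lift of `A'` on the same entry gives a lift of `A` with one row and one column
negated; scaling by a preimage `m` of `-1` corrects this. -/
theorem HasLift.of_isPivot (h : IsLifting vQ vP φ) {A A' : X → Y → P} {x : X} {y : Y}
    (hp : IsPivot vP A x y A') (hA' : HasLift vQ φ A') : HasLift vQ φ A := by
  classical
  obtain ⟨B', hB', hφ⟩ := hA'
  obtain ⟨m, hm⟩ := h.negQ
  have hmP := h.map_neg_one hm
  have hmm : φ m * φ m = 1 := h.injP (by simp [hmP])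
  obtain ⟨B, hB⟩ := hB'.exists_isPivot h.negQ (x := x) (y := y)
    (by rw [← map_ne_zero φ, hφ]; exact hp.entry_ne h.injP)
  have h₁ := h.map_isPivot hB
  simp only [hφ] at h₁
  have h₂ := h₁.unique h.injP (hp.back h.injP hmP)
  refine ⟨fun i j => (if i = x then m else 1) * B i j * (if j = y then m else 1),
    (hB'.pivot h.negQ hB).scale _ _, fun i j => ?_⟩
  have h₃ := congrFun (congrFun h₂ i) j
  rw [map_mul, map_mul, h₃]
  have hmm' : ∀ a, φ m * (φ m * a) = a := fun a => by rw [← mul_assoc, hmm, one_mul]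
  split_ifs <;> simp [mul_assoc, hmm, hmm']

/-- A column with a single nonzero entry imposes no cross ratio condition, so any preimage of that
entry will do. -/
theorem HasLift.of_unit_col (h : IsLifting vQ vP φ) {A : X → Y → P} {u : Y}
    (hA : HasLift vQ φ (mask {inr u}ᶜ A))
    (hu : ∀ x x', A x u ≠ 0 → A x' u ≠ 0 → x = x') : HasLift vQ φ A := by
  classical
  by_cases h0 : ∃ x₀, A x₀ u ≠ 0
  · obtain ⟨x₀, hx₀⟩ := h0
    obtain ⟨B, hB, hφ⟩ := hA
    obtain ⟨q, hq⟩ := h.surj (A x₀ u)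
    refine ⟨fun x y => if y = u then if x = x₀ then q else 0 else B x y, ?_, fun x y => ?_⟩
    · refine DetGood.of_unit_col h.negQ (u := u) (x₀ := x₀) ?_ (fun x hx => by simp [hx])
      convert hB.mask {inr u}ᶜ using 1
      refine mask_eq_mask fun x y _ hy => ?_
      have hyu : y ≠ u := by simpa using hy
      simp [hyu]
    · by_cases hyu : y = u
      · subst hyu
        by_cases hx : x = x₀
        · simp [hx, hq]
        · simp only [hx, if_true, if_false, map_zero]
          by_contra hne
          exact hx (hu x x₀ (Ne.symm hne) hx₀)
      · simp only [hyu, if_false, hφ]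
        exact mask_of_mem (by simp) (by simpa using hyu)
  · push Not at h0
    rwa [mask_eq_self] at hA
    intro x y hxy
    refine ⟨by simp, ?_⟩
    rintro h
    simp only [Set.mem_singleton_iff, inr.injEq] at h
    exact hxy (h ▸ h0 x)

theorem mask_swap (A : X → Y → P) (W : Set (X ⊕ Y)) :
    mask (Sum.swap ⁻¹' W) (fun j i => A i j) = fun j i => mask W A i j := by
  ext j i
  unfold mask
  simp only [Set.mem_preimage, Sum.swap_inl, Sum.swap_inr]
  split_ifs <;> tauto

theorem HasLift.of_unit_row (h : IsLifting vQ vP φ) {A : X → Y → P} {u : X}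
    (hA : HasLift vQ φ (mask {inl u}ᶜ A))
    (hu : ∀ y y', A u y ≠ 0 → A u y' ≠ 0 → y = y') : HasLift vQ φ A := by
  refine (HasLift.of_unit_col h (A := fun j i => A i j) (u := u) ?_ hu).transpose
  convert hA.transpose using 1
  rw [← mask_swap]
  congr 1
  ext z
  rcases z with z | z <;> simp

/-- Lifts of the matrices obtained by deleting a column `u` and a column `w` can be combined if the
matrix obtained by deleting both columns is connected. -/
theorem HasLift.of_two_cols [Finite X] [Finite Y] (h : IsLifting vQ vP φ) {A : X → Y → P}
    (hA : DetGood vP A) {W : Set (X ⊕ Y)} (hsupp : ∀ x y, A x y ≠ 0 → inl x ∈ W ∧ inr y ∈ W)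
    {u w : Y} (huw : u ≠ w) (hconn : ConnOn A (W \ {inr u, inr w}))
    (hu : HasLift vQ φ (mask {inr w}ᶜ A)) (hw : HasLift vQ φ (mask {inr u}ᶜ A)) :
    HasLift vQ φ A := by
  classical
  obtain ⟨B₁, hB₁, hφ₁⟩ := hu
  obtain ⟨B₂, hB₂, hφ₂⟩ := hw
  have e₁ : ∀ x y, y ≠ w → φ (B₁ x y) = A x y := fun x y hy => by
    rw [hφ₁, mask_of_mem (by simp) (by simpa using hy)]
  have e₂ : ∀ x y, y ≠ u → φ (B₂ x y) = A x y := fun x y hy => by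
    rw [hφ₂, mask_of_mem (by simp) (by simpa using hy)]
  have hφC : ∀ x y, φ (mask {inr u, inr w}ᶜ B₁ x y) = mask {inr u, inr w}ᶜ A x y := by
    intro x y
    rw [map_mask]
    refine congrFun (congrFun (mask_eq_mask fun x y _ hy => ?_) x) y
    simp only [Set.mem_compl_iff, Set.mem_insert_iff, Set.mem_singleton_iff, not_or, inr.injEq] at hy
    exact e₁ x y hy.2
  have hφC' : ∀ x y, φ (mask {inr u, inr w}ᶜ B₂ x y) = mask {inr u, inr w}ᶜ A x y := by
    intro x y
    rw [map_mask]
    refine congrFun (congrFun (mask_eq_mask fun x y _ hy => ?_) x) y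
    simp only [Set.mem_compl_iff, Set.mem_insert_iff, Set.mem_singleton_iff, not_or, inr.injEq] at hy
    exact e₂ x y hy.1
  -- Without `u` and `w` both lifts lie over the same connected matrix, so `B₁` can be rescaled to
  -- agree with `B₂` there.
  obtain ⟨s, t, hs, ht, hst⟩ := h.scaleOn (hB₁.mask {inr u, inr w}ᶜ) (hB₂.mask {inr u, inr w}ᶜ)
    (by simpa only [hφC] using hA.mask _) (fun x y => by rw [hφC, hφC'])
    (W := W \ {inr u, inr w}) (hconn.congr fun x y hx hy hxy => by
      rw [← map_ne_zero φ, hφC, mask_of_mem hx.2 hy.2]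
      exact hxy)
  have hB₁₂ : ∀ x y, y ≠ u → y ≠ w → s x * B₁ x y * t y = B₂ x y := by
    intro x y hyu hyw
    have hy' : inr y ∈ ({inr u, inr w}ᶜ : Set (X ⊕ Y)) := by simp [hyu, hyw]
    have hx' : inl x ∈ ({inr u, inr w}ᶜ : Set (X ⊕ Y)) := by simp
    by_cases hxy : A x y = 0
    · rw [← e₁ x y hyw, map_eq_zero] at hxy
      have hxy' := hxy
      rw [← map_eq_zero φ, e₁ x y hyw, ← e₂ x y hyu, map_eq_zero] at hxy'
      rw [hxy, hxy', mul_zero, zero_mul]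
    · have := hst x y ⟨(hsupp x y hxy).1, hx'⟩ ⟨(hsupp x y hxy).2, hy'⟩
      rw [mask_of_mem hx' hy', mask_of_mem hx' hy'] at this
      exact this.symm
  have hφB : ∀ x y, φ (if y = w then B₂ x y else s x * B₁ x y * t y) = A x y := by
    intro x y
    by_cases hyw : y = w
    · subst hyw
      rw [if_pos rfl, e₂ x y huw.symm]
    · rw [if_neg hyw, map_mul, map_mul, hs, ht, one_mul, mul_one, e₁ x y hyw]
  -- Column `w` comes from `B₂`, everything else from the rescaled `B₁`.
  refine ⟨fun x y => if y = w then B₂ x y else s x * B₁ x y * t y,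
    TwoColumns.detGood h (W := W \ {inr u, inr w}) (u := u) (w := w)
      ⟨huw, by simp, by simp, by simpa only [hφB] using hA, ?_, ?_, ?_, ?_, ?_⟩, hφB⟩
  · convert hB₂.mask {inr u}ᶜ using 1
    refine mask_eq_mask fun x y _ hy => ?_
    have hyu : y ≠ u := by simpa using hy
    split_ifs with hyw
    · rfl
    · exact hB₁₂ x y hyu hyw
  · convert (hB₁.scale s t).mask {inr w}ᶜ using 1
    refine mask_eq_mask fun x y _ hy => ?_
    have hyw : y ≠ w := by simpa using hy
    rw [if_neg hyw]
  · refine hconn.congr fun x y hx hy hxy => ?_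
    rw [← map_ne_zero φ, hφB]
    exact hxy
  · intro x y hxy
    rw [← map_ne_zero φ, hφB] at hxy
    exact ⟨(hsupp x y hxy).1, by simp⟩
  · intro x y hyu hyw hxy
    rw [← map_ne_zero φ, hφB] at hxy
    exact ⟨(hsupp x y hxy).2, by simp [hyu, hyw]⟩

theorem HasLift.of_two_rows [Finite X] [Finite Y] (h : IsLifting vQ vP φ) {A : X → Y → P}
    (hA : DetGood vP A) {W : Set (X ⊕ Y)} (hsupp : ∀ x y, A x y ≠ 0 → inl x ∈ W ∧ inr y ∈ W)
    {u w : X} (huw : u ≠ w) (hconn : ConnOn A (W \ {inl u, inl w}))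
    (hu : HasLift vQ φ (mask {inl w}ᶜ A)) (hw : HasLift vQ φ (mask {inl u}ᶜ A)) :
    HasLift vQ φ A := by
  have hsw : ∀ z : X, mask {inr z}ᶜ (fun j i => A i j) = fun j i => mask {inl z}ᶜ A i j := by
    intro z
    rw [← mask_swap]
    congr 1
    ext a
    rcases a with a | a <;> simp
  refine (HasLift.of_two_cols h hA.transpose (W := Sum.swap ⁻¹' W) (u := u) (w := w)
    (fun y x hxy => (hsupp x y hxy).symm) huw ?_ ?_ ?_).transpose
  · convert hconn.transpose using 1
    ext a
    rcases a with a | a <;> simp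
  · rw [hsw]
    exact hu.transpose
  · rw [hsw]
    exact hw.transpose

theorem HasLift.of_blocks (h : IsLifting vQ vP φ) {A : X → Y → P} (C : Set (X ⊕ Y))
    (h₁ : HasLift vQ φ (mask C A)) (h₂ : HasLift vQ φ (mask Cᶜ A))
    (h0 : ∀ x y, A x y ≠ 0 → (inl x ∈ C ↔ inr y ∈ C)) : HasLift vQ φ A := by
  classical
  obtain ⟨B₁, hB₁, hφ₁⟩ := h₁
  obtain ⟨B₂, hB₂, hφ₂⟩ := h₂
  have hφ : ∀ x y, φ (if inl x ∈ C then B₁ x y else B₂ x y) = A x y := by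
    intro x y
    by_cases hx : inl x ∈ C
    · rw [if_pos hx, hφ₁]
      by_cases hy : inr y ∈ C
      · exact mask_of_mem hx hy
      · rw [mask_of_col hy]
        by_contra hne
        exact hy ((h0 x y (Ne.symm hne)).1 hx)
    · rw [if_neg hx, hφ₂]
      by_cases hy : inr y ∈ C
      · rw [mask_of_col (by simpa using hy)]
        by_contra hne
        exact hx ((h0 x y (Ne.symm hne)).2 hy)
      · exact mask_of_mem hx hy
  refine ⟨fun x y => if inl x ∈ C then B₁ x y else B₂ x y,
    DetGood.of_blocks h.negQ C ?_ ?_ fun x y hxy => h0 x y ?_, hφ⟩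
  · convert hB₁.mask C using 1
    exact mask_eq_mask fun x y hx _ => if_pos hx
  · convert hB₂.mask Cᶜ using 1
    exact mask_eq_mask fun x y hx _ => if_neg hx
  · rw [← hφ]
    exact (map_ne_zero φ).2 hxy

/-- Three entries are lifted arbitrarily; the remaining one, which may be zero, is then forced by a
fundamental lift of the cross ratio. -/
theorem HasLift.of_two_by_two (h : IsLifting vQ vP φ) {A : X → Y → P} (hA : DetGood vP A)
    {x x' : X} {y y' : Y} (hx : x ≠ x') (hy : y ≠ y')
    (hsupp : ∀ i j, A i j ≠ 0 → (i = x ∨ i = x') ∧ (j = y ∨ j = y'))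
    (h₂ : A x y' ≠ 0) (h₃ : A x' y ≠ 0) (h₄ : A x' y' ≠ 0) : HasLift vQ φ A := by
  classical
  obtain ⟨r, hr, hφr⟩ := h.exists_fund (A x y * A x' y' / (A x y' * A x' y))
    ((good_one_sub_div_iff (mul_ne_zero h₂ h₃)).2 (by
      convert Good.neg h.negP (hA.two x x' y y') using 1
      simp))
  obtain ⟨q₂, hq₂⟩ := h.surj (A x y')
  obtain ⟨q₃, hq₃⟩ := h.surj (A x' y)
  obtain ⟨q₄, hq₄⟩ := h.surj (A x' y')
  have n₂ : q₂ ≠ 0 := (map_ne_zero φ).1 (by rwa [hq₂])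
  have n₃ : q₃ ≠ 0 := (map_ne_zero φ).1 (by rwa [hq₃])
  have n₄ : q₄ ≠ 0 := (map_ne_zero φ).1 (by rwa [hq₄])
  obtain ⟨q₁, hq₁⟩ : ∃ q₁, q₁ = r * (q₂ * q₃) / q₄ := ⟨_, rfl⟩
  have e₁ : φ q₁ = A x y := by
    rw [hq₁, map_div₀, map_mul, map_mul, hφr, hq₂, hq₃, hq₄, div_mul_cancel₀ _ (mul_ne_zero h₂ h₃),
      mul_div_cancel_right₀ _ h₄]
  have hgood : Good vQ (vQ q₂ * vQ q₃ - vQ q₁ * vQ q₄) := by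
    rw [← map_mul, ← map_mul, ← good_one_sub_div_iff (mul_ne_zero n₂ n₃)]
    convert hr using 3
    rw [hq₁]
    field_simp
  let B : X → Y → Q := fun i j => if i = x then if j = y then q₁ else if j = y' then q₂ else 0 else
    if i = x' then if j = y then q₃ else if j = y' then q₄ else 0 else 0
  refine ⟨B, ?_, ?_⟩
  · refine detGood_of_class h.negQ {y, y'} {B} ?_ ?_ rfl
    · rintro _ rfl i j hj hij
      simp only [Set.mem_insert_iff, Set.mem_singleton_iff, not_or] at hj
      simp [B, hj.1, hj.2] at hij
    · rintro _ rfl k f g hg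
      refine good_minor_of_two h.negQ (fun a b => ?_) f g hg
      have hgood' := Good.neg h.negQ hgood
      rw [neg_sub] at hgood'
      by_cases ha : a = x
      · by_cases hb : b = x
        · convert good_zero (v := vQ) using 1
          rw [ha, hb]
          ring
        · by_cases hb' : b = x'
          · simpa [B, ha, hb', hx.symm, hy.symm] using hgood'
          · simpa [B, hb, hb'] using good_zero
      · by_cases ha' : a = x'
        · by_cases hb : b = x
          · convert hgood using 1
            simp only [B, ha', hb, hx.symm, hy.symm, if_true, if_false]
            ring
          · by_cases hb' : b = x'
            · convert good_zero (v := vQ) using 1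
              rw [ha', hb']
              ring
            · simpa [B, hb, hb'] using good_zero
        · simpa [B, ha, ha'] using good_zero
  · intro i j
    simp only [B]
    split_ifs with g₁ g₂ g₃ g₄ g₅ g₆
    · rw [e₁, g₁, g₂]
    · rw [hq₂, g₁, g₃]
    · rw [map_zero]
      by_contra hne
      rcases (hsupp i j (Ne.symm hne)).2 with rfl | rfl
      · exact g₂ rfl
      · exact g₃ rfl
    · rw [hq₃, g₄, g₅]
    · rw [hq₄, g₄, g₆]
    · rw [map_zero]
      by_contra hne
      rcases (hsupp i j (Ne.symm hne)).2 with rfl | rfl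
      · exact g₅ rfl
      · exact g₆ rfl
    · rw [map_zero]
      by_contra hne
      rcases (hsupp i j (Ne.symm hne)).1 with rfl | rfl
      · exact g₁ rfl
      · exact g₄ rfl

end Lifts

end PivotMatrix

namespace PivotMatrix

open Sum

/-! ### Existence of lifts -/

section Main

variable {P Q RP RQ X Y : Type*} [CommGroupWithZero P] [CommGroupWithZero Q] [CommRing RP]
  [CommRing RQ] {vQ : Q →*₀ RQ} {vP : P →*₀ RP} {φ : Q →*₀ P}

theorem mask_supp {A : X → Y → P} {W W' : Set (X ⊕ Y)}
    (hsupp : ∀ x y, A x y ≠ 0 → inl x ∈ W ∧ inr y ∈ W) {x : X} {y : Y} (h : mask W' A x y ≠ 0) :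
    inl x ∈ W ∩ W' ∧ inr y ∈ W ∩ W' := by
  obtain ⟨h₁, h₂, h₃⟩ := mask_ne_zero h
  exact ⟨⟨(hsupp x y h₃).1, h₁⟩, (hsupp x y h₃).2, h₂⟩

theorem Adj.mem {A : X → Y → P} {W : Set (X ⊕ Y)}
    (hsupp : ∀ x y, A x y ≠ 0 → inl x ∈ W ∧ inr y ∈ W) :
    ∀ {a b : X ⊕ Y}, Adj A a b → a ∈ W ∧ b ∈ W
  | inl x, inr y, h => hsupp x y h
  | inr y, inl x, h => (hsupp x y h).symm

theorem HasLift.of_adj_three [Finite X] [Finite Y] (h : IsLifting vQ vP φ) {W : Set (X ⊕ Y)}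
    (ih : ∀ W' : Set (X ⊕ Y), W' ⊂ W → ∀ A : X → Y → P, DetGood vP A →
      (∀ x y, A x y ≠ 0 → inl x ∈ W' ∧ inr y ∈ W') → HasLift vQ φ A)
    {A : X → Y → P} (hA : DetGood vP A) (hsupp : ∀ x y, A x y ≠ 0 → inl x ∈ W ∧ inr y ∈ W)
    (hconn : ConnOn A W) {z n₁ n₂ n₃ : X ⊕ Y} (h₁₂ : n₁ ≠ n₂) (h₁₃ : n₁ ≠ n₃) (h₂₃ : n₂ ≠ n₃)
    (a₁ : Adj A z n₁) (a₂ : Adj A z n₂) (a₃ : Adj A z n₃) : HasLift vQ φ A := by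
  have hdel : ∀ z ∈ W, HasLift vQ φ (mask {z}ᶜ A) := fun z hz =>
    ih (W ∩ {z}ᶜ) ⟨Set.inter_subset_left, fun hsub => (hsub hz).2 rfl⟩ _ (hA.mask _)
      fun _ _ => mask_supp hsupp
  rcases hconn.exists_pair (a₁.mem hsupp).1 (a₁.mem hsupp).2 (a₂.mem hsupp).2 (a₃.mem hsupp).2
    h₁₂ h₁₃ h₂₃ a₁ a₂ a₃ with ⟨u, w, huw, hu, hw, hc⟩ | ⟨u, w, huw, hu, hw, hc⟩
  · exact HasLift.of_two_rows h hA hsupp huw hc (hdel _ hw) (hdel _ hu)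
  · exact HasLift.of_two_cols h hA hsupp huw hc (hdel _ hw) (hdel _ hu)

theorem HasLift.of_not_connOn (h : IsLifting vQ vP φ) {W : Set (X ⊕ Y)}
    (ih : ∀ W' : Set (X ⊕ Y), W' ⊂ W → ∀ A : X → Y → P, DetGood vP A →
      (∀ x y, A x y ≠ 0 → inl x ∈ W' ∧ inr y ∈ W') → HasLift vQ φ A)
    {A : X → Y → P} (hA : DetGood vP A) (hsupp : ∀ x y, A x y ≠ 0 → inl x ∈ W ∧ inr y ∈ W)
    (hconn : ¬ ConnOn A W) : HasLift vQ φ A := by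
  unfold ConnOn at hconn
  push Not at hconn
  obtain ⟨C, ⟨w, hw, hwC⟩, hC, hsub⟩ := hconn
  obtain ⟨z, hz, hzC⟩ := Set.not_subset.1 hsub
  refine HasLift.of_blocks h C ?_ ?_ ?_
  · exact ih (W ∩ C) ⟨Set.inter_subset_left, fun hs => hzC (hs hz).2⟩ _ (hA.mask _)
      fun _ _ => mask_supp hsupp
  · exact ih (W ∩ Cᶜ) ⟨Set.inter_subset_left, fun hs => (hs hw).2 hwC⟩ _ (hA.mask _)
      fun _ _ => mask_supp hsupp
  · intro x y hxy
    obtain ⟨hx, hy⟩ := hsupp x y hxy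
    exact ⟨hC _ hx _ hy hxy, hC _ hy _ hx hxy⟩

/-- Every matrix with minors in `P` lifts to a matrix with minors in `Q`. -/
theorem IsLifting.hasLift [Finite X] [Finite Y] (h : IsLifting vQ vP φ) {A : X → Y → P}
    (hA : DetGood vP A) : HasLift vQ φ A := by
  suffices key : ∀ (W : Set (X ⊕ Y)) (A : X → Y → P), DetGood vP A →
      (∀ x y, A x y ≠ 0 → inl x ∈ W ∧ inr y ∈ W) → HasLift vQ φ A from
    key Set.univ A hA (by simp)
  intro W
  induction W using WellFoundedLT.induction with
  | _ W ih =>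
  clear hA A
  intro A hA hsupp
  -- Kept general in `A`, since it is used again for a pivot of the given matrix with support in the
  -- same `W`.
  have hthree : ∀ A : X → Y → P, DetGood vP A → (∀ x y, A x y ≠ 0 → inl x ∈ W ∧ inr y ∈ W) →
      ∀ z n₁ n₂ n₃, n₁ ≠ n₂ → n₁ ≠ n₃ → n₂ ≠ n₃ → Adj A z n₁ → Adj A z n₂ → Adj A z n₃ →
      HasLift vQ φ A := by
    intro A hA hsupp z n₁ n₂ n₃ h₁₂ h₁₃ h₂₃ a₁ a₂ a₃
    by_cases hconn : ConnOn A W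
    · exact HasLift.of_adj_three h ih hA hsupp hconn h₁₂ h₁₃ h₂₃ a₁ a₂ a₃
    · exact HasLift.of_not_connOn h ih hA hsupp hconn
  by_cases hconn : ConnOn A W
  swap
  · exact HasLift.of_not_connOn h ih hA hsupp hconn
  by_cases h3 : ∃ z n₁ n₂ n₃, n₁ ≠ n₂ ∧ n₁ ≠ n₃ ∧ n₂ ≠ n₃ ∧ Adj A z n₁ ∧ Adj A z n₂ ∧ Adj A z n₃
  · obtain ⟨z, n₁, n₂, n₃, h₁₂, h₁₃, h₂₃, a₁, a₂, a₃⟩ := h3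
    exact hthree A hA hsupp z n₁ n₂ n₃ h₁₂ h₁₃ h₂₃ a₁ a₂ a₃
  push Not at h3
  have hdel : ∀ z ∈ W, HasLift vQ φ (mask {z}ᶜ A) := fun z hz =>
    ih (W ∩ {z}ᶜ) ⟨Set.inter_subset_left, fun hsub => (hsub hz).2 rfl⟩ _ (hA.mask _)
      fun _ _ => mask_supp hsupp
  by_cases hcol : ∀ y, inr y ∈ W → ∃ x x', A x y ≠ 0 ∧ A x' y ≠ 0 ∧ x ≠ x'
  swap
  · push Not at hcol
    obtain ⟨u, hu, hux⟩ := hcol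
    exact HasLift.of_unit_col h (hdel _ hu) hux
  by_cases hrow : ∀ x, inl x ∈ W → ∃ y y', A x y ≠ 0 ∧ A x y' ≠ 0 ∧ y ≠ y'
  swap
  · push Not at hrow
    obtain ⟨u, hu, huy⟩ := hrow
    exact HasLift.of_unit_row h (hdel _ hu) huy
  by_cases hne : ∃ x, inl x ∈ W
  swap
  · have h0 : A = fun _ _ => 0 := by
      ext x y
      by_contra hxy
      exact hne ⟨x, (hsupp x y hxy).1⟩
    refine ⟨fun _ _ => 0, fun k f g => ?_, fun x y => by rw [h0, map_zero]⟩
    obtain _ | k := k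
    · rw [minor, Matrix.det_fin_zero]
      exact good_one
    · have : minor vQ (fun (_ : X) (_ : Y) => (0 : Q)) f g = 0 :=
        Matrix.det_eq_zero_of_row_eq_zero 0 fun j => by simp
      rw [this]
      exact good_zero
  -- From here on every vertex of `W` has exactly two neighbours: the graph is a cycle.
  obtain ⟨x, hx⟩ := hne
  obtain ⟨y, y', hxy, hxy', hyy'⟩ := hrow x hx
  have hxonly : ∀ j, A x j ≠ 0 → j = y ∨ j = y' := by
    intro j hj
    by_contra hcon
    push Not at hcon
    exact h3 (inl x) (inr y) (inr y') (inr j) (by simpa using hyy') (by simpa using hcon.1.symm)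
      (by simpa using hcon.2.symm) hxy hxy' hj
  obtain ⟨x', hx'y, hx'x⟩ : ∃ x', A x' y ≠ 0 ∧ x' ≠ x := by
    obtain ⟨a, b, ha, hb, hab⟩ := hcol y (hsupp x y hxy).2
    by_cases hax : a = x
    · exact ⟨b, hb, fun hbx => hab (hax.trans hbx.symm)⟩
    · exact ⟨a, ha, hax⟩
  by_cases hx'y' : A x' y' = 0
  · obtain ⟨z, hz, hzy⟩ : ∃ z, A x' z ≠ 0 ∧ z ≠ y := by
      obtain ⟨a, b, ha, hb, hab⟩ := hrow x' (hsupp x' y hx'y).1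
      by_cases hay : a = y
      · exact ⟨b, hb, fun hby => hab (hay.trans hby.symm)⟩
      · exact ⟨a, ha, hay⟩
    have hzy' : z ≠ y' := by
      rintro rfl
      exact hz hx'y'
    have hxz : A x z = 0 := by
      by_contra hne
      rcases hxonly z hne with rfl | rfl
      · exact hzy rfl
      · exact hzy' rfl
    -- The cycle is longer than four. After the pivot the row `x'` has the three neighbours `y`,
    -- `y'` and `z`.
    obtain ⟨A', hp⟩ := hA.exists_isPivot h.negP hxy
    refine HasLift.of_isPivot h hp (hthree A' (hA.pivot h.negP hp) ?_ (inl x') (inr y) (inr y')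
      (inr z) (by simpa using hyy') (by simpa using hzy.symm) (by simpa using hzy'.symm)
      ((hp.col_ne_zero_iff h.injP x').2 hx'y) (hp.other_ne_zero h.injP hx'y' hx'y hxy')
      (by
        change A' x' z ≠ 0
        rwa [hp.col_eq h.injP hxz]))
    intro i j hij
    constructor
    · by_cases hi : A i y = 0
      · rw [hp.row_eq h.injP hi] at hij
        exact (hsupp i j hij).1
      · exact (hsupp i y hi).1
    · by_cases hj : A x j = 0
      · rw [hp.col_eq h.injP hj] at hij
        exact (hsupp i j hij).2
      · exact (hsupp x j hj).2
  · have hx'only : ∀ j, A x' j ≠ 0 → j = y ∨ j = y' := by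
      intro j hj
      by_contra hcon
      push Not at hcon
      exact h3 (inl x') (inr y) (inr y') (inr j) (by simpa using hyy') (by simpa using hcon.1.symm)
        (by simpa using hcon.2.symm) hx'y hx'y' hj
    have honly : ∀ j, A x j ≠ 0 → A x' j ≠ 0 → ∀ i, A i j ≠ 0 → i = x ∨ i = x' := by
      intro j hj hj' i hi
      by_contra hcon
      push Not at hcon
      exact h3 (inr j) (inl x) (inl x') (inl i) (by simpa using hx'x.symm)
        (by simpa using hcon.1.symm) (by simpa using hcon.2.symm) hj hj' hi
    -- These four vertices form a closed cycle, hence all of `W`.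
    have hsub := hconn {inl x, inl x', inr y, inr y'} ⟨inl x, hx, by simp⟩ (by
      rintro (i | j) ha (i' | j') hb hab hC
      · exact hab.elim
      · simp only [Set.mem_insert_iff, Set.mem_singleton_iff, inl.injEq, reduceCtorEq, or_false,
          inr.injEq, false_or] at hC ⊢
        rcases hC with rfl | rfl
        · exact hxonly j' hab
        · exact hx'only j' hab
      · simp only [Set.mem_insert_iff, Set.mem_singleton_iff, inl.injEq, reduceCtorEq, or_false,
          inr.injEq, false_or] at hC ⊢
        rcases hC with rfl | rfl
        · exact honly j hxy hx'y i' hab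
        · exact honly j hxy' hx'y' i' hab
      · exact hab.elim)
    refine HasLift.of_two_by_two h hA hx'x.symm hyy' (fun i j hij => ?_) hxy' hx'y hx'y'
    have hi := hsub (hsupp i j hij).1
    have hj := hsub (hsupp i j hij).2
    simpa using And.intro hi hj

end Main

end PivotMatrix

namespace PartialField

/-! ### Defined sums in a partial field -/

section Sums

variable {P : Type*} [PartialField P]

protected theorem neg_zero : -(0 : P) = 0 := by
  refine (eq_neg_of_zero_mem_padd (0 : P) 0 ?_).symm
  rw [padd_zero]
  exact Part.mem_some 0

theorem mem_padd_mul {p q r s : P} (hp : p ≠ 0) (h : s ∈ padd q r) :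
    p * s ∈ padd (p * q) (p * r) := by
  rw [mul_padd p q r hp]
  exact Part.mem_map _ h

protected theorem mul_neg (p q : P) : p * -q = -(p * q) := by
  by_cases hp : p = 0
  · rw [hp, zero_mul, zero_mul, PartialField.neg_zero]
  · have := mem_padd_mul hp (zero_mem_padd_neg q)
    rw [mul_zero] at this
    exact eq_neg_of_zero_mem_padd _ _ this

theorem association_mul {p : P} (hp : p ≠ 0) {S : Multiset P} {r : P} (h : Association padd S r) :
    Association padd (S.map fun q => p * q) (p * r) := by
  induction h with
  | leaf q => exact .leaf _
  | node _ _ h ih₁ ih₂ =>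
    rw [Multiset.map_add]
    exact .node ih₁ ih₂ (mem_padd_mul hp h)

theorem sumIs_singleton (p : P) : SumIs {p} p := ⟨0, by simpa using Association.leaf p⟩

theorem SumIs.add {S T : Multiset P} {r : P} (hS : SumIs S r) (hT : SumIs T 0) :
    SumIs (S + T) r := by
  obtain ⟨Z, hZ⟩ := hS
  obtain ⟨Z', hZ'⟩ := hT
  refine ⟨Z + Z', ?_⟩
  have := Association.node hZ hZ' (r := r) (by rw [padd_zero]; exact Part.mem_some r)
  convert this using 1
  rw [Multiset.map_add]
  abel

/-- Opposite pairs are exactly what the definition allows one to add, so `W` is merged into the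
auxiliary multiset. -/
theorem SumIs.cancel {S W : Multiset P} {r : P} (h : SumIs (S + (W + W.map fun z => -z)) r) :
    SumIs S r := by
  obtain ⟨Z, hZ⟩ := h
  refine ⟨W + Z, ?_⟩
  convert hZ using 1
  rw [Multiset.map_add]
  abel

theorem sumIs_zero : SumIs (0 : Multiset P) 0 := by
  refine ⟨{0}, ?_⟩
  have := Association.node (.leaf (0 : P)) (.leaf (-0)) (zero_mem_padd_neg (0 : P))
  simpa using this

theorem sumIs_triple {p q r : P} (h : r ∈ padd p q) : SumIs ({p, q} + {-r}) 0 :=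
  ⟨0, by simpa using (Association.node (.node (.leaf p) (.leaf q) h) (.leaf (-r))
    (zero_mem_padd_neg r) : Association padd ({p} + {q} + {-r}) 0)⟩

theorem sumIs_pair (p : P) : SumIs ({p} + {-p}) 0 :=
  ⟨0, by simpa using Association.node (.leaf p) (.leaf (-p)) (zero_mem_padd_neg p)⟩

theorem SumIs.map_mul {S : Multiset P} (hS : SumIs S 0) (p : P) :
    SumIs (S.map fun q => p * q) 0 := by
  by_cases hp : p = 0
  · subst hp
    clear hS
    induction S using Multiset.induction with
    | empty => simpa using sumIs_zero
    | cons a S ih =>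
      rw [Multiset.map_cons, zero_mul, ← Multiset.singleton_add]
      exact (sumIs_singleton 0).add ih
  · obtain ⟨Z, hZ⟩ := hS
    refine ⟨Z.map fun q => p * q, ?_⟩
    have := association_mul hp hZ
    rw [mul_zero] at this
    convert this using 1
    simp only [Multiset.map_add, Multiset.map_map, Function.comp_def, PartialField.mul_neg]

end Sums

/-! ### The ring presented by the defined sums -/

section Universal

variable (P : Type*) [PartialField P]

/-- The ideal generated by the relations `p + q - r` for which `p + q = r` in `P`. -/
noncomputable def relIdeal : Ideal (MonoidAlgebra ℤ P) :=
  Ideal.span {x | ∃ p q r : P, r ∈ padd p q ∧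
    x = MonoidAlgebra.of ℤ P p + MonoidAlgebra.of ℤ P q - MonoidAlgebra.of ℤ P r}

/-- The map from `P` to the ring presented by the sums that are defined in `P`. -/
noncomputable def toUniversal : P →*₀ MonoidAlgebra ℤ P ⧸ relIdeal P where
  toFun p := Ideal.Quotient.mk _ (MonoidAlgebra.of ℤ P p)
  map_zero' := by
    rw [Ideal.Quotient.eq_zero_iff_mem]
    exact Ideal.subset_span ⟨0, 0, 0, by rw [padd_zero]; exact Part.mem_some 0, by abel⟩
  map_one' := by rw [map_one, map_one]
  map_mul' p q := by rw [map_mul, map_mul]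

variable {P}

theorem toUniversal_of_mem {p q r : P} (h : r ∈ padd p q) :
    toUniversal P r = toUniversal P p + toUniversal P q := by
  have : Ideal.Quotient.mk (relIdeal P) (MonoidAlgebra.of ℤ P p + MonoidAlgebra.of ℤ P q -
      MonoidAlgebra.of ℤ P r) = 0 :=
    Ideal.Quotient.eq_zero_iff_mem.2 (Ideal.subset_span ⟨p, q, r, h, rfl⟩)
  rw [map_sub, map_add, sub_eq_zero] at this
  exact this.symm

theorem toUniversal_neg (p : P) : toUniversal P (-p) = -toUniversal P p := by
  have := toUniversal_of_mem (zero_mem_padd_neg p)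
  rw [map_zero] at this
  exact eq_neg_of_add_eq_zero_right this.symm

/-- The formal sum of a multiset. -/
noncomputable def formalSum (S : Multiset P) : MonoidAlgebra ℤ P :=
  (S.map fun p => MonoidAlgebra.of ℤ P p).sum

theorem formalSum_add (S T : Multiset P) : formalSum (S + T) = formalSum S + formalSum T := by
  rw [formalSum, Multiset.map_add, Multiset.sum_add]
  rfl

theorem formalSum_injective : Function.Injective (formalSum (P := P)) := by
  classical
  have key : ∀ (S : Multiset P) (p : P), (formalSum S).coeff p = S.count p := by
    intro S p
    induction S using Multiset.induction with
    | empty => simp [formalSum]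
    | cons a S ih =>
      rw [← Multiset.singleton_add, formalSum_add, MonoidAlgebra.coeff_add, Finsupp.add_apply, ih,
        Multiset.count_add, formalSum, Multiset.map_singleton, Multiset.sum_singleton,
        MonoidAlgebra.of_apply, MonoidAlgebra.coeff_single, Finsupp.single_apply, Multiset.count_singleton]
      push_cast
      simp [eq_comm]
  intro S T h
  ext p
  have h₁ := key S p
  rw [h, key T p] at h₁
  exact_mod_cast h₁.symm

theorem formalSum_map_mul (p : P) (S : Multiset P) :
    formalSum (S.map fun q => p * q) = MonoidAlgebra.of ℤ P p * formalSum S := by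
  rw [formalSum, formalSum, Multiset.map_map, ← Multiset.sum_map_mul_left]
  simp only [Function.comp_def, map_mul]

/-- The differences of multisets with sum `0`. -/
noncomputable def nullSubgroup (P : Type*) [PartialField P] : AddSubgroup (MonoidAlgebra ℤ P) where
  carrier := {x | ∃ S T : Multiset P, SumIs S 0 ∧ SumIs T 0 ∧ x = formalSum S - formalSum T}
  zero_mem' := ⟨0, 0, sumIs_zero, sumIs_zero, by abel⟩
  add_mem' := by
    rintro _ _ ⟨S, T, hS, hT, rfl⟩ ⟨S', T', hS', hT', rfl⟩
    refine ⟨S + S', T + T', hS.add hS', hT.add hT', ?_⟩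
    rw [formalSum_add, formalSum_add]
    abel
  neg_mem' := by
    rintro _ ⟨S, T, hS, hT, rfl⟩
    exact ⟨T, S, hT, hS, by abel⟩

theorem mul_mem_nullSubgroup (a : MonoidAlgebra ℤ P) {x : MonoidAlgebra ℤ P}
    (hx : x ∈ nullSubgroup P) : a * x ∈ nullSubgroup P := by
  induction a using MonoidAlgebra.induction_on with
  | of p =>
    obtain ⟨S, T, hS, hT, rfl⟩ := hx
    refine ⟨_, _, hS.map_mul p, hT.map_mul p, ?_⟩
    rw [formalSum_map_mul, formalSum_map_mul, mul_sub]
  | add a b ha hb =>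
    rw [add_mul]
    exact add_mem ha hb
  | smul n a ha =>
    rw [smul_mul_assoc]
    exact zsmul_mem ha n

/-- A generator `p + q - r` is the formal sum of `{p, q, -r}` minus that of `{r, -r}`, and both
multisets sum to zero in `P`. -/
theorem mem_nullSubgroup_of_mem_relIdeal {x : MonoidAlgebra ℤ P} (hx : x ∈ relIdeal P) :
    x ∈ nullSubgroup P := by
  induction hx using Submodule.span_induction with
  | mem x hx =>
    obtain ⟨p, q, r, h, rfl⟩ := hx
    refine ⟨_, _, sumIs_triple h, sumIs_pair r, ?_⟩
    rw [formalSum_add, formalSum_add]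
    simp only [formalSum, Multiset.insert_eq_cons, Multiset.map_cons, Multiset.map_singleton,
      Multiset.sum_cons, Multiset.sum_singleton]
    abel
  | zero => exact zero_mem _
  | add x y _ _ hx hy => exact add_mem hx hy
  | smul a x _ hx => exact mul_mem_nullSubgroup a hx

/-- A sum is defined in a partial field as soon as it holds in the universal ring. -/
theorem sumIs_of_toUniversal {S : Multiset P} {d : P}
    (h : (S.map (toUniversal P)).sum = toUniversal P d) : SumIs S d := by
  have hmem : formalSum S - formalSum {d} ∈ relIdeal P := by
    rw [← Ideal.Quotient.eq_zero_iff_mem, map_sub, sub_eq_zero]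
    simp only [formalSum, map_multiset_sum, Multiset.map_map, Multiset.map_singleton,
      Multiset.sum_singleton]
    exact h
  obtain ⟨W, W', hW, hW', e⟩ := mem_nullSubgroup_of_mem_relIdeal hmem
  -- An identity of formal sums is an identity of multisets. Thus `S + W'` sums to `d`; adding the
  -- negatives of `W'` and cancelling leaves `S`.
  have e' : S + W' = {d} + W := by
    apply formalSum_injective
    rw [formalSum_add, formalSum_add]
    linear_combination e
  have h₁ : SumIs (S + W') d := e' ▸ (sumIs_singleton d).add hW
  have h₂ := hW'.map_mul (-1)
  have h₃ : (W'.map fun q => -1 * q) = W'.map fun q => -q := by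
    refine Multiset.map_congr rfl fun q _ => ?_
    rw [mul_comm, PartialField.mul_neg, mul_one]
  rw [h₃] at h₂
  have := h₁.add h₂
  rw [add_assoc] at this
  exact this.cancel

end Universal

/-! ### From partial determinants to minors in a ring -/

section Determinants

open PivotMatrix

/-- The partial addition of `P` is the restriction of the addition of the ring `R`. -/
structure IsEmbedding {P R : Type*} [PartialField P] [CommRing R] (v : P →*₀ R) : Prop where
  injective : Function.Injective v
  mem_padd : ∀ p q r : P, r ∈ padd p q ↔ v r = v p + v q

variable {P R : Type*} [PartialField P] [CommRing R] {v : P →*₀ R}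

theorem IsEmbedding.map_neg (hv : IsEmbedding v) (p : P) : v (-p) = -v p := by
  have := (hv.mem_padd _ _ _).1 (zero_mem_padd_neg p)
  rw [map_zero] at this
  exact eq_neg_of_add_eq_zero_right this.symm

theorem IsEmbedding.good_neg_one (hv : IsEmbedding v) : Good v (-1) :=
  ⟨-1, by rw [hv.map_neg, map_one]⟩

theorem map_det_terms {R' : Type*} [CommRing R'] (w : P →*₀ R') (hw : ∀ p, w (-p) = -w p) {k : ℕ}
    (A : Fin k → Fin k → P) :
    (((Finset.univ : Finset (Equiv.Perm (Fin k))).val.map (fun σ =>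
      if Equiv.Perm.sign σ = 1 then ∏ i, A i (σ i) else -∏ i, A i (σ i))).map w).sum =
    minor w A id id := by
  rw [minor, ← Matrix.det_transpose, Matrix.det_apply, Multiset.map_map]
  refine Finset.sum_congr rfl fun σ _ => ?_
  rcases Int.units_eq_one_or (Equiv.Perm.sign σ) with h | h
  · simp [h]
  · have h' : ((-1 : ℤˣ) = 1) = False := by decide
    simp [h, h', hw]

theorem DetIs.val_eq (hv : IsEmbedding v) {k : ℕ} {A : Fin k → Fin k → P} {d : P}
    (h : DetIs (Matrix.of A) d) : v d = minor v A id id := by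
  obtain ⟨Z, hZ⟩ := h
  have := map_association v (fun p q r => (hv.mem_padd p q r).1) hZ
  rw [this, Multiset.map_add, Multiset.sum_add, ← map_det_terms v hv.map_neg A]
  simp [Multiset.map_map, hv.map_neg]

/-- The point is that a minor with value in `P` is also defined as a partial sum. The relations that
describe a pivot are defined sums in `P`, so they hold in the universal ring too. Reducing minors by
pivots there shows that each is the image of an element of `P`, and a determinant with such a value
is a defined sum. -/
theorem isPMatrix_iff (hv : IsEmbedding v) {X Y : Type*} {A : X → Y → P} :
    IsPMatrix (Matrix.of A) ↔ DetGood v A := by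
  constructor
  · intro h k f g
    by_cases hf : f.Injective
    swap
    · rw [minor_eq_zero_of_row _ hf]
      exact good_zero
    by_cases hg : g.Injective
    swap
    · rw [minor_eq_zero_of_col _ _ hg]
      exact good_zero
    obtain ⟨d, hd⟩ := h k f g hf hg
    exact ⟨d, DetIs.val_eq hv (A := fun i j => A (f i) (g j)) hd⟩
  · intro h k f g _ _
    have hU : DetGood (toUniversal P) A := by
      refine detGood_of_class ⟨-1, by rw [toUniversal_neg, map_one]⟩ ∅ {A | DetGood v A} ?_ ?_ h
      · intro A hA x y _ ne
        obtain ⟨A', hp⟩ := DetGood.exists_isPivot hv.good_neg_one hA ne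
        refine ⟨A', DetGood.pivot hv.good_neg_one hA hp, hp.ne, ?_, hp.row, hp.col, ?_⟩
        · have : A' x y * A x y = -1 := by
            apply hv.injective
            rw [map_mul, hp.entry, hv.map_neg, map_one]
          rw [← map_mul, this, toUniversal_neg, map_one]
        · intro i j hi hj
          have e := hp.other i j hi hj
          have : A' i j ∈ padd (A i j) (-(A i y * A x j * (A x y)⁻¹)) := by
            rw [hv.mem_padd, hv.map_neg, e, map_mul, map_mul, sub_eq_add_neg]
          rw [toUniversal_of_mem this, toUniversal_neg, map_mul, map_mul, sub_eq_add_neg]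
      · intro A _ k f g hg
        obtain _ | k := k
        · rw [minor, Matrix.det_fin_zero]
          exact good_one
        · exact (hg 0).elim
    obtain ⟨d, hd⟩ := hU k f g
    refine ⟨d, sumIs_of_toUniversal ?_⟩
    rw [hd]
    exact map_det_terms _ toUniversal_neg fun i j => A (f i) (g j)

theorem detNeZero_iff (hv : IsEmbedding v) {X Y : Type*} {A : X → Y → P} (hA : DetGood v A)
    {k : ℕ} (f : Fin k → X) (g : Fin k → Y) :
    DetNeZero ((Matrix.of A).submatrix f g) ↔ minor v A f g ≠ 0 := by
  constructor
  · rintro ⟨d, hd, h⟩ h0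
    have := DetIs.val_eq hv (A := fun i j => A (f i) (g j)) h
    refine hd ((val_eq_zero hv.injective).1 ?_)
    rw [this]
    exact h0
  · intro h
    have hA' : DetGood v (fun i j => A (f i) (g j)) := fun k f' g' => hA k (f ∘ f') (g ∘ g')
    obtain ⟨d, hd⟩ := (isPMatrix_iff hv).2 hA' k id id Function.injective_id Function.injective_id
    refine ⟨d, ?_, hd⟩
    rintro rfl
    have := DetIs.val_eq hv (A := fun i j => A (f i) (g j)) hd
    rw [map_zero] at this
    exact h this.symm

theorem rank_eq {r : ℕ} {Y : Type*} {A : Matrix (Fin r) Y P} {g : Fin r → Y} (hg : g.Injective)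
    (h : DetNeZero (A.submatrix id g)) : rank A = r := by
  refine IsGreatest.csSup_eq ⟨⟨id, g, Function.injective_id, hg, h⟩, ?_⟩
  rintro k ⟨f, -, hf, -, -⟩
  simpa using Fintype.card_le_of_injective f hf

theorem isRepresentable_iff (hv : IsEmbedding v) {α : Type*} (M : Matroid α) :
    IsRepresentable P M ↔ ∃ (r : ℕ) (A : Fin r → M.E → P), DetGood v A ∧
      ∀ B : Set α, M.IsBase B ↔ ∃ g : Fin r → M.E, Function.Injective g ∧
        Set.range (fun i => (g i : α)) = B ∧ minor v A id g ≠ 0 := by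
  constructor
  · rintro ⟨r, A, hA, -, hB⟩
    have hA' := (isPMatrix_iff hv (A := fun i j => A i j)).1 hA
    refine ⟨r, fun i j => A i j, hA', fun B => ?_⟩
    rw [hB B]
    exact exists_congr fun g => and_congr_right fun _ => and_congr_right fun _ =>
      detNeZero_iff hv hA' id g
  · rintro ⟨r, A, hA, hB⟩
    have hB' : ∀ B : Set α, M.IsBase B ↔ B ∈ basesOf (Matrix.of A) := fun B => by
      rw [hB B]
      exact exists_congr fun g => and_congr_right fun _ => and_congr_right fun _ =>
        (detNeZero_iff hv (A := Matrix.of A) hA id g).symm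
    -- The rank condition is automatic: a base provides a nonzero minor with all `r` rows.
    obtain ⟨B, hBase⟩ := M.exists_isBase
    obtain ⟨g, hg, -, hdet⟩ := (hB' B).1 hBase
    exact ⟨r, Matrix.of A, (isPMatrix_iff hv).2 hA, rank_eq hg hdet, hB'⟩

/-- Representability over `P` and over `Q` agree if matrices can be lifted along `Q → P`. -/
theorem isRepresentable_iff_of_isLifting {Q RQ : Type*} [PartialField Q] [CommRing RQ]
    {vQ : Q →*₀ RQ} (hv : IsEmbedding v) (hvQ : IsEmbedding vQ) {φ : Q →*₀ P}
    (h : IsLifting vQ v φ) (ρ : RQ →+* R) (hρ : ∀ q, ρ (vQ q) = v (φ q)) {α : Type*}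
    (M : Matroid α) [M.Finite] : IsRepresentable P M ↔ IsRepresentable Q M := by
  have hmap : ∀ {X Y : Type _} (B : X → Y → Q) {k : ℕ} (f : Fin k → X) (g : Fin k → Y),
      minor v (fun x y => φ (B x y)) f g = ρ (minor vQ B f g) := by
    intro X Y B k f g
    simp only [minor, RingHom.map_det]
    congr 1
    ext i j
    exact (hρ _).symm
  -- A good minor is the value of some `d`, and `φ d` vanishes only for `d = 0`; so a matrix and its
  -- image have the same bases.
  have hne : ∀ {X Y : Type _} (B : X → Y → Q), DetGood vQ B → ∀ {k : ℕ} (f : Fin k → X)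
      (g : Fin k → Y), minor v (fun x y => φ (B x y)) f g ≠ 0 ↔ minor vQ B f g ≠ 0 := by
    intro X Y B hB k f g
    obtain ⟨d, hd⟩ := hB k f g
    rw [hmap, ← hd, hρ, ne_eq, ne_eq, val_eq_zero hv.injective, val_eq_zero hvQ.injective,
      map_eq_zero]
  rw [isRepresentable_iff hv, isRepresentable_iff hvQ]
  constructor
  · rintro ⟨r, A, hA, hbase⟩
    have : Finite M.E := M.ground_finite
    obtain ⟨B, hB, hφ⟩ := h.hasLift hA
    obtain rfl : A = fun x y => φ (B x y) := by
      ext x y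
      exact (hφ x y).symm
    refine ⟨r, B, hB, fun S => ?_⟩
    rw [hbase S]
    exact exists_congr fun g => and_congr_right fun _ => and_congr_right fun _ => hne B hB id g
  · rintro ⟨r, B, hB, hbase⟩
    refine ⟨r, fun x y => φ (B x y), fun k f g => ?_, fun S => ?_⟩
    · rw [hmap]
      obtain ⟨d, hd⟩ := hB k f g
      exact ⟨φ d, by rw [← hd, hρ]⟩
    · rw [hbase S]
      exact exists_congr fun g => and_congr_right fun _ => and_congr_right fun _ => (hne B hB id g).symm

end Determinants

end PartialField

/-! ### Two unit equations -/

namespace UnitEquation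

/-- The modulus `80 = 3 ^ 4 - 1` is also `16 * 5`, so powers of three and high powers of two both
have few residues. -/
theorem three_pow_mod (l : ℕ) : 3 ^ l % 80 = 1 ∨ 3 ^ l % 80 = 3 ∨ 3 ^ l % 80 = 9 ∨
    3 ^ l % 80 = 27 := by
  induction l with
  | zero => simp
  | succ l ih => rw [pow_succ]; omega

theorem two_pow_mod (k : ℕ) : 2 ^ (k + 4) % 80 = 16 ∨ 2 ^ (k + 4) % 80 = 32 ∨
    2 ^ (k + 4) % 80 = 64 ∨ 2 ^ (k + 4) % 80 = 48 := by
  induction k with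
  | zero => simp
  | succ k ih => rw [show k + 1 + 4 = k + 4 + 1 by ring, pow_succ]; omega

/-- Neighbouring powers of two and three. -/
theorem two_pow_three_pow {k l : ℕ} {ε δ γ : ℤ} (hε : ε = 1 ∨ ε = -1) (hδ : δ = 1 ∨ δ = -1)
    (hγ : γ = 1 ∨ γ = -1) (h : ε * 2 ^ k + δ * 3 ^ l = γ) :
    k = 1 ∧ l = 0 ∨ k = 1 ∧ l = 1 ∨ k = 2 ∧ l = 1 ∨ k = 3 ∧ l = 2 := by
  have h3 := three_pow_mod l
  have key : (2 ^ k : ℕ) = 3 ^ l + 1 ∨ (2 ^ k + 1 : ℕ) = 3 ^ l := by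
    have e2 : ((2 ^ k : ℕ) : ℤ) = 2 ^ k := by push_cast; rfl
    have e3 : ((3 ^ l : ℕ) : ℤ) = 3 ^ l := by push_cast; rfl
    have p2 : 0 < 2 ^ k := by positivity
    rw [← e2, ← e3] at h
    clear e2 e3 h3
    generalize 2 ^ k = a at *
    generalize 3 ^ l = b at *
    rcases hε with rfl | rfl <;> rcases hδ with rfl | rfl <;> rcases hγ with rfl | rfl <;> omega
  -- For `k ≥ 4` the residues of `2 ^ k` modulo `80` never differ by one from those of `3 ^ l`.
  have hk : k < 4 := by
    by_contra hk
    obtain ⟨j, rfl⟩ := Nat.exists_eq_add_of_le' (not_lt.1 hk)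
    have h2 := two_pow_mod j
    omega
  have hl : l < 3 := by
    by_contra hl
    have h27 : 3 ^ 3 ≤ 3 ^ l := Nat.pow_le_pow_right (by norm_num) (not_lt.1 hl)
    have h8 : 2 ^ k ≤ 2 ^ 3 := Nat.pow_le_pow_right (by norm_num) (by omega)
    omega
  interval_cases k <;> interval_cases l <;> simp_all

/-- The ultrametric inequality for two rational numbers with sum one. -/
theorem padicValRat_of_add_eq_one (p : ℕ) [Fact p.Prime] {x y : ℚ} (hx : x ≠ 0) (hy : y ≠ 0)
    (h : x + y = 1) :
    padicValRat p x = 0 ∧ 0 ≤ padicValRat p y ∨ padicValRat p y = 0 ∧ 0 ≤ padicValRat p x ∨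
      padicValRat p x = padicValRat p y ∧ padicValRat p x ≤ 0 := by
  have h1 : padicValRat p (x + y) = 0 := by rw [h, padicValRat.one]
  by_cases hxy : padicValRat p x = padicValRat p y
  · have := padicValRat.min_le_padicValRat_add (p := p) (q := x) (r := y) (by simp [h])
    rw [h1, ← hxy, min_self] at this
    exact Or.inr (Or.inr ⟨hxy, this⟩)
  · have := padicValRat.add_eq_min (p := p) (by simp [h]) hx hy hxy
    rw [h1] at this
    omega

theorem padicValRat_two {ε : ℤ} (hε : ε = 1 ∨ ε = -1) (m n : ℤ) :
    padicValRat 2 ((ε : ℚ) * 2 ^ m * 3 ^ n) = m := by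
  have h2 : padicValRat 2 (2 : ℚ) = 1 := by exact_mod_cast padicValRat.self (p := 2) (by norm_num)
  have h3 : padicValRat 2 (3 : ℚ) = 0 := by
    have := padicValRat.of_nat (p := 2) (n := 3)
    rw [padicValNat.eq_zero_of_not_dvd (by norm_num)] at this
    exact_mod_cast this
  have e1 : (ε : ℚ) ≠ 0 := by rcases hε with rfl | rfl <;> norm_num
  have e2 : padicValRat 2 (ε : ℚ) = 0 := by rcases hε with rfl | rfl <;> simp
  rw [padicValRat.mul (by positivity) (by positivity), padicValRat.mul e1 (by positivity),
    padicValRat.zpow, padicValRat.zpow, h2, h3, e2]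
  simp

theorem padicValRat_three {ε : ℤ} (hε : ε = 1 ∨ ε = -1) (m n : ℤ) :
    padicValRat 3 ((ε : ℚ) * 2 ^ m * 3 ^ n) = n := by
  have h2 : padicValRat 3 (3 : ℚ) = 1 := by exact_mod_cast padicValRat.self (p := 3) (by norm_num)
  have h3 : padicValRat 3 (2 : ℚ) = 0 := by
    have := padicValRat.of_nat (p := 3) (n := 2)
    rw [padicValNat.eq_zero_of_not_dvd (by norm_num)] at this
    exact_mod_cast this
  have e1 : (ε : ℚ) ≠ 0 := by rcases hε with rfl | rfl <;> norm_num
  have e2 : padicValRat 3 (ε : ℚ) = 0 := by rcases hε with rfl | rfl <;> simp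
  rw [padicValRat.mul (by positivity) (by positivity), padicValRat.mul e1 (by positivity),
    padicValRat.zpow, padicValRat.zpow, h2, h3, e2]
  simp

/-- Exponents `(m, n)` such that `x = ± 2 ^ m * 3 ^ n` and `1 - x` are `{2, 3}`-units. -/
def exponents : List (ℤ × ℤ) :=
  [(-2, 0), (-3, 2), (-2, 1), (0, 1), (-1, 0), (1, 0), (2, 0), (-1, 1), (-3, 0), (0, 2), (3, -2),
    (1, -1), (0, -1), (2, -1), (0, -2), (3, 0), (0, 0)]

theorem mem_exponents {m n m' n' ε δ : ℤ} (hε : ε = 1 ∨ ε = -1) (hδ : δ = 1 ∨ δ = -1)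
    (h : (ε : ℚ) * 2 ^ m * 3 ^ n + δ * 2 ^ m' * 3 ^ n' = 1) : (m, n) ∈ exponents := by
  have : Fact (Nat.Prime 3) := ⟨by norm_num⟩
  have eε : (ε : ℚ) ≠ 0 := by rcases hε with rfl | rfl <;> norm_num
  have eδ : (δ : ℚ) ≠ 0 := by rcases hδ with rfl | rfl <;> norm_num
  have c2 := padicValRat_of_add_eq_one 2 (by positivity) (by positivity) h
  have c3 := padicValRat_of_add_eq_one 3 (by positivity) (by positivity) h
  rw [padicValRat_two hε, padicValRat_two hδ] at c2
  rw [padicValRat_three hε, padicValRat_three hδ] at c3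
  have hone : (1 : ℤ) = 1 ∨ (1 : ℤ) = -1 := Or.inl rfl
  -- The three ultrametric possibilities at `2` and at `3` combine to nine cases. Six of them
  -- reduce, after clearing denominators, to neighbouring powers of two and three.
  rcases c2 with ⟨rfl, hm⟩ | ⟨rfl, hm⟩ | ⟨rfl, hm⟩ <;>
    rcases c3 with ⟨rfl, hn⟩ | ⟨rfl, hn⟩ | ⟨rfl, hn⟩
  · simp [exponents]
  · lift m' to ℕ using hm
    lift n to ℕ using hn
    simp only [zpow_zero, mul_one, zpow_natCast] at h
    have h' : δ * 2 ^ m' + ε * 3 ^ n = 1 := by rw [add_comm]; exact_mod_cast h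
    rcases two_pow_three_pow hδ hε hone h' with ⟨rfl, rfl⟩ | ⟨rfl, rfl⟩ | ⟨rfl, rfl⟩ | ⟨rfl, rfl⟩ <;>
      simp [exponents]
  · obtain ⟨j, rfl⟩ : ∃ j : ℤ, n = -j := ⟨-n, by simp⟩
    lift j to ℕ using by omega
    lift m' to ℕ using hm
    simp only [zpow_zero, mul_one, zpow_natCast, zpow_neg] at h
    have h3 : (3 : ℚ) ^ j ≠ 0 := by positivity
    field_simp at h
    have h' : -δ * 2 ^ m' + 1 * 3 ^ j = ε := by
      have : (ε : ℤ) + δ * 2 ^ m' = 3 ^ j := by exact_mod_cast h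
      linarith
    rcases two_pow_three_pow (by omega) hone hε h' with ⟨rfl, rfl⟩ | ⟨rfl, rfl⟩ | ⟨rfl, rfl⟩ |
      ⟨rfl, rfl⟩ <;> simp [exponents]
  · lift n' to ℕ using hn
    lift m to ℕ using hm
    simp only [zpow_zero, mul_one, zpow_natCast] at h
    have h' : ε * 2 ^ m + δ * 3 ^ n' = 1 := by exact_mod_cast h
    rcases two_pow_three_pow hε hδ hone h' with ⟨rfl, rfl⟩ | ⟨rfl, rfl⟩ | ⟨rfl, rfl⟩ | ⟨rfl, rfl⟩ <;>
      simp [exponents]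
  -- The second summand is `± 1`, so the first is `0`, which is impossible, or `2`.
  · have h2 := padicValRat_two hε m n
    have h3 := padicValRat_three hε m n
    rcases hδ with rfl | rfl
    · exact absurd h (by simp [eε, zpow_ne_zero])
    · have e : (ε : ℚ) * 2 ^ m * 3 ^ n = ((1 : ℤ) : ℚ) * 2 ^ (1 : ℤ) * 3 ^ (0 : ℤ) := by
        simp at h ⊢
        linarith
      rw [e, padicValRat_two hone] at h2
      rw [e, padicValRat_three hone] at h3
      simp [exponents, ← h2, ← h3]
  · obtain ⟨j, rfl⟩ : ∃ j : ℤ, n = -j := ⟨-n, by simp⟩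
    lift j to ℕ using by omega
    lift m to ℕ using hm
    simp only [zpow_zero, mul_one, zpow_natCast, zpow_neg] at h
    have h3 : (3 : ℚ) ^ j ≠ 0 := by positivity
    field_simp at h
    have h' : -ε * 2 ^ m + 1 * 3 ^ j = δ := by
      have : (ε : ℤ) * 2 ^ m + δ = 3 ^ j := by exact_mod_cast h
      linarith
    rcases two_pow_three_pow (by omega) hone hδ h' with ⟨rfl, rfl⟩ | ⟨rfl, rfl⟩ | ⟨rfl, rfl⟩ |
      ⟨rfl, rfl⟩ <;> simp [exponents]
  · obtain ⟨j, rfl⟩ : ∃ j : ℤ, m = -j := ⟨-m, by simp⟩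
    lift j to ℕ using by omega
    lift n' to ℕ using hn
    simp only [zpow_zero, mul_one, zpow_natCast, zpow_neg] at h
    have h3 : (2 : ℚ) ^ j ≠ 0 := by positivity
    field_simp at h
    have h' : 1 * 2 ^ j + -δ * 3 ^ n' = ε := by
      have : (ε : ℤ) + δ * 3 ^ n' = 2 ^ j := by exact_mod_cast h
      linarith
    rcases two_pow_three_pow hone (by omega) hε h' with ⟨rfl, rfl⟩ | ⟨rfl, rfl⟩ | ⟨rfl, rfl⟩ |
      ⟨rfl, rfl⟩ <;> simp [exponents]
  · obtain ⟨j, rfl⟩ : ∃ j : ℤ, m = -j := ⟨-m, by simp⟩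
    lift j to ℕ using by omega
    lift n to ℕ using hn
    simp only [zpow_zero, mul_one, zpow_natCast, zpow_neg] at h
    have h3 : (2 : ℚ) ^ j ≠ 0 := by positivity
    field_simp at h
    have h' : 1 * 2 ^ j + -ε * 3 ^ n = δ := by
      have : (ε : ℤ) * 3 ^ n + δ = 2 ^ j := by exact_mod_cast h
      linarith
    rcases two_pow_three_pow hone (by omega) hδ h' with ⟨rfl, rfl⟩ | ⟨rfl, rfl⟩ | ⟨rfl, rfl⟩ |
      ⟨rfl, rfl⟩ <;> simp [exponents]
  -- The summands agree up to sign, so both are `1/2`.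
  · obtain ⟨η, hη, e⟩ : ∃ η : ℤ, (η = 1 ∨ η = -1) ∧
        (η : ℚ) * 2 ^ (m + 1) * 3 ^ n = ((1 : ℤ) : ℚ) * 2 ^ (0 : ℤ) * 3 ^ (0 : ℤ) := by
      refine ⟨ε, hε, ?_⟩
      rw [zpow_add₀ (by norm_num)]
      rcases hε with rfl | rfl <;> rcases hδ with rfl | rfl <;> simp at h ⊢ <;> linarith
    have h2 := padicValRat_two hη (m + 1) n
    have h3 := padicValRat_three hη (m + 1) n
    rw [e, padicValRat_two hone] at h2
    rw [e, padicValRat_three hone] at h3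
    obtain rfl : m = -1 := by omega
    simp [exponents, ← h3]

end UnitEquation

/-! ### Gaussian units -/

namespace GaussianUnits

open Complex

theorem one_add_I_ne_zero : (1 + I : ℂ) ≠ 0 := fun h => by simpa using congrArg re h

theorem I_zpow_eq_one_iff (k : ℤ) : I ^ k = 1 ↔ 4 ∣ k := by
  constructor
  · intro h
    have hk := Int.emod_add_mul_ediv k 4
    rw [← hk, zpow_add₀ I_ne_zero, zpow_mul] at h
    have h4 : I ^ (4 : ℤ) = 1 := by exact_mod_cast I_pow_four
    rw [h4, one_zpow, mul_one] at h
    have h0 := Int.emod_nonneg k (b := 4) (by norm_num)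
    have h1 := Int.emod_lt_of_pos k (b := 4) (by norm_num)
    refine Int.dvd_of_emod_eq_zero ?_
    generalize k % 4 = r at *
    interval_cases r
    · rfl
    · simpa using congrArg re h
    · have : I ^ (2 : ℤ) = -1 := by exact_mod_cast I_sq
      rw [this] at h
      norm_num at h
    · have : I ^ (3 : ℤ) = -I := by exact_mod_cast I_pow_three
      rw [this] at h
      simpa using congrArg re h
  · rintro ⟨j, rfl⟩
    have h4 : I ^ (4 : ℤ) = 1 := by exact_mod_cast I_pow_four
    rw [zpow_mul, h4, one_zpow]

theorem I_zpow_congr {k l : ℤ} (h : 4 ∣ k - l) : I ^ k = I ^ l := by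
  have := (I_zpow_eq_one_iff _).2 h
  rwa [zpow_sub₀ I_ne_zero, div_eq_one_iff_eq (zpow_ne_zero _ I_ne_zero)] at this

theorem normSq_I_zpow_mul (k n : ℤ) : normSq (I ^ k * (1 + I) ^ n) = 2 ^ n := by
  rw [map_mul, map_zpow₀, map_zpow₀, normSq_I, one_zpow, one_mul]
  congr 1
  simp [normSq_apply]
  norm_num

theorem I_zpow_mul_eq_iff (k n l m : ℤ) :
    I ^ k * (1 + I) ^ n = I ^ l * (1 + I) ^ m ↔ 4 ∣ k - l ∧ n = m := by
  constructor
  · intro h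
    have hn := congrArg normSq h
    rw [normSq_I_zpow_mul, normSq_I_zpow_mul] at hn
    obtain rfl := zpow_right_injective₀ (by norm_num : (0 : ℝ) < 2) (by norm_num) hn
    refine ⟨(I_zpow_eq_one_iff _).1 ?_, rfl⟩
    rw [zpow_sub₀ I_ne_zero, div_eq_one_iff_eq (zpow_ne_zero _ I_ne_zero)]
    exact mul_right_cancel₀ (zpow_ne_zero _ one_add_I_ne_zero) h
  · rintro ⟨h, rfl⟩
    rw [I_zpow_congr h]

/-- Powers of `I` times nonnegative powers of `1 + I` are Gaussian integers. -/
theorem mem_range_toComplex (k : ℤ) (n : ℕ) :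
    I ^ k * (1 + I) ^ n ∈ GaussianInt.toComplex.range := by
  have hI : I ∈ GaussianInt.toComplex.range := ⟨⟨0, 1⟩, by simp [GaussianInt.toComplex_def]⟩
  have hk : I ^ k = I ^ (k % 4).toNat := by
    rw [← zpow_natCast, Int.toNat_of_nonneg (Int.emod_nonneg _ (by norm_num))]
    exact I_zpow_congr (by omega)
  rw [hk]
  exact mul_mem (pow_mem hI _) (pow_mem (add_mem (one_mem _) hI) _)

/-- The left side is a Gaussian integer divisible by `1 + I`, so its norm is even, while the right
side has norm one. -/
theorem add_ne_I_zpow (k l j : ℤ) {n m : ℤ} (hn : 0 < n) (hm : 0 < m) :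
    I ^ k * (1 + I) ^ n + I ^ l * (1 + I) ^ m ≠ I ^ j := by
  intro h
  obtain ⟨a, rfl⟩ : ∃ a : ℕ, n = a + 1 := ⟨(n - 1).toNat, by omega⟩
  obtain ⟨b, rfl⟩ : ∃ b : ℕ, m = b + 1 := ⟨(m - 1).toNat, by omega⟩
  obtain ⟨x, hx⟩ := add_mem (mem_range_toComplex k a) (mem_range_toComplex l b)
  have e : (1 + I) * GaussianInt.toComplex x = I ^ j := by
    rw [hx, ← h, zpow_add_one₀ one_add_I_ne_zero, zpow_add_one₀ one_add_I_ne_zero, zpow_natCast,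
      zpow_natCast]
    ring
  have hN := congrArg normSq e
  rw [map_mul, map_zpow₀, normSq_I, one_zpow, ← GaussianInt.intCast_real_norm] at hN
  have h2 : normSq (1 + I) = ((2 : ℤ) : ℝ) := by
    simp [normSq_apply]
    norm_num
  rw [h2] at hN
  have hN' : 2 * x.norm = 1 := by exact_mod_cast hN
  omega

theorem exponent_cases {k l n m : ℤ} (h : I ^ k * (1 + I) ^ n + I ^ l * (1 + I) ^ m = 1) :
    n = 0 ∨ m = 0 ∨ n = m := by
  have e2 : I ^ (2 : ℤ) = -1 := by exact_mod_cast I_sq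
  have hu := one_add_I_ne_zero
  by_contra! hc
  obtain ⟨hn, hm, hnm⟩ := hc
  have ineq : ∀ {k l n m : ℤ}, I ^ k * (1 + I) ^ n + I ^ l * (1 + I) ^ m = 1 → n < 0 → n < m →
      False := by
    intro k l n m h hn hm
    -- The equation is divided by `(1 + I) ^ n`; the shift by `2` in the exponent of `I` is a minus
    -- sign.
    refine add_ne_I_zpow 0 (l + 2) k (n := -n) (m := m - n) (by omega) (by omega) ?_
    rw [zpow_add₀ I_ne_zero, e2, zpow_sub₀ hu, zpow_neg, zpow_zero]
    have hz := zpow_ne_zero n hu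
    field_simp
    linear_combination -h
  rcases lt_trichotomy n 0 with h1 | h1 | h1
  · rcases lt_or_gt_of_ne hnm with h2 | h2
    · exact ineq h h1 h2
    · exact ineq (by rwa [add_comm]) (by omega) h2
  · exact hn h1
  · rcases lt_or_gt_of_ne hm with h2 | h2
    · exact ineq (by rwa [add_comm]) h2 (by omega)
    · exact add_ne_I_zpow k l 0 h1 h2 (by simpa using h)

/-- The exponents `(k, n)`, where `0 ≤ k < 4`, such that both `x = I ^ k * (1 + I) ^ n` and `1 - x`
are units of `ℤ[I, 1/2]`. -/
def exponents : List (ℤ × ℤ) :=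
  [(1, 0), (2, 0), (3, 0), (3, 1), (3, 2), (0, 1), (0, -1), (1, -1), (1, -2)]

theorem I_zpow_cases (k : ℤ) : k % 4 = 0 ∧ I ^ k = 1 ∨ k % 4 = 1 ∧ I ^ k = I ∨
    k % 4 = 2 ∧ I ^ k = -1 ∨ k % 4 = 3 ∧ I ^ k = -I := by
  have h : I ^ k = I ^ (k % 4) := I_zpow_congr (by omega)
  have e2 : I ^ (2 : ℤ) = -1 := by exact_mod_cast I_sq
  have e3 : I ^ (3 : ℤ) = -I := by exact_mod_cast I_pow_three
  have h0 := Int.emod_nonneg k (b := 4) (by norm_num)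
  have h1 := Int.emod_lt_of_pos k (b := 4) (by norm_num)
  rw [h]
  generalize k % 4 = r at *
  interval_cases r <;> simp [e2, e3]

theorem one_sub_cases {z : ℂ} {l : ℤ} (hz : z ≠ 0) (h : z = 1 - I ^ l) :
    z = I ^ (3 : ℤ) * (1 + I) ^ (1 : ℤ) ∨ z = I ^ (3 : ℤ) * (1 + I) ^ (2 : ℤ) ∨
      z = I ^ (0 : ℤ) * (1 + I) ^ (1 : ℤ) := by
  have e3 : I ^ (3 : ℤ) = -I := by exact_mod_cast I_pow_three
  have e2 : (1 + I) ^ (2 : ℤ) = (1 + I) ^ 2 := by exact_mod_cast rfl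
  rw [e3, e2, zpow_one, zpow_zero]
  rcases I_zpow_cases l with ⟨-, hl⟩ | ⟨-, hl⟩ | ⟨-, hl⟩ | ⟨-, hl⟩ <;> rw [hl] at h
  · simp [h] at hz
  · left
    linear_combination h + I_sq
  · right
    left
    linear_combination h + (2 + I) * I_sq
  · right
    right
    linear_combination h

/-- By the ultrametric trichotomy, one of `x`, `1 - x`, or `(1 - x) / x` is a power of `I`. In the
last two cases `x` or its inverse has the form `1 - I ^ j`. -/
theorem mem_exponents {k l n m : ℤ} (h : I ^ k * (1 + I) ^ n + I ^ l * (1 + I) ^ m = 1) :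
    (k % 4, n) ∈ exponents := by
  have hu := one_add_I_ne_zero
  have hz : I ^ k * (1 + I) ^ n ≠ 0 :=
    mul_ne_zero (zpow_ne_zero _ I_ne_zero) (zpow_ne_zero _ hu)
  have hw : I ^ l * (1 + I) ^ m ≠ 0 :=
    mul_ne_zero (zpow_ne_zero _ I_ne_zero) (zpow_ne_zero _ hu)
  simp only [exponents, List.mem_cons, Prod.mk.injEq, List.not_mem_nil, or_false]
  rcases exponent_cases h with rfl | rfl | rfl
  · rcases I_zpow_cases k with ⟨-, hl⟩ | ⟨hk, hl⟩ | ⟨hk, hl⟩ | ⟨hk, hl⟩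
    · rw [hl] at h
      simp at h
      exact absurd (by simp [h]) hw
    all_goals simp [hk]
  · rw [zpow_zero, mul_one] at h
    rcases one_sub_cases hz (eq_sub_of_add_eq h) with h | h | h <;>
      rw [I_zpow_mul_eq_iff] at h <;> omega
  · have hn := zpow_ne_zero n hu
    have hk := zpow_ne_zero k I_ne_zero
    have hi : I ^ (-k) * (1 + I) ^ (-n) = 1 - I ^ (l - k + 2) := by
      have e2 : I ^ (2 : ℤ) = -1 := by exact_mod_cast I_sq
      rw [zpow_add₀ I_ne_zero, zpow_sub₀ I_ne_zero, e2, zpow_neg, zpow_neg]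
      field_simp
      linear_combination -h
    rcases one_sub_cases (mul_ne_zero (zpow_ne_zero _ I_ne_zero) (zpow_ne_zero _ hu)) hi
      with h | h | h <;> rw [I_zpow_mul_eq_iff] at h <;> omega

end GaussianUnits

/-! ### Changing the ambient ring of `ℙ(R, S)` -/

namespace RingPartialField

variable {R : Type*} [CommRing R] [Nontrivial R] {S : Set Rˣ}

/-- The inclusion of `ℙ(R, S)` in `R`. -/
def valHom : RingPartialField R S →*₀ R where
  toFun := val
  map_zero' := rfl
  map_one' := rfl
  map_mul' _ _ := rfl

theorem valHom_apply (x : RingPartialField R S) : valHom x = x.val := rfl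

/-- If `ℙ(R, S)` is contained in a subring of `R`, it can be seen as embedded in that subring. -/
theorem exists_isEmbedding {A : Type*} [CommRing A] (E : A →+* R) (hE : Function.Injective E)
    (hS : ∀ u ∈ S, ∃ w : Aˣ, E w = u) :
    ∃ v : RingPartialField R S →*₀ A, PartialField.IsEmbedding v ∧ ∀ q, E (v q) = q.val := by
  have hle : Subgroup.closure (S ∪ {-1}) ≤ (Units.map (E : A →* R)).range := by
    rw [Subgroup.closure_le]
    rintro u (hu | rfl)
    · obtain ⟨w, hw⟩ := hS u hu
      exact ⟨w, Units.ext hw⟩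
    · exact ⟨-1, Units.ext (by simp)⟩
  have hex : ∀ q : RingPartialField R S, ∃ a, E a = q.val := by
    rintro ⟨_, rfl | ⟨u, hu, rfl⟩⟩
    · exact ⟨0, map_zero E⟩
    · obtain ⟨w, rfl⟩ := hle hu
      exact ⟨w, rfl⟩
  choose v hv using hex
  refine ⟨⟨⟨v, ?_⟩, ?_, ?_⟩, ⟨?_, ?_⟩, hv⟩
  · exact hE (by rw [hv, map_zero]; rfl)
  · exact hE (by rw [hv, map_one]; rfl)
  · intro p q
    exact hE (by rw [hv, map_mul, hv, hv]; rfl)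
  · intro p q h
    exact RingPartialField.ext (by rw [← hv, ← hv]; exact congrArg E h)
  · intro p q r
    refine mem_add.trans ?_
    rw [← hv, ← hv, ← hv, ← map_add]
    exact hE.eq_iff

end RingPartialField

/-! ### The 2-cyclotomic partial field -/

namespace TwoCyclotomic

open Polynomial

/-- The ring `ℤ[α, 1 / α, 1 / (α - 1), 1 / (α + 1)]`. -/
abbrev Loc : Type := Localization.Away (X * (X - 1) * (X + 1) : ℤ[X])

section Evaluation

variable {K : Type*} [Field K]

/-- Evaluation at `z`, for `z` different from `0`, `1`, `-1`. -/
noncomputable def ev (z : K) (h : z * (z - 1) * (z + 1) ≠ 0) : Loc →+* K :=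
  IsLocalization.Away.lift (X * (X - 1) * (X + 1) : ℤ[X])
    (g := eval₂RingHom (Int.castRingHom K) z) (by simpa using h)

theorem ev_algebraMap (z : K) (h : z * (z - 1) * (z + 1) ≠ 0) (p : ℤ[X]) :
    ev z h (algebraMap ℤ[X] Loc p) = p.eval₂ (Int.castRingHom K) z :=
  IsLocalization.Away.lift_eq _ _ _

end Evaluation

theorem ratFunc_ne_zero :
    (RatFunc.X * (RatFunc.X - 1) * (RatFunc.X + 1) : RatFunc ℚ) ≠ 0 :=
  mul_ne_zero (mul_ne_zero RatFunc.X_ne_zero ratFunc_X_sub_one_ne_zero) ratFunc_X_add_one_ne_zero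

/-- Denominators are units, and `α` is transcendental, so no nonzero integer polynomial vanishes at
it. -/
theorem ev_injective : Function.Injective (ev (RatFunc.X : RatFunc ℚ) ratFunc_ne_zero) := by
  rw [injective_iff_map_eq_zero]
  intro x hx
  obtain ⟨⟨p, s⟩, hps⟩ := IsLocalization.surj (Submonoid.powers (X * (X - 1) * (X + 1) : ℤ[X])) x
  have hp : ev (RatFunc.X : RatFunc ℚ) ratFunc_ne_zero (algebraMap ℤ[X] Loc p) = 0 := by
    rw [← hps, map_mul, hx, zero_mul]
  have hp0 : p = 0 := by
    have e : p.eval₂ (Int.castRingHom (RatFunc ℚ)) RatFunc.X =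
        algebraMap ℚ[X] (RatFunc ℚ) (p.map (Int.castRingHom ℚ)) := by
      have : eval₂RingHom (Int.castRingHom (RatFunc ℚ)) RatFunc.X =
          (algebraMap ℚ[X] (RatFunc ℚ)).comp (mapRingHom (Int.castRingHom ℚ)) := by
        ext <;> simp
      exact congrArg (fun f => f p) this
    rw [ev_algebraMap, e, map_eq_zero_iff _ (RatFunc.algebraMap_injective ℚ)] at hp
    exact (Polynomial.map_eq_zero_iff (Int.cast_injective)).1 hp
  rw [hp0, map_zero] at hps
  exact ((IsLocalization.map_units Loc s).mul_left_eq_zero).1 hps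

theorem isUnit_factors : IsUnit (algebraMap ℤ[X] Loc X) ∧
    IsUnit (algebraMap ℤ[X] Loc X - 1) ∧ IsUnit (algebraMap ℤ[X] Loc X + 1) := by
  have h : IsUnit (algebraMap ℤ[X] Loc (X * (X - 1) * (X + 1))) :=
    IsLocalization.Away.algebraMap_isUnit _
  simp only [map_mul, map_add, map_sub, map_one] at h
  have h1 := isUnit_of_mul_isUnit_left h
  exact ⟨isUnit_of_mul_isUnit_left h1, isUnit_of_mul_isUnit_right h1,
    isUnit_of_mul_isUnit_right h⟩

/-- The ring `ℚ(α)` has no homomorphism to `GF(4)`. Working over `ℤ` instead makes evaluation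
possible in every characteristic. -/
theorem exists_embedding : ∃ v : TwoCyclotomicPF →*₀ Loc, PartialField.IsEmbedding v ∧
    ∀ q, ev (RatFunc.X : RatFunc ℚ) ratFunc_ne_zero (v q) = q.val := by
  refine RingPartialField.exists_isEmbedding _ ev_injective ?_
  obtain ⟨⟨a, ha⟩, ⟨b, hb⟩, ⟨c, hc⟩⟩ := isUnit_factors
  rintro u (rfl | rfl | rfl)
  · exact ⟨a, by simp [ha, ev_algebraMap]⟩
  · exact ⟨b, by simp [hb, ev_algebraMap]⟩
  · exact ⟨c, by simp [hc, ev_algebraMap]⟩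

/-- The embedding of `𝕂₂` in `ℤ[α, 1 / α, 1 / (α - 1), 1 / (α + 1)]`. -/
noncomputable def val : TwoCyclotomicPF →*₀ Loc := exists_embedding.choose

theorem isEmbedding_val : PartialField.IsEmbedding val := exists_embedding.choose_spec.1

theorem ev_val (q : TwoCyclotomicPF) :
    ev (RatFunc.X : RatFunc ℚ) ratFunc_ne_zero (val q) = q.val := exists_embedding.choose_spec.2 q

/-- The element `α`. -/
noncomputable def gen : TwoCyclotomicPF :=
  ⟨RatFunc.X, Or.inr ⟨_, Subgroup.subset_closure (Or.inl (Or.inl rfl)), rfl⟩⟩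

/-- The element `α - 1`. -/
noncomputable def genSubOne : TwoCyclotomicPF :=
  ⟨RatFunc.X - 1, Or.inr ⟨_, Subgroup.subset_closure (Or.inl (Or.inr (Or.inl rfl))), rfl⟩⟩

/-- The element `α + 1`. -/
noncomputable def genAddOne : TwoCyclotomicPF :=
  ⟨RatFunc.X + 1, Or.inr ⟨_, Subgroup.subset_closure (Or.inl (Or.inr (Or.inr rfl))), rfl⟩⟩

/-- The element `(-1) ^ e * α ^ a * (α - 1) ^ b * (α + 1) ^ c`. -/
noncomputable def el (e a b c : ℤ) : TwoCyclotomicPF :=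
  (-1) ^ e * gen ^ a * genSubOne ^ b * genAddOne ^ c

theorem el_val (e a b c : ℤ) : (el e a b c).val =
    (-1) ^ e * RatFunc.X ^ a * (RatFunc.X - 1) ^ b * (RatFunc.X + 1) ^ c := by
  rw [← RingPartialField.valHom_apply, el]
  simp only [map_mul, map_zpow₀]
  rfl

theorem exists_eq_el {q : TwoCyclotomicPF} (hq : q ≠ 0) : ∃ e a b c, q = el e a b c := by
  obtain ⟨x, rfl | ⟨u, hu, rfl⟩⟩ := q
  · exact absurd rfl hq
  suffices h : ∃ e a b c, (u : RatFunc ℚ) = (el e a b c).val by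
    obtain ⟨e, a, b, c, h⟩ := h
    exact ⟨e, a, b, c, RingPartialField.ext h⟩
  clear hq
  simp only [el_val]
  have h0 := RatFunc.X_ne_zero (K := ℚ)
  have h1 := ratFunc_X_sub_one_ne_zero
  have h2 := ratFunc_X_add_one_ne_zero
  induction hu using Subgroup.closure_induction with
  | mem u hu =>
    rcases hu with (rfl | rfl | rfl) | rfl
    · exact ⟨0, 1, 0, 0, by simp⟩
    · exact ⟨0, 0, 1, 0, by simp⟩
    · exact ⟨0, 0, 0, 1, by simp⟩
    · exact ⟨1, 0, 0, 0, by simp⟩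
  | one => exact ⟨0, 0, 0, 0, by simp⟩
  | mul u w _ _ hu hw =>
    obtain ⟨e, a, b, c, h⟩ := hu
    obtain ⟨e', a', b', c', h'⟩ := hw
    refine ⟨e + e', a + a', b + b', c + c', ?_⟩
    rw [Units.val_mul, h, h', zpow_add₀ h0, zpow_add₀ h1, zpow_add₀ h2,
      zpow_add₀ (neg_ne_zero.2 one_ne_zero)]
    ring
  | inv u _ hu =>
    obtain ⟨e, a, b, c, h⟩ := hu
    refine ⟨-e, -a, -b, -c, ?_⟩
    rw [Units.val_inv_eq_inv_val, h, zpow_neg, zpow_neg, zpow_neg, zpow_neg, mul_inv, mul_inv,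
      mul_inv]

theorem el_div (e a b c e' a' b' c' : ℤ) :
    el e a b c / el e' a' b' c' = el (e - e') (a - a') (b - b') (c - c') := by
  have h0 := RatFunc.X_ne_zero (K := ℚ)
  have h1 := ratFunc_X_sub_one_ne_zero
  have h2 := ratFunc_X_add_one_ne_zero
  apply RingPartialField.ext
  rw [← RingPartialField.valHom_apply, map_div₀, RingPartialField.valHom_apply,
    RingPartialField.valHom_apply, el_val, el_val, el_val, zpow_sub₀ h0, zpow_sub₀ h1,
    zpow_sub₀ h2, zpow_sub₀ (neg_ne_zero.2 one_ne_zero)]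
  field_simp

theorem el_emod_two (e a b c : ℤ) : el (e % 2) a b c = el e a b c := by
  apply RingPartialField.ext
  rw [el_val, el_val]
  congr 3
  conv_rhs => rw [← Int.emod_add_mul_ediv e 2, zpow_add₀ (neg_ne_zero.2 one_ne_zero), zpow_mul]
  norm_num

theorem el_ne_zero (e a b c : ℤ) : el e a b c ≠ 0 := by
  intro h
  have := el_val e a b c
  rw [h] at this
  have h0 := RatFunc.X_ne_zero (K := ℚ)
  have h1 := ratFunc_X_sub_one_ne_zero
  have h2 := ratFunc_X_add_one_ne_zero
  have h3 : (-1 : RatFunc ℚ) ≠ 0 := neg_ne_zero.2 one_ne_zero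
  exact mul_ne_zero (mul_ne_zero (mul_ne_zero (zpow_ne_zero e h3) (zpow_ne_zero a h0))
    (zpow_ne_zero b h1)) (zpow_ne_zero c h2) this.symm

theorem ev_val_el {K : Type*} [Field K] (z : K) (h : z * (z - 1) * (z + 1) ≠ 0) (e a b c : ℤ) :
    ev z h (val (el e a b c)) = (-1) ^ e * z ^ a * (z - 1) ^ b * (z + 1) ^ c := by
  have h0 : val gen = algebraMap ℤ[X] Loc X :=
    ev_injective (by rw [ev_val, ev_algebraMap]; simp [gen])
  have h1 : val genSubOne = algebraMap ℤ[X] Loc (X - 1) :=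
    ev_injective (by rw [ev_val, ev_algebraMap]; simp [genSubOne])
  have h2 : val genAddOne = algebraMap ℤ[X] Loc (X + 1) :=
    ev_injective (by rw [ev_val, ev_algebraMap]; simp [genAddOne])
  have h3 : val (-1) = -1 := by rw [isEmbedding_val.map_neg, map_one]
  have hz : ∀ q, ev z h (val q) = ((ev z h).toMonoidWithZeroHom.comp val) q := fun _ => rfl
  rw [hz, el]
  simp only [map_mul, map_zpow₀]
  simp only [← hz, h0, h1, h2, h3, ev_algebraMap]
  simp

end TwoCyclotomic

/-! ### The homomorphism from `𝕂₂` to `GF(4) ⊗ ℍ₂` -/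

namespace TwoCyclotomic

open PivotMatrix Complex

theorem exists_omega : ∃ w : GF4, w ^ 2 + w + 1 = 0 := by
  classical
  have : Fintype GF4 := Fintype.ofFinite _
  have hcard : Fintype.card GF4 = 4 := by
    rw [← Nat.card_eq_fintype_card, GaloisField.card 2 2 (by norm_num)]
    norm_num
  obtain ⟨w, -, hw⟩ := Finset.exists_mem_notMem_of_card_lt_card
    (s := ({0, 1} : Finset GF4)) (t := Finset.univ) (by
      rw [Finset.card_univ, hcard]
      exact lt_of_le_of_lt Finset.card_le_two (by norm_num))
  simp only [Finset.mem_insert, Finset.mem_singleton, not_or] at hw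
  have h3 := FiniteField.pow_card_sub_one_eq_one w hw.1
  rw [hcard] at h3
  refine ⟨w, mul_left_cancel₀ (sub_ne_zero.2 hw.2) ?_⟩
  linear_combination h3

/-- A primitive third root of unity in `GF(4)`. -/
noncomputable def omega : GF4 := exists_omega.choose

theorem omega_spec : omega ^ 2 + omega + 1 = 0 := exists_omega.choose_spec

theorem GF4_two : (2 : GF4) = 0 := CharTwo.two_eq_zero

theorem omega_ne_zero : omega ≠ 0 := fun h => by simpa [h] using omega_spec

theorem omega_zpow_three : omega ^ (3 : ℤ) = 1 := by
  have : omega ^ 3 = 1 := by linear_combination (omega - 1) * omega_spec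
  exact_mod_cast this

theorem omega_zpow_eq_one_iff (k : ℤ) : omega ^ k = 1 ↔ 3 ∣ k := by
  constructor
  · intro h
    rw [← Int.emod_add_mul_ediv k 3, zpow_add₀ omega_ne_zero, zpow_mul, omega_zpow_three,
      one_zpow, mul_one] at h
    have h0 := Int.emod_nonneg k (b := 3) (by norm_num)
    have h1 := Int.emod_lt_of_pos k (b := 3) (by norm_num)
    refine Int.dvd_of_emod_eq_zero ?_
    have hs := omega_spec
    generalize k % 3 = r at *
    interval_cases r
    · rfl
    · rw [zpow_one] at h
      rw [h] at hs
      exact absurd (by linear_combination hs - GF4_two) (one_ne_zero (α := GF4))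
    · have h' : omega ^ 2 = 1 := by exact_mod_cast h
      exact absurd (by linear_combination hs - h' - GF4_two) omega_ne_zero
  · rintro ⟨j, rfl⟩
    rw [zpow_mul, omega_zpow_three, one_zpow]

theorem omega_zpow_eq_iff (k l : ℤ) : omega ^ k = omega ^ l ↔ 3 ∣ k - l := by
  rw [← omega_zpow_eq_one_iff, zpow_sub₀ omega_ne_zero,
    div_eq_one_iff_eq (zpow_ne_zero _ omega_ne_zero)]

theorem exists_eq_omega_zpow {x : GF4} (hx : x ≠ 0) : ∃ k : ℤ, x = omega ^ k := by
  classical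
  have : Fintype GF4 := Fintype.ofFinite _
  have hcard : Fintype.card GF4 = 4 := by
    rw [← Nat.card_eq_fintype_card, GaloisField.card 2 2 (by norm_num)]
    norm_num
  have h3 := FiniteField.pow_card_sub_one_eq_one x hx
  rw [hcard] at h3
  have e : (x - 1) * ((x - omega) * (x - omega ^ 2)) = 0 := by
    linear_combination h3 + (x - 1) * (omega - 1 - x) * omega_spec
  rcases mul_eq_zero.1 e with h | h
  · exact ⟨0, by rw [zpow_zero]; exact sub_eq_zero.1 h⟩
  rcases mul_eq_zero.1 h with h | h
  · exact ⟨1, by rw [zpow_one]; exact sub_eq_zero.1 h⟩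
  · exact ⟨2, by exact_mod_cast sub_eq_zero.1 h⟩

theorem omega_admissible : omega * (omega - 1) * (omega + 1) ≠ 0 := by
  intro h
  refine one_ne_zero (α := GF4) ?_
  linear_combination (1 - omega ^ 2) * h -
    ((1 - omega ^ 2) * (omega - 1) + (omega - 2)) * omega_spec - GF4_two

theorem I_admissible : (I : ℂ) * (I - 1) * (I + 1) ≠ 0 := by
  intro h
  have h2 : I * (I - 1) * (I + 1) = -2 * I := by linear_combination I * I_sq
  rw [h2] at h
  simp at h

/-- In characteristic two `ω - 1 = ω + 1 = ω⁻¹`, and signs disappear. -/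
theorem ev_omega_el (e a b c : ℤ) :
    ev omega omega_admissible (val (el e a b c)) = omega ^ (a - b - c) := by
  have h1 : (-1 : GF4) = 1 := by linear_combination -GF4_two
  have h2 : omega - 1 = omega⁻¹ := by
    refine eq_inv_of_mul_eq_one_left ?_
    linear_combination omega_spec - (omega + 1) * GF4_two
  have h3 : omega + 1 = omega⁻¹ := by
    rw [← h2]
    linear_combination GF4_two
  rw [ev_val_el, h1, h2, h3, one_zpow, one_mul, inv_zpow, inv_zpow, zpow_sub₀ omega_ne_zero,
    zpow_sub₀ omega_ne_zero]
  rfl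

theorem ev_I_el (e a b c : ℤ) :
    ev I I_admissible (val (el e a b c)) = I ^ (2 * e + a + b) * (1 + I) ^ (b + c) := by
  have h1 : (-1 : ℂ) = I ^ (2 : ℤ) := by exact_mod_cast I_sq.symm
  have h2 : I - 1 = I * (1 + I) := by linear_combination -I_sq
  rw [ev_val_el, h1, h2, mul_zpow, ← zpow_mul, zpow_add₀ I_ne_zero, zpow_add₀ I_ne_zero,
    zpow_add₀ GaussianUnits.one_add_I_ne_zero, add_comm I 1]
  ring

theorem mem_gaussian (k n : ℤ) : ∃ u ∈ Subgroup.closure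
    (({Units.mk0 I I_ne_zero, Units.mk0 (1 - I) (fun h => by simpa using congrArg re h)} :
      Set ℂˣ) ∪ {-1}), (u : ℂ) = I ^ k * (1 + I) ^ n := by
  refine ⟨Units.mk0 I I_ne_zero ^ k * (Units.mk0 I I_ne_zero *
    Units.mk0 (1 - I) (fun h => by simpa using congrArg re h)) ^ n, ?_, ?_⟩
  · have h1 := Subgroup.subset_closure (G := ℂˣ) (k := ({Units.mk0 I I_ne_zero, Units.mk0 (1 - I)
      (fun h => by simpa using congrArg re h)} : Set ℂˣ) ∪ {-1}) (Or.inl (Or.inl rfl))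
    have h2 := Subgroup.subset_closure (G := ℂˣ) (k := ({Units.mk0 I I_ne_zero, Units.mk0 (1 - I)
      (fun h => by simpa using congrArg re h)} : Set ℂˣ) ∪ {-1}) (Or.inl (Or.inr rfl))
    exact mul_mem (zpow_mem h1 _) (zpow_mem (mul_mem h1 h2) _)
  · have e : I * (1 - I) = 1 + I := by linear_combination -I_sq
    simp [e]

theorem exists_gaussian {x : GaussianPF} (hx : x ≠ 0) :
    ∃ k n : ℤ, x.val = I ^ k * (1 + I) ^ n := by
  obtain ⟨x, rfl | ⟨u, hu, rfl⟩⟩ := x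
  · exact absurd rfl hx
  clear hx
  have h0 := I_ne_zero
  have h1 := GaussianUnits.one_add_I_ne_zero
  change ∃ k n : ℤ, (u : ℂ) = I ^ k * (1 + I) ^ n
  induction hu using Subgroup.closure_induction with
  | mem u hu =>
    rcases hu with (rfl | rfl) | rfl
    · exact ⟨1, 0, by simp⟩
    · refine ⟨-1, 1, ?_⟩
      rw [zpow_neg_one, zpow_one, Units.val_mk0, inv_I]
      linear_combination I_sq
    · exact ⟨2, 0, by simp⟩
  | one => exact ⟨0, 0, by simp⟩
  | mul u w _ _ hu hw =>
    obtain ⟨k, n, h⟩ := hu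
    obtain ⟨k', n', h'⟩ := hw
    refine ⟨k + k', n + n', ?_⟩
    rw [Units.val_mul, h, h', zpow_add₀ h0, zpow_add₀ h1]
    ring
  | inv u _ hu =>
    obtain ⟨k, n, h⟩ := hu
    exact ⟨-k, -n, by rw [Units.val_inv_eq_inv_val, h, zpow_neg, zpow_neg, mul_inv]⟩

/-- The embedding of `GF(4) ⊗ ℍ₂` in `GF(4) × ℂ`. -/
def prodVal : ProdPartialField GF4 GaussianPF →*₀ GF4 × ℂ where
  toFun x := (x.fst, x.snd.val)
  map_zero' := rfl
  map_one' := rfl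
  map_mul' _ _ := rfl

theorem prodVal_apply (x : ProdPartialField GF4 GaussianPF) : prodVal x = (x.fst, x.snd.val) := rfl

theorem isEmbedding_prodVal : PartialField.IsEmbedding prodVal where
  injective x y h := by
    rw [prodVal_apply, prodVal_apply, Prod.mk.injEq] at h
    exact ProdPartialField.ext h.1 (RingPartialField.ext h.2)
  mem_padd p q r := by
    refine ProdPartialField.mem_add.trans ?_
    rw [prodVal_apply, prodVal_apply, prodVal_apply, Prod.mk_add_mk, Prod.mk.injEq]
    exact and_congr Part.mem_some_iff RingPartialField.mem_add

/-- Simultaneous evaluation at `ω` and at `i`. -/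
noncomputable def evProd : Loc →+* GF4 × ℂ :=
  (ev omega omega_admissible).prod (ev I I_admissible)

theorem exists_prodVal_eq (q : TwoCyclotomicPF) : ∃ x, prodVal x = evProd (val q) := by
  by_cases hq : q = 0
  · exact ⟨0, by rw [hq, map_zero, map_zero, map_zero]⟩
  obtain ⟨e, a, b, c, rfl⟩ := exists_eq_el hq
  refine ⟨⟨ev omega omega_admissible (val (el e a b c)),
    ⟨ev I I_admissible (val (el e a b c)), Or.inr ?_⟩, ?_⟩, rfl⟩
  · rw [ev_I_el]
    exact mem_gaussian _ _
  · refine iff_of_true ?_ fun h => ?_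
    · rw [ev_omega_el]
      exact zpow_ne_zero _ omega_ne_zero
    · have h' := congrArg RingPartialField.val h
      change ev I I_admissible (val (el e a b c)) = 0 at h'
      rw [ev_I_el] at h'
      exact mul_ne_zero (zpow_ne_zero _ I_ne_zero)
        (zpow_ne_zero _ GaussianUnits.one_add_I_ne_zero) h'

/-- The homomorphism from `𝕂₂` to `GF(4) ⊗ ℍ₂` that sends `α` to `(ω, i)`. -/
noncomputable def toProd : TwoCyclotomicPF →*₀ ProdPartialField GF4 GaussianPF where
  toFun q := (exists_prodVal_eq q).choose
  map_zero' := isEmbedding_prodVal.injective (by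
    rw [(exists_prodVal_eq 0).choose_spec, map_zero, map_zero, map_zero])
  map_one' := isEmbedding_prodVal.injective (by
    rw [(exists_prodVal_eq 1).choose_spec, map_one, map_one, map_one])
  map_mul' p q := isEmbedding_prodVal.injective (by
    rw [(exists_prodVal_eq _).choose_spec, map_mul, map_mul, map_mul,
      (exists_prodVal_eq p).choose_spec, (exists_prodVal_eq q).choose_spec])

theorem prodVal_toProd (q : TwoCyclotomicPF) : prodVal (toProd q) = evProd (val q) :=
  (exists_prodVal_eq q).choose_spec

theorem prodVal_toProd_el (e a b c : ℤ) : prodVal (toProd (el e a b c)) =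
    (omega ^ (a - b - c), I ^ (2 * e + a + b) * (1 + I) ^ (b + c)) := by
  rw [prodVal_toProd, ← ev_omega_el e, ← ev_I_el]
  rfl

/-- The exponents of the image of `el e a b c` in `GF(4) ⊗ ℍ₂`. -/
def key (t : ℤ × ℤ × ℤ × ℤ) : ℤ × ℤ × ℤ :=
  ((t.2.1 - t.2.2.1 - t.2.2.2) % 3, (2 * t.1 + t.2.1 + t.2.2.1) % 4, t.2.2.1 + t.2.2.2)

theorem toProd_el_eq_iff (e a b c e' a' b' c' : ℤ) :
    toProd (el e a b c) = toProd (el e' a' b' c') ↔ key (e, a, b, c) = key (e', a', b', c') := by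
  rw [← isEmbedding_prodVal.injective.eq_iff, prodVal_toProd_el, prodVal_toProd_el, Prod.mk.injEq,
    omega_zpow_eq_iff, GaussianUnits.I_zpow_mul_eq_iff]
  simp only [key, Prod.mk.injEq]
  omega

theorem exists_eq_toProd_el {x : ProdPartialField GF4 GaussianPF} (hx : x ≠ 0) :
    ∃ e a b c, x = toProd (el e a b c) := by
  obtain ⟨h1, h2⟩ := ProdPartialField.ne_zero_and_ne_zero hx
  obtain ⟨j, hj⟩ := exists_eq_omega_zpow h1
  obtain ⟨k, n, hk⟩ := exists_gaussian h2
  -- The Chinese remainder theorem: the exponent of `α` must be `k` modulo `4` and `j + n` modulo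
  -- `3`.
  refine ⟨0, 9 * k + 4 * (j + n), 0, n, isEmbedding_prodVal.injective ?_⟩
  rw [prodVal_toProd_el, prodVal_apply, hj, hk, Prod.mk.injEq, omega_zpow_eq_iff,
    GaussianUnits.I_zpow_mul_eq_iff]
  omega

end TwoCyclotomic

/-! ### Fundamental elements of `𝕂₂` and of `GF(4) ⊗ ℍ₂` -/

namespace TwoCyclotomic

open PivotMatrix Complex

/-- The exponents of the nonzero elements `x` of `𝕂₂` such that `1 - x` is in `𝕂₂`. -/
def fundamentals : List (ℤ × ℤ × ℤ × ℤ) :=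
  [(0, 0, 0, 0), (0, 1, 0, 0), (1, 1, 0, 0), (0, 2, 0, 0), (0, 0, 0, 1), (1, 0, 1, 0), (1, 0, 1, 1),
    (0, 1, -1, 0), (0, 1, 0, -1), (0, 2, -1, -1), (0, -1, 0, 0), (1, -1, 0, 0), (0, -2, 0, 0),
    (0, 0, 0, -1), (1, 0, -1, 0), (1, 0, -1, -1), (0, -1, 1, 0), (0, -1, 0, 1), (0, -2, 1, 1)]

theorem good_one_sub_of_mem {e a b c : ℤ} (h : (e, a, b, c) ∈ fundamentals) :
    Good val (1 - val (el e a b c)) := by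
  have h0 := RatFunc.X_ne_zero (K := ℚ)
  have h1 := ratFunc_X_sub_one_ne_zero
  have h2 := ratFunc_X_add_one_ne_zero
  -- The explicit arguments given to `aux` below are the exponents of `1 - x`.
  have aux : ∀ {e a b c : ℤ} (e' a' b' c' : ℤ), (el e a b c).val + (el e' a' b' c').val = 1 →
      Good val (1 - val (el e a b c)) := by
    intro e a b c e' a' b' c' h
    refine ⟨el e' a' b' c', ev_injective ?_⟩
    rw [map_sub, map_one, ev_val, ev_val]
    linear_combination h
  have e2 : ∀ x : RatFunc ℚ, x ^ (2 : ℤ) = x ^ 2 := fun x => by exact_mod_cast rfl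
  simp only [fundamentals, List.mem_cons, Prod.mk.injEq, List.not_mem_nil, or_false] at h
  rcases h with h | h | h | h | h | h | h | h | h | h | h | h | h | h | h | h | h | h | h <;>
    obtain ⟨rfl, rfl, rfl, rfl⟩ := h
  · refine ⟨0, ev_injective ?_⟩
    rw [map_sub, ev_val, ev_val, el_val]
    simp only [zpow_zero, map_one, mul_one, sub_self]
    rfl
  · refine aux 1 0 1 0 ?_; simp [el_val]
  · refine aux 0 0 0 1 ?_; simp [el_val]
  · refine aux 1 0 1 1 ?_; simp [el_val, e2]; ring
  · refine aux 1 1 0 0 ?_; simp [el_val]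
  · refine aux 0 1 0 0 ?_; simp [el_val]
  · refine aux 0 2 0 0 ?_; simp [el_val, e2]; ring
  · refine aux 1 0 (-1) 0 ?_; simp [el_val]; field_simp; ring
  · refine aux 0 0 0 (-1) ?_; simp [el_val]; field_simp
  · refine aux 1 0 (-1) (-1) ?_; simp [el_val, e2]; field_simp; ring
  · refine aux 0 (-1) 1 0 ?_; simp [el_val]; field_simp; ring
  · refine aux 0 (-1) 0 1 ?_; simp [el_val]; field_simp; ring
  · refine aux 0 (-2) 1 1 ?_; simp [el_val, zpow_neg, e2]; field_simp; ring
  · refine aux 0 1 0 (-1) ?_; simp [el_val]; field_simp; ring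
  · refine aux 0 1 (-1) 0 ?_; simp [el_val]; field_simp; ring
  · refine aux 0 2 (-1) (-1) ?_; simp [el_val, e2]; field_simp; ring
  · refine aux 0 (-1) 0 0 ?_; simp [el_val]; field_simp; ring
  · refine aux 1 (-1) 0 0 ?_; simp [el_val]; field_simp; ring
  · refine aux 0 (-2) 0 0 ?_; simp [el_val, zpow_neg, e2]; field_simp; ring

theorem key_mem_of_exponents : ∀ j ∈ [1, 2], ∀ s ∈ GaussianUnits.exponents,
    ((j, s.1, s.2) : ℤ × ℤ × ℤ) ∈ fundamentals.map key := by decide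

/-- Apart from `1`, the first component is `ω` or `ω ^ 2` and the second is one of nine Gaussian
units; each of the eighteen pairs is the image of a listed element. -/
theorem key_mem {e a b c : ℤ} (h : Good prodVal (1 - prodVal (toProd (el e a b c)))) :
    key (e, a, b, c) ∈ fundamentals.map key := by
  obtain ⟨y, hy⟩ := h
  rw [prodVal_toProd_el] at hy
  by_cases hy0 : y = 0
  · have h1 : prodVal (toProd (el e a b c)) = prodVal (toProd (el 0 0 0 0)) := by
      rw [hy0, map_zero] at hy
      rw [prodVal_toProd_el, ← sub_eq_zero.1 hy.symm, prodVal_toProd_el]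
      simp only [sub_zero, mul_zero, add_zero, zpow_zero, mul_one]
      rfl
    rw [isEmbedding_prodVal.injective.eq_iff, toProd_el_eq_iff] at h1
    rw [h1]
    decide
  · obtain ⟨e', a', b', c', rfl⟩ := exists_eq_toProd_el hy0
    rw [prodVal_toProd_el, Prod.ext_iff] at hy
    obtain ⟨h1, h2⟩ := hy
    simp only [Prod.fst_sub, Prod.snd_sub, Prod.fst_one, Prod.snd_one] at h1 h2
    have hg := GaussianUnits.mem_exponents (k := 2 * e + a + b) (n := b + c)
      (l := 2 * e' + a' + b') (m := b' + c') (by rw [h2]; ring)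
    refine key_mem_of_exponents ((a - b - c) % 3) ?_ _ hg
    have h3 : ¬ 3 ∣ a - b - c := by
      intro h3
      rw [(omega_zpow_eq_one_iff _).2 h3, sub_self] at h1
      exact zpow_ne_zero _ omega_ne_zero h1
    simp only [List.mem_cons, List.not_mem_nil, or_false]
    omega

theorem neg_one_zpow_cases (e : ℤ) :
    ∃ ε : ℤ, (ε = 1 ∨ ε = -1) ∧ ((-1 : ℚ) ^ e = ε) := by
  rcases Int.even_or_odd e with h | h
  · exact ⟨1, Or.inl rfl, by simp [h.neg_one_zpow]⟩
  · exact ⟨-1, Or.inr rfl, by simp [h.neg_one_zpow]⟩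

/-- At a rational `z` for which `z`, `z - 1`, `z + 1` are `{2, 3}`-units, `x` and `1 - x` specialise
to such units with sum one. Excluding `x = 1` keeps the second one nonzero. -/
theorem mem_exponents_of_ev {z : ℚ} (hz : z * (z - 1) * (z + 1) ≠ 0)
    {s m n : ℤ → ℤ → ℤ → ℤ → ℤ} (hs : ∀ e a b c, (-1 : ℚ) ^ e * z ^ a * (z - 1) ^ b * (z + 1) ^ c =
      (-1) ^ s e a b c * 2 ^ m e a b c * 3 ^ n e a b c) {e a b c : ℤ} (h1 : el e a b c ≠ 1)
    (h : Good val (1 - val (el e a b c))) : (m e a b c, n e a b c) ∈ UnitEquation.exponents := by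
  obtain ⟨q, hq⟩ := h
  have hq0 : q ≠ 0 := by
    rintro rfl
    rw [map_zero] at hq
    exact h1 (isEmbedding_val.injective (by rw [map_one, ← sub_eq_zero.1 hq.symm]))
  obtain ⟨e', a', b', c', rfl⟩ := exists_eq_el hq0
  have hq' := congrArg (ev z hz) hq
  rw [map_sub, map_one, ev_val_el, ev_val_el, hs, hs] at hq'
  obtain ⟨ε, hε, e1⟩ := neg_one_zpow_cases (s e a b c)
  obtain ⟨δ, hδ, e2⟩ := neg_one_zpow_cases (s e' a' b' c')
  rw [e1, e2] at hq'
  exact UnitEquation.mem_exponents hε hδ (by rw [hq']; ring)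

/-- Here `p` and `q` are the exponent pairs at `α = 2` and `α = 1/2`, namely `(a, c)` and `(-a - b -
c, c)`. They determine `b`, and the further pair is the one at `α = 3`. The condition on `key` uses
that the image is fundamental and different from `1`. -/
theorem mem_fundamentals_of_exponents : ∀ p ∈ UnitEquation.exponents,
    ∀ q ∈ UnitEquation.exponents, p.2 = q.2 →
      (p.2 - q.1 - p.1, p.1) ∈ UnitEquation.exponents → ∀ e ∈ ([0, 1] : List ℤ),
        key (e, p.1, -q.1 - p.1 - p.2, p.2) ∈ fundamentals.map key →
          key (e, p.1, -q.1 - p.1 - p.2, p.2) ≠ 0 → (e, p.1, -q.1 - p.1 - p.2, p.2) ∈ fundamentals := by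
  decide

theorem map_add_toProd {p q r : TwoCyclotomicPF} (h : val r = val p + val q) :
    prodVal (toProd r) = prodVal (toProd p) + prodVal (toProd q) := by
  rw [prodVal_toProd, prodVal_toProd, prodVal_toProd, h, map_add]

theorem good_map_one_sub {q : TwoCyclotomicPF} (h : Good val (1 - val q)) :
    Good prodVal (1 - prodVal (toProd q)) := by
  obtain ⟨r, hr⟩ := h
  refine ⟨toProd r, ?_⟩
  rw [prodVal_toProd, prodVal_toProd, hr, map_sub, map_one]

theorem el_zero : el 0 0 0 0 = 1 := by
  simp [el]

/-- The element `1 - q` of `𝕂₂` maps to zero, and only zero does. -/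
theorem eq_one_of_toProd {q : TwoCyclotomicPF} (h : Good val (1 - val q)) (hq : toProd q = 1) :
    q = 1 := by
  obtain ⟨r, hr⟩ := h
  have hr' : toProd r = 0 := isEmbedding_prodVal.injective (by
    rw [prodVal_toProd, hr, map_sub, ← prodVal_toProd, hq]
    simp)
  rw [(map_eq_zero toProd).1 hr', map_zero] at hr
  exact isEmbedding_val.injective (by rw [map_one, ← sub_eq_zero.1 hr.symm])

theorem mem_fundamentals {e a b c : ℤ} (h1 : el e a b c ≠ 1)
    (h : Good val (1 - val (el e a b c))) : (e % 2, a, b, c) ∈ fundamentals := by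
  have hk' : key (e % 2, a, b, c) ∈ fundamentals.map key := by
    have : key (e % 2, a, b, c) = key (e, a, b, c) := by
      simp only [key, Prod.mk.injEq, true_and, and_true]
      omega
    rw [this]
    exact key_mem (good_map_one_sub h)
  have e4 : ∀ c : ℤ, (4 : ℚ) ^ c = 2 ^ (2 * c) := fun c => by
    rw [zpow_mul]
    norm_num
  have e12 : ∀ c : ℤ, (1 / 2 : ℚ) ^ c = 2 ^ (-c) := fun c => by
    rw [one_div, inv_zpow, zpow_neg]
  have hk0 : key (e % 2, a, b, c) ≠ 0 := by
    intro h0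
    refine h1 (eq_one_of_toProd h ?_)
    rw [← el_emod_two, ← map_one toProd, ← el_zero, toProd_el_eq_iff, h0]
    rfl
  have c2 := mem_exponents_of_ev (z := 2) (by norm_num) (s := fun e _ _ _ => e)
    (m := fun _ a _ _ => a) (n := fun _ _ _ c => c) (by intros; norm_num) h1 h
  have c12 := mem_exponents_of_ev (z := 1 / 2) (by norm_num) (s := fun e _ b _ => e + b)
    (m := fun _ a b c => -a - b - c) (n := fun _ _ _ c => c) (by
      intro e a b c
      have t1 : (1 / 2 - 1 : ℚ) = -1 * (1 / 2) := by norm_num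
      have t2 : (1 / 2 + 1 : ℚ) = 3 * (1 / 2) := by norm_num
      rw [t1, t2, mul_zpow, mul_zpow, e12, e12, e12, sub_eq_add_neg, sub_eq_add_neg,
        zpow_add₀ (by norm_num), zpow_add₀ (by norm_num), zpow_add₀ (by norm_num)]
      ring) h1 h
  have c3 := mem_exponents_of_ev (z := 3) (by norm_num) (s := fun e _ _ _ => e)
    (m := fun _ _ b c => b + 2 * c) (n := fun _ a _ _ => a) (by
      intro e a b c
      have t1 : (3 - 1 : ℚ) = 2 := by norm_num
      have t2 : (3 + 1 : ℚ) = 4 := by norm_num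
      rw [t1, t2, e4, zpow_add₀ (by norm_num)]
      ring) h1 h
  have := mem_fundamentals_of_exponents _ c2 _ c12 rfl (by
    simp only at c3 ⊢
    convert c3 using 2
    ring) (e % 2) (by
      simp only [List.mem_cons, List.not_mem_nil, or_false]
      omega)
  simp only at this
  rw [show -(-a - b - c) - a - c = b by ring] at this
  exact this hk' hk0

theorem exists_mem_fundamentals {q : TwoCyclotomicPF} (hq : q ≠ 0) (h : Good val (1 - val q)) :
    ∃ e a b c, (e, a, b, c) ∈ fundamentals ∧ q = el e a b c := by
  by_cases h1 : q = 1
  · exact ⟨0, 0, 0, 0, by decide, by rw [h1, el_zero]⟩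
  obtain ⟨e, a, b, c, rfl⟩ := exists_eq_el hq
  exact ⟨e % 2, a, b, c, mem_fundamentals h1 h, (el_emod_two ..).symm⟩

theorem fundamentals_inj : ∀ s ∈ fundamentals, ∀ t ∈ fundamentals, key s = key t → s = t := by
  decide

/-- The exponent of `-1` matters only modulo two; it is reduced to match the normal form of the
list. -/
theorem fundamentals_div : ∀ s ∈ fundamentals, ∀ t ∈ fundamentals,
    key (s.1 - t.1, s.2.1 - t.2.1, s.2.2.1 - t.2.2.1, s.2.2.2 - t.2.2.2) ∈ fundamentals.map key →
      ((s.1 - t.1) % 2, s.2.1 - t.2.1, s.2.2.1 - t.2.2.1, s.2.2.2 - t.2.2.2) ∈ fundamentals := by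
  decide

theorem fundamentals_neg : ∀ s ∈ fundamentals,
    key (s.1 - 1, s.2.1, s.2.2.1, s.2.2.2) ∈ fundamentals.map key →
      ((s.1 - 1) % 2, s.2.1, s.2.2.1, s.2.2.2) ∈ fundamentals := by
  decide

theorem isLifting_toProd : IsLifting val prodVal toProd where
  injQ := isEmbedding_val.injective
  injP := isEmbedding_prodVal.injective
  negQ := isEmbedding_val.good_neg_one
  negP := isEmbedding_prodVal.good_neg_one
  map_add p q r := map_add_toProd
  surj x := by
    by_cases hx : x = 0
    · exact ⟨0, by rw [map_zero, hx]⟩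
    · obtain ⟨e, a, b, c, rfl⟩ := exists_eq_toProd_el hx
      exact ⟨_, rfl⟩
  exists_fund x h := by
    by_cases hx : x = 0
    · exact ⟨0, by rw [map_zero, sub_zero]; exact good_one, by rw [map_zero, hx]⟩
    · obtain ⟨e, a, b, c, rfl⟩ := exists_eq_toProd_el hx
      obtain ⟨⟨e', a', b', c'⟩, ht, hk⟩ := List.mem_map.1 (key_mem h)
      exact ⟨el e' a' b' c', good_one_sub_of_mem ht, (toProd_el_eq_iff ..).2 hk⟩
  inj_fund p q hp hq h := by
    by_cases hp0 : p = 0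
    · rw [hp0, map_zero, eq_comm, map_eq_zero] at h
      rw [hp0, h]
    by_cases hq0 : q = 0
    · rw [hq0, map_zero, map_eq_zero] at h
      rw [hq0, h]
    obtain ⟨e, a, b, c, hs, rfl⟩ := exists_mem_fundamentals hp0 hp
    obtain ⟨e', a', b', c', ht, rfl⟩ := exists_mem_fundamentals hq0 hq
    have := fundamentals_inj _ hs _ ht ((toProd_el_eq_iff ..).1 h)
    simp only [Prod.mk.injEq] at this
    obtain ⟨rfl, rfl, rfl, rfl⟩ := this
    rfl
  div_fund p q hp0 hq0 hp hq h := by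
    obtain ⟨e, a, b, c, hs, rfl⟩ := exists_mem_fundamentals hp0 hp
    obtain ⟨e', a', b', c', ht, rfl⟩ := exists_mem_fundamentals hq0 hq
    rw [el_div] at h ⊢
    rw [← el_emod_two]
    exact good_one_sub_of_mem (fundamentals_div _ hs _ ht (key_mem h))
  neg_fund t ht h := by
    by_cases ht0 : t = 0
    · rw [ht0, map_zero, sub_zero]
      exact good_one
    -- The factor `el 1 0 0 0` is `-1`, so this is the fundamental element `-t`.
    obtain ⟨e, a, b, c, hs, he⟩ := exists_mem_fundamentals (q := el 1 0 0 0 * t)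
      (mul_ne_zero (el_ne_zero 1 0 0 0) ht0) (by
        have : val (el 1 0 0 0 * t) = -val t := by
          apply ev_injective
          rw [map_mul, map_mul, map_neg, ev_val, el_val]
          simp
        rwa [this, sub_neg_eq_add])
    obtain rfl : t = el (e - 1) a b c := by
      rw [mul_comm, ← eq_div_iff (el_ne_zero 1 0 0 0), el_div] at he
      simpa using he
    rw [← el_emod_two]
    exact good_one_sub_of_mem (fundamentals_neg _ hs (key_mem h))

end TwoCyclotomic

theorem mainTheorem11 {α : Type*} (M : Matroid α) [M.Finite] :
    PartialField.IsRepresentable (ProdPartialField GF4 GaussianPF) M ↔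
      PartialField.IsRepresentable TwoCyclotomicPF M :=
  PartialField.isRepresentable_iff_of_isLifting TwoCyclotomic.isEmbedding_prodVal
    TwoCyclotomic.isEmbedding_val TwoCyclotomic.isLifting_toProd TwoCyclotomic.evProd
    (fun q => (TwoCyclotomic.prodVal_toProd q).symm) M
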